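/- **Setting.** Let $\mathcal U\subset\mathbb R^2$ be a bounded open set containing the origin $O$, and put $\Sigma=\{(x,y)\in\mathcal U:y=0\}$, $\Sigma^\pm=\{(x,y)\in\mathcal U:\pm y>0\}$. For $C^\infty$ functions $f^\pm,g^\pm$ on $\mathbb R^2$ consider the piecewise-smooth system $(\dot x,\dot y)=(f^\pm,g^\pm)$ on $\Sigma^\pm$. A point $p\in\Sigma$ is a *crossing point* ($p\in\Sigma_c$) if $g^+(p)g^-(p)>0$, and a *tangent point* if $g^+(p)g^-(p)=0$ and $f^\pm(p)\neq0$. A *nonsliding loop* is an oriented Jordan curve in $\mathcal U$ that is a cyclic concatenation of finitely many orbit segments of the two subsystems, oriented by time, each of which meets $\Sigma$ exactly at its two endpoints, such that at least one of these endpoints is a tangent point. A *switching point* is a point where the loop passes from one of the half-planes $y>0$, $y<0$ to the other. The loop is *of type $L^{cro}$* (crossing) if it has switching points and all of them are crossing points, and *of type $L^{cri}$* (critical) if it has switching points and not all of them are crossing points. The distance of two systems is $\rho=\sum d(X,Y)$, summed over the four pairs of component functions, with $d(X,Y)=\max_{\overline{\mathcal U}}\left(|X-Y|+|\partial_x(X-Y)|+|\partial_y(X-Y)|\right)$.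 Consider the system $$(\dot x,\dot y)=\left(f^\pm(x,y),\ \phi^\pm(x,y)\,x^{m^\pm}\right)\ \text{ on }\Sigma^\pm,\tag{1}$$ with $f^\pm,\phi^\pm\in C^\infty(\mathbb R^2)$, $f^\pm(O)\ne0$, $\phi^\pm(O)\neq0$ and integers $m^\pm\ge0$, $m^++m^-\ge1$. Let $m^*=\max\{m^+,m^-\}$. Assume that (1) has a loop $L_*^{cri}$ of type $L^{cri}$ satisfying (H) $L_*^{cri}$ is clockwise and meets $\Sigma$ at exactly two points: $P=(P_x,0)\in\Sigma_c$ with $P_x<0$, and $O$. Consider the unfolding $$(\dot x,\dot y)=\Big(f^\pm(x,y+\psi^\pm),\ \phi^\pm(x,y+\psi^\pm)\prod_{i=1}^{m^\pm}(x-\lambda_i^\pm)-f^\pm(x,y+\psi^\pm)\,\tfrac{d\psi^\pm}{dx}\Big)\ \text{ on }\Sigma^\pm,\tag{2}$$ with $\boldsymbol\lambda^\pm\in\mathbb R^{m^\pm}$ and $\psi^\pm=\psi(x,\boldsymbol k^\pm)$ of the following form, where $d\ge1$, $r_1<r_2$ and $\boldsymbol k\in\mathbb R^{3d+1}$ (with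 separate $d,r_1,r_2$ for each sign). If $k_1<k_2<\dots<k_{2d+1}$, then for $i=1,\dots,d$: $\psi=k_{2d+1+i}\,h^*(x,k_{2i-1},k_{2i})$ on $(k_{2i-1},k_{2i}]$, $\psi=k_{2d+1+i}\,h_*(x,k_{2i},k_{2i+1})$ on $(k_{2i},k_{2i+1}]$, and $\psi=0$ elsewhere; otherwise $\psi=k_{2d+2}\,h^*(x,r_1,r_2)$. Here $h^*(x,a,b)$ is $0$ for $x\le a$, $1/(1+e^{\eta})$ for $a<x<b$ and $1$ for $x\ge b$, where $\eta=\frac1{x-a}+\frac1{x-b}$, and $h_*(x,a,b)=1-h^*(x,a,b)$. For a type $C\in\{L^{cro},L^{cri}\}$ and $\ell\ge1$ say that *(2) has a bifurcating loop $C(\ell)$* if there are $d^\pm\ge 1$ and $r_1^\pm<r_2^\pm$ such that for every $\varepsilon>0$ there are $\boldsymbol\lambda^\pm,\boldsymbol k^\pm$ of norm less than $\varepsilon$, with $(\boldsymbol\lambda^+,\boldsymbol\lambda^-)\ne0$, for which (2) is a $C^\infty$ system at $\rho$-distance less than $\varepsilon$ from (1) and has a loop of type $C$ that is $\varepsilon$-close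 to $L_*^{cri}$ (each of the two loops lies in the $\varepsilon$-neighbourhood of the other) and that contains exactly $\ell$ tangent points, all at distance less than $\varepsilon$ from $O$. **Theorem.** (a) If $m^*=1$, no loop of type $L^{cro}$ bifurcates from $L_*^{cri}$: there is $\varepsilon>0$ such that no $C^\infty$ piecewise-smooth system at $\rho$-distance less than $\varepsilon$ from (1) has a loop of type $L^{cro}$ in the $\varepsilon$-neighbourhood of $L_*^{cri}$. If $m^*\ne1$, then for each $\ell\in\{1,\dots,\lfloor m^*/2\rfloor\}$ the unfolding (2) has a bifurcating loop $L^{cro}(\ell)$. (b) For each $\ell\in\{1,\dots,\lfloor(m^*+1)/2\rfloor\}$ the unfolding (2) has a bifurcating loop $L^{cri}(\ell)$. -/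

import Mathlib

open Set
open scoped ContDiff

noncomputable section

namespace Filippov

/-- The two sides of the switching line `y = 0`. -/
inductive Side
  | upper
  | lower

/-- The data `(f⁺, g⁺)`, `(f⁻, g⁻)` of a planar piecewise-smooth vector field with switching
line `y = 0`. -/
structure PWS where
  f : Side → ℝ × ℝ → ℝ
  g : Side → ℝ × ℝ → ℝ

/-- All four component functions are `C^∞` on the plane. -/
def PWS.Smooth (S : PWS) : Prop :=
  ∀ s, ContDiff ℝ ∞ (S.f s) ∧ ContDiff ℝ ∞ (S.g s)

/-- The vector field of one subsystem. -/
def PWS.field (S : PWS) (s : Side) (p : ℝ × ℝ) : ℝ × ℝ := (S.f s p, S.g s p)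

/-- The switching manifold `Σ` in the phase region `U`. -/
def switchLine (U : Set (ℝ × ℝ)) : Set (ℝ × ℝ) := {p | p ∈ U ∧ p.2 = 0}

/-- The open zones `Σ⁺` and `Σ⁻` of the phase region `U`. -/
def zone (U : Set (ℝ × ℝ)) : Side → Set (ℝ × ℝ)
  | .upper => {p | p ∈ U ∧ 0 < p.2}
  | .lower => {p | p ∈ U ∧ p.2 < 0}

/-- The crossing region `Σ_c`. -/
def PWS.crossing (S : PWS) (U : Set (ℝ × ℝ)) : Set (ℝ × ℝ) :=
  {p | p ∈ switchLine U ∧ 0 < S.g .upper p * S.g .lower p}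

/-- The tangent points. -/
def PWS.tangent (S : PWS) (U : Set (ℝ × ℝ)) : Set (ℝ × ℝ) :=
  {p | p ∈ switchLine U ∧ S.g .upper p * S.g .lower p = 0 ∧
    S.f .upper p ≠ 0 ∧ S.f .lower p ≠ 0}

/-- An oriented Jordan curve in `U` which is a cyclic concatenation of `n + 1` orbit segments
`γ i : [0, T i] → U` of the subsystems, each of which meets the switching line exactly at its two
endpoints. Every segment is parametrized and oriented by time. (Indices are cyclic:
in `Fin (n + 1)` the successor of the last index is `0`.) -/
structure Loop (S : PWS) (U : Set (ℝ × ℝ)) where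
  n : ℕ
  side : Fin (n + 1) → Side
  T : Fin (n + 1) → ℝ
  γ : Fin (n + 1) → ℝ → ℝ × ℝ
  T_pos : ∀ i, 0 < T i
  orbit : ∀ i, ∀ t ∈ Icc 0 (T i),
    HasDerivWithinAt (γ i) (S.field (side i) (γ i t)) (Icc 0 (T i)) t
  start_mem : ∀ i, γ i 0 ∈ switchLine U
  stop_mem : ∀ i, γ i (T i) ∈ switchLine U
  inside : ∀ i, ∀ t ∈ Ioo 0 (T i), γ i t ∈ zone U (side i)
  closes : ∀ i, γ i (T i) = γ (i + 1) 0
  simple : ∀ i j, ∀ s ∈ Ico 0 (T i), ∀ t ∈ Ico 0 (T j), γ i s = γ j t → i = j ∧ s = t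

namespace Loop

variable {S : PWS} {U : Set (ℝ × ℝ)}

/-- The underlying point set of the loop. -/
def carrier (L : Loop S U) : Set (ℝ × ℝ) := ⋃ i, L.γ i '' Icc 0 (L.T i)

/-- The tangent points lying on the loop. -/
def tangentPoints (L : Loop S U) : Set (ℝ × ℝ) := L.carrier ∩ S.tangent U

/-- The switching points: the points at which the loop enters one half-plane from the other. -/
def switchingPoints (L : Loop S U) : Set (ℝ × ℝ) :=
  {p | ∃ i, L.side i ≠ L.side (i + 1) ∧ p = L.γ (i + 1) 0}

/-- A nonsliding loop connecting tangent points: some junction point is a tangent point. -/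
def IsNonsliding (L : Loop S U) : Prop := ∃ i, L.γ i 0 ∈ S.tangent U

/-- The class `L^{cro}`. -/
def IsCro (L : Loop S U) : Prop :=
  L.IsNonsliding ∧ L.switchingPoints.Nonempty ∧ L.switchingPoints ⊆ S.crossing U

/-- The class `L^{cri}`. -/
def IsCri (L : Loop S U) : Prop :=
  L.IsNonsliding ∧ L.switchingPoints.Nonempty ∧ (L.switchingPoints \ S.crossing U).Nonempty

/-- Hypothesis (H): `L` is a critical loop which meets the switching line exactly at the crossing
point `P = (a, 0)`, `a < 0`, and at the origin, and it is clockwise. As `P` lies to the left of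
the origin, clockwise means that the part of the loop in the upper half-plane is run through from
`P` to the origin. -/
def HypH (L : Loop S U) (a : ℝ) : Prop :=
  L.IsCri ∧ a < 0 ∧ (a, 0) ∈ S.crossing U ∧
    L.carrier ∩ switchLine U = {(a, 0), (0, 0)} ∧
    ∃ i, L.side i = .upper ∧ L.γ i 0 = (a, 0) ∧ L.γ i (L.T i) = (0, 0)

end Loop

/-- The `C^1` distance `d(X, Y)` on the closure of `U`. -/
def distC1 (U : Set (ℝ × ℝ)) (X Y : ℝ × ℝ → ℝ) : ℝ :=
  sSup ((fun p => |X p - Y p| + |fderiv ℝ (fun q => X q - Y q) p (1, 0)|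
    + |fderiv ℝ (fun q => X q - Y q) p (0, 1)|) '' closure U)

/-- The distance `ρ` of two piecewise-smooth vector fields. -/
def rho (U : Set (ℝ × ℝ)) (S S' : PWS) : ℝ :=
  distC1 U (S.f .upper) (S'.f .upper) + distC1 U (S.g .upper) (S'.g .upper)
    + distC1 U (S.f .lower) (S'.f .lower) + distC1 U (S.g .lower) (S'.g .lower)

/-- The system with `y`-components `φ^±(x,y) x^{m^±}`. -/
def baseSystem (f φ : Side → ℝ × ℝ → ℝ) (m : Side → ℕ) : PWS where
  f := f
  g := fun s p => φ s p * p.1 ^ m s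

/-- The increasing cutoff function `h^*`. -/
def cutUp (x r₁ r₂ : ℝ) : ℝ :=
  if x ≤ r₁ then 0
  else if x < r₂ then 1 / (1 + Real.exp (1 / (x - r₁) + 1 / (x - r₂)))
  else 1

/-- The decreasing cutoff function `h_*`. -/
def cutDown (x r₁ r₂ : ℝ) : ℝ :=
  if x ≤ r₁ then 1
  else if x < r₂ then
    Real.exp (1 / (x - r₁) + 1 / (x - r₂)) / (1 + Real.exp (1 / (x - r₁) + 1 / (x - r₂)))
  else 0

/-- The parameter set `𝒦`: the first `2d + 1` entries of `k` increase strictly. -/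
def paramK (d : ℕ) : Set (Fin (3 * d + 1) → ℝ) :=
  {k | ∀ i : Fin (2 * d), k ⟨i, by omega⟩ < k ⟨i + 1, by omega⟩}

/-- The `i`-th bump of `ψ^*`, supported in `[k_{2i-1}, k_{2i+1}]` with height `k_{2d+1+i}` (entries
of `k` counted from `1`, and `i = 1, …, d`; in the code everything is counted from `0`). -/
def bump (d : ℕ) (k : Fin (3 * d + 1) → ℝ) (i : Fin d) (x : ℝ) : ℝ :=
  if k ⟨2 * i, by omega⟩ < x ∧ x ≤ k ⟨2 * i + 1, by omega⟩ then
    k ⟨2 * d + 1 + i, by omega⟩ * cutUp x (k ⟨2 * i, by omega⟩) (k ⟨2 * i + 1, by omega⟩)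
  else if k ⟨2 * i + 1, by omega⟩ < x ∧ x ≤ k ⟨2 * i + 2, by omega⟩ then
    k ⟨2 * d + 1 + i, by omega⟩ * cutDown x (k ⟨2 * i + 1, by omega⟩) (k ⟨2 * i + 2, by omega⟩)
  else 0

open Classical in
/-- The functional function `ψ(x, k)`, `k ∈ ℝ^{3d+1}`, `d ≥ 1`, with fixed numbers `r₁ < r₂`. For
`k ∈ 𝒦` the bumps live on disjoint intervals, so their sum is the piecewise definition. -/
def psi (d : ℕ) (hd : 0 < d) (r₁ r₂ : ℝ) (k : Fin (3 * d + 1) → ℝ) (x : ℝ) : ℝ :=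
  if k ∈ paramK d then ∑ i : Fin d, bump d k i x
  else k ⟨2 * d + 1, by omega⟩ * cutUp x r₁ r₂

/-- The unfolding with zeros `lam s i` and functional functions `Ψ s`. -/
def unfolding (f φ : Side → ℝ × ℝ → ℝ) (m : Side → ℕ) (lam : (s : Side) → Fin (m s) → ℝ)
    (Ψ : Side → ℝ → ℝ) : PWS where
  f := fun s p => f s (p.1, p.2 + Ψ s p.1)
  g := fun s p => φ s (p.1, p.2 + Ψ s p.1) * ∏ i, (p.1 - lam s i)
    - f s (p.1, p.2 + Ψ s p.1) * deriv (Ψ s) p.1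

/-- Loops of the class `C` with exactly `ℓ` tangent points bifurcate from `L₀` within the
unfolding: for suitable families `ψ^±(x, k^±)` of functional functions there are arbitrarily small
parameters, with `λ` not identically zero, for which the unfolding is an arbitrarily small
perturbation of the given system and has a loop of the class `C` arbitrarily close to `L₀` (in the
Hausdorff sense) which contains exactly `ℓ` tangent points, all of them arbitrarily close to the
origin. -/
def Bifurcates (U : Set (ℝ × ℝ)) (f φ : Side → ℝ × ℝ → ℝ) (m : Side → ℕ)
    (L₀ : Loop (baseSystem f φ m) U) (C : (S : PWS) → Loop S U → Prop) (ℓ : ℕ) : Prop :=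
  ∃ (d : Side → ℕ) (hd : ∀ s, 0 < d s) (r₁ r₂ : Side → ℝ), (∀ s, r₁ s < r₂ s) ∧
    ∀ ε : ℝ, 0 < ε →
      ∃ (lam : (s : Side) → Fin (m s) → ℝ) (k : (s : Side) → Fin (3 * d s + 1) → ℝ) (S : PWS),
        S = unfolding f φ m lam (fun s => psi (d s) (hd s) (r₁ s) (r₂ s) (k s)) ∧
        (∃ s, lam s ≠ 0) ∧ (∀ s, ‖lam s‖ < ε) ∧ (∀ s, ‖k s‖ < ε) ∧
        S.Smooth ∧ rho U (baseSystem f φ m) S < ε ∧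
        ∃ L : Loop S U, C S L ∧
          L.carrier ⊆ Metric.thickening ε L₀.carrier ∧
          L₀.carrier ⊆ Metric.thickening ε L.carrier ∧
          L.tangentPoints.encard = ℓ ∧ L.tangentPoints ⊆ Metric.ball (0, 0) ε

end Filippov

end

/-!
A loop that satisfies (H) consists of an upper arc from the crossing point `P` to the origin and a
lower arc back (`Loop.HypH.exists_arcs`). Since one arc reaches the origin and the other leaves
it, the signs of the vertical speeds near the origin are determined there (`Arcs.lower_sign`,
`Arcs.upper_sign`). Reflection in the switching line combined with time reversal exchanges the two
sides, so in each argument one side may be taken as the upper one (`Loop.reflect`,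
`Arcs.bifurcatesFrom_of_upper`).

For `m^* = 1` a crossing loop close to the given one would contain a tangent point that is not a
switching point, necessarily close to the origin and with `m = 1` on the side of the loop there,
say the upper one. The upper orbit of the unperturbed system through the origin moves on into the
upper half-plane, to a point off the loop (`Arcs.exists_exit`). The orbit of the perturbed system
issuing from the tangent point follows it, as it cannot return to the switching line earlier:
beyond the tangent point the field points upward there. So the loop leaves the neighbourhood
(`Arcs.no_upper_touch`).

For the existence of loops, the shear `Y = y + ψ(x)` turns a subsystem of the unfolding into the
field `(f, φ ∏ (x - λ_i))`, with the graph of `ψ` as the switching line. On the side with the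
larger `m`, say the upper one, a curve `Y(x)` near the origin then has critical points exactly at
the `λ_i`, and a contact with the graph of `ψ` below it is a tangent point or the point where the
loop crosses to the other half-plane. On the lower side all `λ_i` are zero, and `ψ` is a step of a
small height `κ` between `P` and the origin. This height is the one free parameter needed to close
the loop: the lower orbit that ends where the upper one starts, near `P`, passes over the abscissa
of the last contact at a small height, and `κ` is chosen as this height
(`Arcs.exists_lower_return`, `Arcs.exists_loop`). So only contacts near the origin have to be
produced, for an orbit through a prescribed point.

The zeros are put at equidistant knots of distance `w`, so that the curve has minima at the odd
knots (`knot_minima`), and `ψ` is a train of bumps of width `w` centred there, whose heights are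
the minimal values; the bumps then touch the curve exactly at the odd knots (`touches_of_bumps`).
If an odd number of zeros is spread over the knots, the last contact is a tangency, too, and the
loop is critical; if the number is even, it is transverse and the loop is crossing. The other
zeros are put at a knot beyond the last contact. As the cutoff functions are not scaling
invariant, the second derivative of a bump of height `H` is of order `H / w^4`, so the heights
have to be `O(w^5)`. This is clear for a single bump, and for `m ≥ 4`, where the slope of the
curve is `O(w^4)`. For `m = 3` and two bumps it holds because three equidistant zeros make the
leading part of the slope odd about the middle one (`levelBound_three`). The remaining case is a
crossing loop with one tangent point and `m ≥ 2`: here `ψ = 0`, and the orbit touches the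
switching line at the first of two close zeros and crosses it soon after the second
(`exists_first_return`).
-/

/-! ### Ordinary differential equations: existence, shadowing, uniqueness, extension -/

section ODE

variable {E : Type*} [NormedAddCommGroup E] [NormedSpace ℝ E]

/-- A bounded Lipschitz field has solutions on every compact time interval. -/
theorem exists_solution_of_lipschitz_bounded [CompleteSpace E] {V : E → E} {K : NNReal} {M : ℝ}
    (hV : LipschitzWith K V) (hM : ∀ z, ‖V z‖ ≤ M) {a b t₀ : ℝ} (ht₀ : t₀ ∈ Icc a b) (z₀ : E) :
    ∃ Γ : ℝ → E, Γ t₀ = z₀ ∧ ∀ t ∈ Icc a b, HasDerivAt Γ (V (Γ t)) t := by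
  have hM0 : 0 ≤ M := (norm_nonneg _).trans (hM z₀)
  have hmem : t₀ ∈ Icc (a - 1) (b + 1) := ⟨by linarith [ht₀.1], by linarith [ht₀.2]⟩
  have hL : 0 ≤ max (b + 1 - t₀) (t₀ - (a - 1)) := le_max_of_le_left (by linarith [ht₀.2])
  have hpl : IsPicardLindelof (fun _ => V) (⟨t₀, hmem⟩ : Icc (a - 1) (b + 1)) z₀
      (M * max (b + 1 - t₀) (t₀ - (a - 1))).toNNReal 0 M.toNNReal K := by
    refine IsPicardLindelof.of_time_independent (fun x _ => ?_) (hV.lipschitzOnWith) ?_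
    · rw [Real.coe_toNNReal _ hM0]; exact hM x
    · rw [Real.coe_toNNReal _ hM0, Real.coe_toNNReal _ (mul_nonneg hM0 hL), NNReal.coe_zero,
        sub_zero]
  obtain ⟨Γ, h0, h1⟩ := hpl.exists_eq_forall_mem_Icc_hasDerivWithinAt₀
  refine ⟨Γ, h0, fun t ht => ?_⟩
  exact (h1 t ⟨by linarith [ht.1], by linarith [ht.2]⟩).hasDerivAt
    (Icc_mem_nhds (by linarith [ht.1]) (by linarith [ht.2]))

/-- The Grönwall bound when the initial error and the defect are both `δ`. -/
theorem gronwallBound_diag_le {K : ℝ} (hK : 0 < K) {δ x L : ℝ} (hδ : 0 ≤ δ) (hx : x ≤ L) :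
    gronwallBound δ K (δ + 0) x ≤ δ * (Real.exp (K * L) * (1 + 1 / K)) := by
  rw [gronwallBound_of_K_ne_0 hK.ne']
  have h1 : Real.exp (K * x) ≤ Real.exp (K * L) := by gcongr
  have h2 : (δ + 0) / K * (Real.exp (K * x) - 1) ≤ δ / K * Real.exp (K * L) := by
    rw [add_zero]; gcongr; linarith
  have h3 : δ * Real.exp (K * x) ≤ δ * Real.exp (K * L) := by gcongr
  calc _ ≤ δ * Real.exp (K * L) + δ / K * Real.exp (K * L) := add_le_add h3 h2
    _ = _ := by field_simp

/-- Two-sided Grönwall estimate: an approximate trajectory of a Lipschitz field stays close to a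
trajectory, forward and backward in time. -/
theorem dist_le_of_approx_trajectory {V : E → E} {K : NNReal} (hV : LipschitzWith K V)
    {a b t₀ δ : ℝ} (ht₀ : t₀ ∈ Icc a b) {Γ Γ₀ Γ' : ℝ → E}
    (hΓ : ∀ t ∈ Icc a b, HasDerivWithinAt Γ (Γ' t) (Icc a b) t)
    (hΓ' : ∀ t ∈ Icc a b, dist (Γ' t) (V (Γ t)) ≤ δ)
    (hΓ₀ : ∀ t ∈ Icc a b, HasDerivWithinAt Γ₀ (V (Γ₀ t)) (Icc a b) t)
    (h0 : dist (Γ t₀) (Γ₀ t₀) ≤ δ) :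
    ∀ t ∈ Icc a b, dist (Γ t) (Γ₀ t) ≤
      δ * (Real.exp ((K + 1) * (b - a)) * (1 + 1 / ((K : ℝ) + 1))) := by
  have hδ : 0 ≤ δ := dist_nonneg.trans h0
  have hK : (0 : ℝ) < (K : ℝ) + 1 := by positivity
  have hVK : LipschitzWith (K + 1) V := hV.weaken (by simp)
  have hnV : LipschitzWith (K + 1) (fun z => - V z) := hVK.neg
  intro t ht
  rcases le_total t₀ t with h | h
  · have key := dist_le_of_approx_trajectories_ODE (v := fun _ => V) (K := K + 1) (f := Γ) (g := Γ₀)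
      (f' := Γ') (g' := fun t => V (Γ₀ t)) (a := t₀) (b := b) (εf := δ) (εg := 0) (δ := δ)
      (fun _ => hVK)
      (fun s hs => ((hΓ s ⟨ht₀.1.trans hs.1, hs.2⟩).continuousWithinAt.mono
        (Icc_subset_Icc_left ht₀.1)))
      (fun s hs => ((hΓ s ⟨ht₀.1.trans hs.1, hs.2.le⟩).mono
        (Icc_subset_Icc_left (ht₀.1.trans hs.1))).mono_of_mem_nhdsWithin
          (Icc_mem_nhdsGE hs.2))
      (fun s hs => hΓ' s ⟨ht₀.1.trans hs.1, hs.2.le⟩)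
      (fun s hs => ((hΓ₀ s ⟨ht₀.1.trans hs.1, hs.2⟩).continuousWithinAt.mono
        (Icc_subset_Icc_left ht₀.1)))
      (fun s hs => ((hΓ₀ s ⟨ht₀.1.trans hs.1, hs.2.le⟩).mono
        (Icc_subset_Icc_left (ht₀.1.trans hs.1))).mono_of_mem_nhdsWithin
          (Icc_mem_nhdsGE hs.2))
      (fun s hs => by simp) h0 t ⟨h, ht.2⟩
    refine key.trans ?_
    have := gronwallBound_diag_le hK hδ (x := t - t₀) (L := b - a) (by linarith [ht₀.1, ht.2])
    simpa using this
  -- backward in time, by time reversal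
  · have hneg : ∀ {G : ℝ → E} {G' : E} {s : ℝ}, s ∈ Icc (-t₀) (-a) →
        HasDerivWithinAt G G' (Icc a b) (-s) →
        HasDerivWithinAt (fun s => G (-s)) (-G') (Icc (-t₀) (-a)) s := by
      intro G G' s hs hG
      have := HasDerivWithinAt.scomp s (h := fun s : ℝ => -s) (h' := -1)
        (s := Icc (-t₀) (-a)) hG ((hasDerivAt_neg s).hasDerivWithinAt)
        (fun u hu => ⟨by linarith [hu.2], by linarith [hu.1, ht₀.2]⟩)
      simpa [Function.comp_def] using this
    have hm : ∀ {s}, s ∈ Icc (-t₀) (-a) → -s ∈ Icc a b := fun {s} hs =>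
      ⟨by linarith [hs.2], by linarith [hs.1, ht₀.2]⟩
    have key := dist_le_of_approx_trajectories_ODE (v := fun _ z => - V z) (K := K + 1)
      (f := fun s => Γ (-s)) (g := fun s => Γ₀ (-s))
      (f' := fun s => - Γ' (-s)) (g' := fun s => - V (Γ₀ (-s))) (a := -t₀) (b := -a)
      (εf := δ) (εg := 0) (δ := δ) (fun _ => hnV)
      (fun s hs => (hneg hs (hΓ _ (hm hs))).continuousWithinAt)
      (fun s hs => ((hneg (Ico_subset_Icc_self hs) (hΓ _ (hm (Ico_subset_Icc_self hs)))).mono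
        (Icc_subset_Icc_left hs.1)).mono_of_mem_nhdsWithin (Icc_mem_nhdsGE hs.2))
      (fun s hs => by
        simpa only [dist_neg_neg] using hΓ' _ (hm (Ico_subset_Icc_self hs)))
      (fun s hs => (hneg hs (hΓ₀ _ (hm hs))).continuousWithinAt)
      (fun s hs => ((hneg (Ico_subset_Icc_self hs) (hΓ₀ _ (hm (Ico_subset_Icc_self hs)))).mono
        (Icc_subset_Icc_left hs.1)).mono_of_mem_nhdsWithin (Icc_mem_nhdsGE hs.2))
      (fun s hs => by simp) (by simpa using h0) (-t) ⟨by linarith, by linarith [ht.1]⟩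
    simp only [neg_neg] at key
    refine key.trans ?_
    have := gronwallBound_diag_le hK hδ (x := -t - -t₀) (L := b - a) (by linarith [ht₀.2, ht.1])
    simpa using this

/-- A smooth cutoff, equal to `1` on the ball of radius `R + 1` and to `0` off the ball of radius
`R + 2`; multiplication with it makes a `C^1` field bounded and Lipschitz. -/
theorem exists_cutoff [FiniteDimensional ℝ E] {R : ℝ} (hR : 0 ≤ R) :
    ∃ χ : E → ℝ, (∀ z, |χ z| ≤ 1) ∧ (∀ z, ‖z‖ ≤ R + 1 → χ z = 1) ∧
      (∀ z, ¬ ‖z‖ ≤ R + 2 → χ z = 0) ∧ ∀ V : E → E, ContDiff ℝ 1 V →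
        ∃ (K : NNReal) (M : ℝ), LipschitzWith K (fun z => χ z • V z) ∧ ∀ z, ‖χ z • V z‖ ≤ M := by
  let χ : ContDiffBump (0 : E) := ⟨R + 1, R + 2, by linarith, by linarith⟩
  refine ⟨χ, fun z => by rw [abs_of_nonneg χ.nonneg]; exact χ.le_one, fun z hz =>
    χ.one_of_mem_closedBall (by simpa using hz), fun z hz =>
    χ.zero_of_le_dist (by simpa using (not_le.1 hz).le), fun V hV => ?_⟩
  have hL : ContDiff ℝ 1 (fun z => χ z • V z) := χ.contDiff.smul hV
  obtain ⟨K, hK⟩ := hL.lipschitzWith_of_hasCompactSupport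
    (χ.hasCompactSupport.smul_right) (by simp)
  obtain ⟨M, hM⟩ := hL.continuous.bounded_above_of_compact_support
    (χ.hasCompactSupport.smul_right)
  exact ⟨K, M, hK, hM⟩

/-- Two trajectories of a `C^1` field on the same time interval which meet at one time agree. -/
theorem eqOn_of_trajectories {V : E → E} (hV : ContDiff ℝ 1 V) {a b t₀ : ℝ}
    (ht₀ : t₀ ∈ Icc a b) {Γ Γ₀ : ℝ → E}
    (hΓ : ∀ t ∈ Icc a b, HasDerivWithinAt Γ (V (Γ t)) (Icc a b) t)
    (hΓ₀ : ∀ t ∈ Icc a b, HasDerivWithinAt Γ₀ (V (Γ₀ t)) (Icc a b) t)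
    (h0 : Γ t₀ = Γ₀ t₀) [FiniteDimensional ℝ E] : EqOn Γ Γ₀ (Icc a b) := by
  have hc : ContinuousOn Γ (Icc a b) := fun t ht => (hΓ t ht).continuousWithinAt
  have hc₀ : ContinuousOn Γ₀ (Icc a b) := fun t ht => (hΓ₀ t ht).continuousWithinAt
  obtain ⟨R, hR⟩ := (isCompact_Icc.image_of_continuousOn hc).isBounded.exists_norm_le
  obtain ⟨R₀, hR₀⟩ := (isCompact_Icc.image_of_continuousOn hc₀).isBounded.exists_norm_le
  obtain ⟨χ, -, hχ1, -, hχ⟩ := exists_cutoff (E := E) (le_max_right (max R R₀) 0)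
  obtain ⟨K, M, hK, -⟩ := hχ V hV
  have h1 : ∀ t ∈ Icc a b, χ (Γ t) = 1 := fun t ht =>
    hχ1 _ (by linarith [hR _ ⟨t, ht, rfl⟩, le_max_left (max R R₀) 0, le_max_left R R₀])
  have h2 : ∀ t ∈ Icc a b, χ (Γ₀ t) = 1 := fun t ht =>
    hχ1 _ (by linarith [hR₀ _ ⟨t, ht, rfl⟩, le_max_left (max R R₀) 0, le_max_right R R₀])
  intro t ht
  have := dist_le_of_approx_trajectory hK ht₀ (Γ₀ := Γ₀) (δ := 0) hΓ
    (fun t ht => by simp [h1 t ht])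
    (fun t ht => by simpa [h2 t ht] using hΓ₀ t ht) (by simp [h0]) t ht
  simpa using this

/-- Continuous dependence: trajectories of a field `C^0`-close to `V` that start close to a
trajectory `Γ₀` of `V` exist as long as `Γ₀` does, and stay close to it. -/
theorem exists_shadowing [FiniteDimensional ℝ E] {V : E → E} (hV : ContDiff ℝ 1 V)
    {a b t₀ : ℝ} (ht₀ : t₀ ∈ Icc a b)
    {Γ₀ : ℝ → E} (hΓ₀ : ∀ t ∈ Icc a b, HasDerivWithinAt Γ₀ (V (Γ₀ t)) (Icc a b) t)
    {R : ℝ} (hR : ∀ t ∈ Icc a b, ‖Γ₀ t‖ ≤ R) {ε : ℝ} (hε : 0 < ε) :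
    ∃ δ : ℝ, 0 < δ ∧ ∀ W : E → E, ContDiff ℝ 1 W → (∀ z, ‖z‖ ≤ R + 2 → ‖W z - V z‖ ≤ δ) →
      ∀ z₀, ‖z₀ - Γ₀ t₀‖ ≤ δ → ∃ Γ : ℝ → E, Γ t₀ = z₀ ∧
        (∀ t ∈ Icc a b, HasDerivAt Γ (W (Γ t)) t) ∧ ∀ t ∈ Icc a b, ‖Γ t - Γ₀ t‖ < ε := by
  have hR0 : 0 ≤ R := (norm_nonneg _).trans (hR t₀ ht₀)
  obtain ⟨χ, hχa, hχ1, hχ0, hχ⟩ := exists_cutoff (E := E) hR0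
  obtain ⟨K, -, hK, -⟩ := hχ V hV
  set C := Real.exp ((K + 1) * (b - a)) * (1 + 1 / ((K : ℝ) + 1)) with hC
  have hC0 : 0 < C := by positivity
  have hm : 0 < min ε 1 := by positivity
  refine ⟨min ε 1 / (2 * C), by positivity, fun W hW hWV z₀ hz₀ => ?_⟩
  obtain ⟨K', M, hK', hM⟩ := hχ W hW
  have := FiniteDimensional.complete ℝ E
  -- the trajectory is one of the cut-off field; staying near `Γ₀`, it never sees the cutoff
  obtain ⟨Γ, hΓ0, hΓ⟩ := exists_solution_of_lipschitz_bounded hK' hM ht₀ z₀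
  have hclose := dist_le_of_approx_trajectory hK ht₀ (δ := min ε 1 / (2 * C))
    (fun t ht => (hΓ t ht).hasDerivWithinAt)
    (fun t ht => by
      rw [dist_eq_norm, ← smul_sub, norm_smul]
      by_cases hz : ‖Γ t‖ ≤ R + 2
      · calc _ ≤ 1 * (min ε 1 / (2 * C)) := by
              gcongr
              · exact hχa _
              · exact hWV _ hz
          _ = _ := one_mul _
      · rw [hχ0 _ hz]; simp; positivity)
    (fun t ht => by
      have := hΓ₀ t ht
      rwa [← one_smul ℝ (V (Γ₀ t)), ← hχ1 (Γ₀ t) (by linarith [hR t ht])] at this)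
    (by rw [hΓ0, dist_eq_norm]; exact hz₀)
  have hclose' : ∀ t ∈ Icc a b, ‖Γ t - Γ₀ t‖ < min ε 1 := by
    intro t ht
    have := hclose t ht
    rw [dist_eq_norm, ← hC, show min ε 1 / (2 * C) * C = min ε 1 / 2 by field_simp] at this
    linarith
  refine ⟨Γ, hΓ0, fun t ht => ?_, fun t ht => (hclose' t ht).trans_le (min_le_left _ _)⟩
  have h1 : ‖Γ t‖ ≤ R + 1 := by
    have h2 := norm_add_le (Γ t - Γ₀ t) (Γ₀ t)
    rw [sub_add_cancel] at h2
    linarith [hR t ht, (hclose' t ht).trans_le (min_le_right ε 1)]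
  have := hΓ t ht
  rwa [hχ1 _ h1, one_smul] at this

/-- A trajectory on a compact interval extends a little beyond both ends. -/
theorem exists_extension [FiniteDimensional ℝ E] {V : E → E} (hV : ContDiff ℝ 1 V)
    {T : ℝ} (hT : 0 < T) {γ : ℝ → E}
    (hγ : ∀ t ∈ Icc 0 T, HasDerivWithinAt γ (V (γ t)) (Icc 0 T) t) :
    ∃ (τ : ℝ) (Γ : ℝ → E), 0 < τ ∧ (∀ t ∈ Icc (-τ) (T + τ), HasDerivAt Γ (V (Γ t)) t) ∧
      EqOn Γ γ (Icc 0 T) := by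
  have hc : ContinuousOn γ (Icc 0 T) := fun t ht => (hγ t ht).continuousWithinAt
  obtain ⟨R, hR⟩ := (isCompact_Icc.image_of_continuousOn hc).isBounded.exists_norm_le
  have hR0 : 0 ≤ R := (norm_nonneg _).trans (hR _ ⟨0, ⟨le_rfl, hT.le⟩, rfl⟩)
  obtain ⟨χ, -, hχ1, -, hχ⟩ := exists_cutoff (E := E) hR0
  obtain ⟨K, M, hK, hM⟩ := hχ V hV
  have := FiniteDimensional.complete ℝ E
  obtain ⟨Γ, hΓ0, hΓ⟩ := exists_solution_of_lipschitz_bounded hK hM (a := -1) (b := T + 1)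
    (t₀ := 0) ⟨by linarith, by linarith⟩ (γ 0)
  have heq : EqOn Γ γ (Icc 0 T) := by
    intro t ht
    have := dist_le_of_approx_trajectory hK (t₀ := 0) (Γ := Γ) (Γ₀ := γ) (δ := 0)
      ⟨le_rfl, hT.le⟩
      (fun t ht => (hΓ t ⟨by linarith [ht.1], by linarith [ht.2]⟩).hasDerivWithinAt)
      (fun t ht => by simp) (fun t ht => ?_) (by simp [hΓ0]) t ht
    · simpa using this
    rw [hχ1 _ ((hR _ ⟨t, ht, rfl⟩).trans (by linarith)), one_smul]
    exact hγ t ht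
  have hloc : ∀ s ∈ Icc 0 T, ∃ τ > 0, ∀ t, |t - s| ≤ τ → ‖Γ t‖ ≤ R + 1 := by
    intro s hs
    have hcs : ContinuousAt Γ s :=
      (hΓ s ⟨by linarith [hs.1], by linarith [hs.2]⟩).continuousAt
    have hlt : ‖Γ s‖ < R + 1 := by
      rw [heq hs]; linarith [hR _ ⟨s, hs, rfl⟩]
    have := (hcs.norm.eventually_lt_const hlt)
    obtain ⟨d, hd, hd'⟩ := Metric.eventually_nhds_iff.1 this
    exact ⟨d / 2, by positivity, fun t ht =>
      (hd' (by rw [Real.dist_eq]; linarith)).le⟩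
  obtain ⟨τ₁, h₁, h₁'⟩ := hloc 0 ⟨le_rfl, hT.le⟩
  obtain ⟨τ₂, h₂, h₂'⟩ := hloc T ⟨hT.le, le_rfl⟩
  refine ⟨min (min τ₁ τ₂) 1, Γ, by positivity, fun t ht => ?_, heq⟩
  have ha : min (min τ₁ τ₂) 1 ≤ τ₁ := (min_le_left _ _).trans (min_le_left _ _)
  have hb : min (min τ₁ τ₂) 1 ≤ τ₂ := (min_le_left _ _).trans (min_le_right _ _)
  have hc : min (min τ₁ τ₂) 1 ≤ 1 := min_le_right _ _
  have h1 : ‖Γ t‖ ≤ R + 1 := by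
    rcases lt_or_ge t 0 with h | h
    · exact h₁' t (by rw [abs_le]; constructor <;> linarith [ht.1])
    rcases le_or_gt t T with h' | h'
    · rw [heq ⟨h, h'⟩]; linarith [hR _ ⟨t, ⟨h, h'⟩, rfl⟩]
    · exact h₂' t (by rw [abs_le]; constructor <;> linarith [ht.2])
  have := hΓ t ⟨by linarith [ht.1], by linarith [ht.2]⟩
  rwa [hχ1 _ h1, one_smul] at this

end ODE

/-! ### The smooth cutoff function and its derivatives -/

namespace Filippov

theorem cutUp_eq_expNegInvGlue {a b : ℝ} (_hab : a < b) (x : ℝ) :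
    cutUp x a b = expNegInvGlue (x - a) / (expNegInvGlue (x - a) + expNegInvGlue (b - x)) := by
  unfold cutUp
  split_ifs with h1 h2
  · rw [expNegInvGlue.zero_of_nonpos (by linarith)]; simp
  · rw [not_le] at h1
    have ha : ¬ x - a ≤ 0 := by linarith
    have hb : ¬ b - x ≤ 0 := by linarith
    rw [expNegInvGlue, expNegInvGlue, if_neg ha, if_neg hb]
    have : Real.exp (-(b - x)⁻¹) = Real.exp (-(x - a)⁻¹) * Real.exp (1 / (x - a) + 1 / (x - b)) := by
      rw [← Real.exp_add]; congr 1
      rw [show x - b = -(b - x) by ring]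
      simp only [one_div, inv_neg]; ring
    rw [this]
    field_simp
  · rw [not_lt] at h2
    rw [expNegInvGlue.zero_of_nonpos (x := b - x) (by linarith), add_zero, div_self]
    exact (expNegInvGlue.pos_of_pos (by linarith)).ne'

theorem contDiff_cutUp {a b : ℝ} (hab : a < b) : ContDiff ℝ ∞ (fun x => cutUp x a b) := by
  have h : (fun x => cutUp x a b) = fun x =>
      expNegInvGlue (x - a) / (expNegInvGlue (x - a) + expNegInvGlue (b - x)) :=
    funext (cutUp_eq_expNegInvGlue hab)
  rw [h]
  have h1 : ContDiff ℝ ∞ fun x => expNegInvGlue (x - a) :=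
    expNegInvGlue.contDiff.comp (contDiff_id.sub contDiff_const)
  have h2 : ContDiff ℝ ∞ fun x => expNegInvGlue (b - x) :=
    expNegInvGlue.contDiff.comp (contDiff_const.sub contDiff_id)
  refine h1.div (h1.add h2) fun x => ?_
  rcases le_or_gt x a with h | h
  · have := expNegInvGlue.pos_of_pos (x := b - x) (by linarith)
    linarith [expNegInvGlue.nonneg (x - a)]
  · have := expNegInvGlue.pos_of_pos (x := x - a) (by linarith)
    linarith [expNegInvGlue.nonneg (b - x)]

theorem cutUp_nonneg (x a b : ℝ) : 0 ≤ cutUp x a b := by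
  unfold cutUp; split_ifs <;> positivity

theorem cutUp_le_one (x a b : ℝ) : cutUp x a b ≤ 1 := by
  unfold cutUp; split_ifs
  · norm_num
  · rw [div_le_one (by positivity)]; linarith [Real.exp_pos (1 / (x - a) + 1 / (x - b))]
  · norm_num

theorem cutUp_of_le {x a b : ℝ} (h : x ≤ a) : cutUp x a b = 0 := by simp [cutUp, h]

theorem cutUp_of_ge {x a b : ℝ} (hab : a < b) (h : b ≤ x) : cutUp x a b = 1 := by
  simp [cutUp, not_le.2 (hab.trans_le h), not_lt.2 h]

theorem cutDown_eq {a b : ℝ} (x : ℝ) : cutDown x a b = 1 - cutUp x a b := by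
  unfold cutDown cutUp
  split_ifs
  · simp
  · field_simp; ring
  · simp

/-- The logistic weight `h (1 - h)` decays exponentially in the exponent, which beats the poles of
the exponent `A - B` at the ends of the interval. -/
theorem pow_mul_exp_le {A B w : ℝ} (hw : 0 < w) (hw1 : w ≤ 1) (hB : 0 < B) (hBA : B ≤ A)
    (hBw : B ≤ 2 / w) :
    A ^ 2 * Real.exp (-(A - B)) ≤ 12 / w ^ 2 ∧ A ^ 4 * Real.exp (-(A - B)) ≤ 320 / w ^ 4 := by
  obtain ⟨D, rfl⟩ : ∃ D, A = B + D := ⟨A - B, by ring⟩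
  have hD : 0 ≤ D := by linarith
  rw [add_sub_cancel_left]
  have h2 : D ^ 2 * Real.exp (-D) ≤ 2 := by
    have := Real.pow_div_factorial_le_exp D hD 2
    rw [Real.exp_neg, ← div_eq_mul_inv, div_le_iff₀ (Real.exp_pos _)]
    norm_num [Nat.factorial] at this; linarith
  have h4 : D ^ 4 * Real.exp (-D) ≤ 24 := by
    have := Real.pow_div_factorial_le_exp D hD 4
    rw [Real.exp_neg, ← div_eq_mul_inv, div_le_iff₀ (Real.exp_pos _)]
    norm_num [Nat.factorial] at this; linarith
  have he : Real.exp (-D) ≤ 1 := Real.exp_le_one_iff.2 (by linarith)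
  have he0 := Real.exp_pos (-D)
  have hi : 1 ≤ 1 / w := by rw [le_div_iff₀ hw]; linarith
  constructor
  · have h1 : (B + D) ^ 2 ≤ 2 * (B ^ 2 + D ^ 2) := by nlinarith [sq_nonneg (B - D)]
    have h3 : B ^ 2 ≤ 4 / w ^ 2 := by
      calc B ^ 2 ≤ (2 / w) ^ 2 := by gcongr
        _ = _ := by ring
    have h5 : (1 : ℝ) ≤ 1 / w ^ 2 := by
      calc (1 : ℝ) ≤ (1 / w) ^ 2 := one_le_pow₀ hi
        _ = _ := by ring
    calc (B + D) ^ 2 * Real.exp (-D) ≤ 2 * (B ^ 2 + D ^ 2) * Real.exp (-D) := by gcongr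
      _ = 2 * (B ^ 2 * Real.exp (-D) + D ^ 2 * Real.exp (-D)) := by ring
      _ ≤ 2 * (4 / w ^ 2 * 1 + 2) := by gcongr
      _ ≤ 2 * (4 / w ^ 2 * 1 + 2 * (1 / w ^ 2)) := by gcongr; linarith
      _ = 12 / w ^ 2 := by ring
  · have h1 : (B + D) ^ 4 ≤ 8 * (B ^ 4 + D ^ 4) := by
      nlinarith [sq_nonneg (B - D), sq_nonneg (B ^ 2 - D ^ 2), sq_nonneg (B + D),
        mul_nonneg (sq_nonneg (B - D)) (sq_nonneg (B + D)),
        mul_nonneg (sq_nonneg (B - D)) (sq_nonneg (B - D))]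
    have h3 : B ^ 4 ≤ 16 / w ^ 4 := by
      calc B ^ 4 ≤ (2 / w) ^ 4 := by gcongr
        _ = _ := by ring
    have h5 : (1 : ℝ) ≤ 1 / w ^ 4 := by
      calc (1 : ℝ) ≤ (1 / w) ^ 4 := one_le_pow₀ hi
        _ = _ := by ring
    calc (B + D) ^ 4 * Real.exp (-D) ≤ 8 * (B ^ 4 + D ^ 4) * Real.exp (-D) := by gcongr
      _ = 8 * (B ^ 4 * Real.exp (-D) + D ^ 4 * Real.exp (-D)) := by ring
      _ ≤ 8 * (16 / w ^ 4 * 1 + 24) := by gcongr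
      _ ≤ 8 * (16 / w ^ 4 * 1 + 24 * (1 / w ^ 4)) := by gcongr; linarith
      _ = 320 / w ^ 4 := by ring

/-- Bounds for the polynomials in the poles `A = 1 / (x - a)` and `B = 1 / (b - x)` that occur in the
first two derivatives of the cutoff function; one of the two poles is at most `2 / w`. -/
theorem weighted_poles_le {A B w : ℝ} (hw : 0 < w) (hw1 : w ≤ 1) (hA : 1 ≤ A) (hB : 1 ≤ B)
    (hAB : A ≤ 2 / w ∨ B ≤ 2 / w) :
    (A ^ 2 + B ^ 2) * Real.exp (-|A - B|) ≤ 2560 / w ^ 2 ∧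
      ((A ^ 2 + B ^ 2) ^ 2 + 2 * (A ^ 3 + B ^ 3)) * Real.exp (-|A - B|) ≤ 2560 / w ^ 4 := by
  wlog h : B ≤ A generalizing A B
  · have := this hB hA hAB.symm (not_le.1 h).le
    rw [abs_sub_comm] at this
    constructor
    · linarith [this.1]
    · linarith [this.2]
  have hB2 : B ≤ 2 / w := hAB.elim (fun h' => h.trans h') id
  obtain ⟨h1, h2⟩ := pow_mul_exp_le hw hw1 (by linarith) h hB2
  rw [abs_of_nonneg (by linarith)]
  have he0 := Real.exp_pos (-(A - B))
  have h22 : B ^ 2 ≤ A ^ 2 := by gcongr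
  have h33 : B ^ 3 ≤ A ^ 3 := by gcongr
  have h34 : A ^ 3 ≤ A ^ 4 := pow_le_pow_right₀ hA (by norm_num)
  constructor
  · calc _ ≤ (2 * A ^ 2) * Real.exp (-(A - B)) := by gcongr; linarith
      _ ≤ 2 * (12 / w ^ 2) := by rw [mul_assoc]; gcongr
      _ = 24 / w ^ 2 := by ring
      _ ≤ _ := by gcongr; norm_num
  · calc _ ≤ (8 * A ^ 4) * Real.exp (-(A - B)) := by
          gcongr
          have : (A ^ 2 + B ^ 2) ^ 2 ≤ (2 * A ^ 2) ^ 2 := by gcongr; linarith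
          linarith [this, show (2 * A ^ 2) ^ 2 = 4 * A ^ 4 by ring]
      _ ≤ 8 * (320 / w ^ 4) := by rw [mul_assoc]; gcongr
      _ = _ := by ring

theorem logistic_weight_le (D : ℝ) :
    1 / (1 + Real.exp D) * (1 - 1 / (1 + Real.exp D)) ≤ Real.exp (-|D|) := by
  have h0 := Real.exp_pos D
  have : 1 / (1 + Real.exp D) * (1 - 1 / (1 + Real.exp D)) =
      Real.exp D / (1 + Real.exp D) ^ 2 := by field_simp; ring
  rw [this, div_le_iff₀ (by positivity)]
  rcases le_total 0 D with h | h
  · rw [abs_of_nonneg h, Real.exp_neg]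
    rw [inv_mul_eq_div, le_div_iff₀ h0]
    nlinarith
  · rw [abs_of_nonpos h, neg_neg]
    nlinarith [mul_pos h0 h0, mul_pos h0 (mul_pos h0 h0)]

theorem hasDerivAt_cutUp {a b x : ℝ} (hx : x ∈ Ioo a b) :
    HasDerivAt (fun x => cutUp x a b)
      (cutUp x a b * (1 - cutUp x a b) * (((x - a) ^ 2)⁻¹ + ((x - b) ^ 2)⁻¹)) x := by
  have ha : x - a ≠ 0 := (sub_pos.2 hx.1).ne'
  have hb : x - b ≠ 0 := (sub_neg.2 hx.2).ne
  have heq : ∀ y ∈ Ioo a b, cutUp y a b =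
      (1 + Real.exp ((y - a)⁻¹ + (y - b)⁻¹))⁻¹ := by
    intro y hy
    simp [cutUp, not_le.2 hy.1, hy.2]
  have h1 : HasDerivAt (fun y => (y - a)⁻¹ + (y - b)⁻¹)
      (-1 / (x - a) ^ 2 + -1 / (x - b) ^ 2) x :=
    (((hasDerivAt_id x).sub_const a).inv ha).add (((hasDerivAt_id x).sub_const b).inv hb)
  have h2 := ((h1.exp).const_add 1).inv (by positivity)
  rw [heq x hx]
  refine (h2.congr_of_eventuallyEq ?_).congr_deriv ?_
  · filter_upwards [Ioo_mem_nhds hx.1 hx.2] with y hy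
    simp [heq y hy]
  · field_simp; ring

theorem hasDerivAt_deriv_cutUp {a b x : ℝ} (hx : x ∈ Ioo a b) :
    HasDerivAt (deriv fun x => cutUp x a b)
      (cutUp x a b * (1 - cutUp x a b) * ((1 - 2 * cutUp x a b) *
        (((x - a) ^ 2)⁻¹ + ((x - b) ^ 2)⁻¹) ^ 2 - 2 * (((x - a) ^ 3)⁻¹ + ((x - b) ^ 3)⁻¹))) x := by
  have ha : x - a ≠ 0 := (sub_pos.2 hx.1).ne'
  have hb : x - b ≠ 0 := (sub_neg.2 hx.2).ne
  have h0 := hasDerivAt_cutUp hx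
  have h1 : HasDerivAt (fun y => ((y - a) ^ 2)⁻¹ + ((y - b) ^ 2)⁻¹)
      (-2 * (((x - a) ^ 3)⁻¹ + ((x - b) ^ 3)⁻¹)) x := by
    refine (((((hasDerivAt_id x).sub_const a).pow 2).inv (pow_ne_zero 2 ha)).add
      ((((hasDerivAt_id x).sub_const b).pow 2).inv (pow_ne_zero 2 hb))).congr_deriv ?_
    simp only [id, Pi.pow_apply]
    field_simp
    ring
  refine (((h0.mul (h0.const_sub 1)).mul h1).congr_of_eventuallyEq ?_).congr_deriv ?_
  · filter_upwards [Ioo_mem_nhds hx.1 hx.2] with y hy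
    exact (hasDerivAt_cutUp hy).deriv
  · simp only [Pi.mul_apply]
    ring

/-- The first two derivatives of the cutoff function on an interval of length `w` are `O(w⁻²)` and
`O(w⁻⁴)`. -/
theorem abs_deriv_cutUp_le {a b : ℝ} (hab : a < b) (hab1 : b - a ≤ 1) (x : ℝ) :
    |deriv (fun x => cutUp x a b) x| ≤ 2560 / (b - a) ^ 2 ∧
      |deriv (deriv fun x => cutUp x a b) x| ≤ 2560 / (b - a) ^ 4 := by
  have hw : 0 < b - a := by linarith
  have hsm := contDiff_cutUp hab
  have hsm1 : ContDiff ℝ ∞ (deriv fun x => cutUp x a b) :=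
    (contDiff_infty_iff_deriv.1 hsm).2
  have hc1 := hsm1.continuous
  have hc2 : Continuous (deriv (deriv fun x => cutUp x a b)) :=
    (contDiff_infty_iff_deriv.1 hsm1).2.continuous
  have hcl : IsClosed {x | |deriv (fun x => cutUp x a b) x| ≤ 2560 / (b - a) ^ 2 ∧
      |deriv (deriv fun x => cutUp x a b) x| ≤ 2560 / (b - a) ^ 4} :=
    (isClosed_le hc1.abs continuous_const).inter (isClosed_le hc2.abs continuous_const)
  -- both estimates are closed conditions, so the two ends of the interval may be left out
  have hd : Dense ({a, b}ᶜ : Set ℝ) := (Set.toFinite {a, b}).countable.dense_compl ℝ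
  refine hcl.closure_subset_iff.2 ?_ (hd x)
  intro x hx
  simp only [mem_compl_iff, mem_insert_iff, mem_singleton_iff, not_or] at hx
  have hconst : ∀ (s : Set ℝ) (c : ℝ), IsOpen s → x ∈ s → (∀ y ∈ s, cutUp y a b = c) →
      deriv (fun x => cutUp x a b) x = 0 ∧ deriv (deriv fun x => cutUp x a b) x = 0 := by
    intro s c hs hxs hy
    have h1 : ∀ y ∈ s, deriv (fun x => cutUp x a b) y = 0 := by
      intro y hys
      have : (fun x => cutUp x a b) =ᶠ[nhds y] fun _ => c := by
        filter_upwards [hs.mem_nhds hys] with z hz using hy z hz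
      rw [this.deriv_eq]; simp
    refine ⟨h1 x hxs, ?_⟩
    have : (deriv fun x => cutUp x a b) =ᶠ[nhds x] fun _ => 0 := by
      filter_upwards [hs.mem_nhds hxs] with z hz using h1 z hz
    rw [this.deriv_eq]; simp
  rcases lt_or_gt_of_ne hx.1 with h | h
  · obtain ⟨e1, e2⟩ := hconst (Iio a) 0 isOpen_Iio h (fun y hy => cutUp_of_le (le_of_lt hy))
    simp only [mem_ofPred_eq, e1, e2, abs_zero]
    constructor <;> positivity
  rcases lt_or_gt_of_ne hx.2 with h' | h'
  swap
  · obtain ⟨e1, e2⟩ := hconst (Ioi b) 1 isOpen_Ioi h' (fun y hy => cutUp_of_ge hab (le_of_lt hy))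
    simp only [mem_ofPred_eq, e1, e2, abs_zero]
    constructor <;> positivity
  have hxm : x ∈ Ioo a b := ⟨h, h'⟩
  rw [mem_ofPred_eq, (hasDerivAt_cutUp hxm).deriv, (hasDerivAt_deriv_cutUp hxm).deriv]
  have hA0 : 0 < x - a := by linarith
  have hB0 : 0 < b - x := by linarith
  set A := (x - a)⁻¹ with hA
  set B := (b - x)⁻¹ with hB
  have hA1 : 1 ≤ A := (one_le_inv₀ hA0).2 (by linarith)
  have hB1 : 1 ≤ B := (one_le_inv₀ hB0).2 (by linarith)
  have hAB : A ≤ 2 / (b - a) ∨ B ≤ 2 / (b - a) := by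
    rcases le_total ((b - a) / 2) (x - a) with h | h
    · left
      calc A ≤ ((b - a) / 2)⁻¹ := inv_anti₀ (by positivity) h
        _ = _ := by rw [inv_div]
    · right
      calc B ≤ ((b - a) / 2)⁻¹ := inv_anti₀ (by positivity) (by linarith)
        _ = _ := by rw [inv_div]
  obtain ⟨k1, k2⟩ := weighted_poles_le hw hab1 hA1 hB1 hAB
  have hcu : cutUp x a b = 1 / (1 + Real.exp (A - B)) := by
    simp only [cutUp, not_le.2 h, h', if_true, if_false]
    rw [show x - b = -(b - x) by ring, hA, hB, one_div (x - a), one_div (-(b - x)), inv_neg,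
      ← sub_eq_add_neg]
  have hw := logistic_weight_le (A - B)
  rw [← hcu] at hw
  have h0 := cutUp_nonneg x a b
  have h1 := cutUp_le_one x a b
  have hww : 0 ≤ cutUp x a b * (1 - cutUp x a b) := mul_nonneg h0 (by linarith)
  have e2 : ((x - a) ^ 2)⁻¹ + ((x - b) ^ 2)⁻¹ = A ^ 2 + B ^ 2 := by
    rw [hA, hB, inv_pow, inv_pow, show (x - b) ^ 2 = (b - x) ^ 2 by ring]
  have e3 : ((x - a) ^ 3)⁻¹ + ((x - b) ^ 3)⁻¹ = A ^ 3 - B ^ 3 := by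
    rw [hA, hB, inv_pow, inv_pow, show (x - b) ^ 3 = -(b - x) ^ 3 by ring, inv_neg,
      ← sub_eq_add_neg]
  rw [e2, e3]
  constructor
  · rw [abs_mul, abs_of_nonneg hww, abs_of_nonneg (by positivity), mul_comm]
    exact (mul_le_mul_of_nonneg_left hw (by positivity)).trans k1
  · have : |(1 - 2 * cutUp x a b) * (A ^ 2 + B ^ 2) ^ 2 - 2 * (A ^ 3 - B ^ 3)| ≤
        (A ^ 2 + B ^ 2) ^ 2 + 2 * (A ^ 3 + B ^ 3) := by
      have hA3 : 0 < A ^ 3 := by positivity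
      have hB3 : 0 < B ^ 3 := by positivity
      have hsq : 0 ≤ (A ^ 2 + B ^ 2) ^ 2 := sq_nonneg _
      rw [abs_le]
      constructor <;> nlinarith
    rw [abs_mul, abs_of_nonneg hww]
    calc _ ≤ Real.exp (-|A - B|) * ((A ^ 2 + B ^ 2) ^ 2 + 2 * (A ^ 3 + B ^ 3)) := by gcongr
      _ ≤ _ := by rw [mul_comm]; exact k2

/-! ### Trains of bumps realized by the perturbation -/

/-- The bump of height one over `[a, c]` with its peak at `b`. -/
noncomputable def unitBump (a b c x : ℝ) : ℝ := cutUp x a b * (1 - cutUp x b c)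

theorem unitBump_nonneg (a b c x : ℝ) : 0 ≤ unitBump a b c x :=
  mul_nonneg (cutUp_nonneg _ _ _) (sub_nonneg.2 (cutUp_le_one _ _ _))

theorem unitBump_le_one (a b c x : ℝ) : unitBump a b c x ≤ 1 :=
  mul_le_one₀ (cutUp_le_one _ _ _) (sub_nonneg.2 (cutUp_le_one _ _ _))
    (by linarith [cutUp_nonneg x b c])

theorem unitBump_peak {a b c : ℝ} (hab : a < b) : unitBump a b c b = 1 := by
  rw [unitBump, cutUp_of_ge hab le_rfl, cutUp_of_le le_rfl]; norm_num

theorem unitBump_of_le {a b c x : ℝ} (h : x ≤ a) : unitBump a b c x = 0 := by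
  rw [unitBump, cutUp_of_le h, zero_mul]

theorem unitBump_of_ge {a b c x : ℝ} (hbc : b < c) (h : c ≤ x) : unitBump a b c x = 0 := by
  rw [unitBump, cutUp_of_ge hbc h]; ring

theorem contDiff_unitBump {a b c : ℝ} (hab : a < b) (hbc : b < c) :
    ContDiff ℝ ∞ (unitBump a b c) :=
  (contDiff_cutUp hab).mul (contDiff_const.sub (contDiff_cutUp hbc))

theorem abs_deriv_unitBump_le {a b c w : ℝ} (hab : b - a = w) (hbc : c - b = w) (hw : 0 < w)
    (hw1 : w ≤ 1) (x : ℝ) :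
    |deriv (unitBump a b c) x| ≤ 14000000 / w ^ 2 ∧
      |deriv (deriv (unitBump a b c)) x| ≤ 14000000 / w ^ 4 := by
  have hab' : a < b := by linarith
  have hbc' : b < c := by linarith
  have hu := contDiff_cutUp hab'
  have hv := contDiff_cutUp hbc'
  have hu1 : ContDiff ℝ ∞ (deriv fun x => cutUp x a b) := (contDiff_infty_iff_deriv.1 hu).2
  have hv1 : ContDiff ℝ ∞ (deriv fun x => cutUp x b c) := (contDiff_infty_iff_deriv.1 hv).2
  have d1 : ∀ x, HasDerivAt (unitBump a b c) (deriv (fun x => cutUp x a b) x * (1 - cutUp x b c) -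
      cutUp x a b * deriv (fun x => cutUp x b c) x) x := by
    intro x
    have e1 := (hu.differentiable (by simp) x).hasDerivAt
    have e2 := (hv.differentiable (by simp) x).hasDerivAt
    exact (e1.mul (e2.const_sub 1)).congr_deriv (by ring)
  have d2 : HasDerivAt (deriv (unitBump a b c))
      (deriv (deriv fun x => cutUp x a b) x * (1 - cutUp x b c) -
        2 * (deriv (fun x => cutUp x a b) x * deriv (fun x => cutUp x b c) x) -
        cutUp x a b * deriv (deriv fun x => cutUp x b c) x) x := by
    have e1 := (hu.differentiable (by simp) x).hasDerivAt
    have e2 := (hv.differentiable (by simp) x).hasDerivAt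
    have e3 := (hu1.differentiable (by simp) x).hasDerivAt
    have e4 := (hv1.differentiable (by simp) x).hasDerivAt
    have := (e3.mul (e2.const_sub 1)).sub (e1.mul e4)
    refine (this.congr_of_eventuallyEq (Filter.Eventually.of_forall fun y => ?_)).congr_deriv ?_
    · exact (d1 y).deriv
    · ring
  rw [(d1 x).deriv, d2.deriv]
  obtain ⟨a1, a2⟩ := abs_deriv_cutUp_le hab' (by rw [hab]; exact hw1) x
  obtain ⟨b1, b2⟩ := abs_deriv_cutUp_le hbc' (by rw [hbc]; exact hw1) x
  rw [hab] at a1 a2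
  rw [hbc] at b1 b2
  have c1 : |1 - cutUp x b c| ≤ 1 := by
    rw [abs_le]; constructor <;> linarith [cutUp_nonneg x b c, cutUp_le_one x b c]
  have c2 : |cutUp x a b| ≤ 1 := by
    rw [abs_le]; constructor <;> linarith [cutUp_nonneg x a b, cutUp_le_one x a b]
  constructor
  · calc _ ≤ |deriv (fun x => cutUp x a b) x * (1 - cutUp x b c)| +
          |cutUp x a b * deriv (fun x => cutUp x b c) x| := abs_sub _ _
      _ ≤ 2560 / w ^ 2 * 1 + 1 * (2560 / w ^ 2) := by rw [abs_mul, abs_mul]; gcongr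
      _ = 5120 / w ^ 2 := by ring
      _ ≤ _ := by gcongr; norm_num
  · calc _ ≤ |deriv (deriv fun x => cutUp x a b) x * (1 - cutUp x b c)| +
          |2 * (deriv (fun x => cutUp x a b) x * deriv (fun x => cutUp x b c) x)| +
          |cutUp x a b * deriv (deriv fun x => cutUp x b c) x| :=
            (abs_sub _ _).trans (by gcongr; exact abs_sub _ _)
      _ ≤ 2560 / w ^ 4 * 1 + 2 * (2560 / w ^ 2 * (2560 / w ^ 2)) + 1 * (2560 / w ^ 4) := by
          rw [abs_mul, abs_mul, abs_mul, abs_mul, abs_two]; gcongr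
      _ = 13112320 / w ^ 4 := by field_simp; norm_num
      _ ≤ _ := by gcongr; norm_num

theorem bump_eq (d : ℕ) (k : Fin (3 * d + 1) → ℝ) (i : Fin d) (x : ℝ)
    (h1 : k ⟨2 * i, by omega⟩ < k ⟨2 * i + 1, by omega⟩)
    (h2 : k ⟨2 * i + 1, by omega⟩ < k ⟨2 * i + 2, by omega⟩) :
    bump d k i x = k ⟨2 * d + 1 + i, by omega⟩ *
      unitBump (k ⟨2 * i, by omega⟩) (k ⟨2 * i + 1, by omega⟩) (k ⟨2 * i + 2, by omega⟩) x := by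
  unfold bump
  split_ifs with h h'
  · rw [unitBump, cutUp_of_le h.2]; ring
  · rw [unitBump, cutUp_of_ge h1 h'.1.le, cutDown_eq]; ring
  · by_cases ha : x ≤ k ⟨2 * i, by omega⟩
    · rw [unitBump_of_le ha]; ring
    · have hb : k ⟨2 * i + 1, by omega⟩ < x := by
        by_contra hb; exact h ⟨not_le.1 ha, not_lt.1 hb⟩
      have hc : k ⟨2 * i + 2, by omega⟩ ≤ x := by
        by_contra hc; exact h' ⟨hb, (not_le.1 hc).le⟩
      rw [unitBump_of_ge h2 hc]; ring

/-- Equally spaced bumps of prescribed heights: knots `c, c + w, …, c + 2dw`. -/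
noncomputable def bumpParam (d : ℕ) (c w : ℝ) (H : Fin d → ℝ) (j : Fin (3 * d + 1)) : ℝ :=
  if h : (j : ℕ) ≤ 2 * d then c + w * (j : ℕ) else H ⟨j - (2 * d + 1), by omega⟩

theorem bumpParam_knot {d : ℕ} (c w : ℝ) (H : Fin d → ℝ) {j : ℕ} (hj : j ≤ 2 * d) :
    bumpParam d c w H ⟨j, by omega⟩ = c + w * j := by
  simp [bumpParam, hj]

theorem bumpParam_height {d : ℕ} (c w : ℝ) (H : Fin d → ℝ) (i : Fin d) :
    bumpParam d c w H ⟨2 * d + 1 + i, by omega⟩ = H i := by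
  have : ¬ (2 * d + 1 + (i : ℕ) ≤ 2 * d) := by omega
  simp [bumpParam, this]

theorem psi_bumpParam {d : ℕ} (hd : 0 < d) (r₁ r₂ c : ℝ) {w : ℝ} (hw : 0 < w) (H : Fin d → ℝ) :
    psi d hd r₁ r₂ (bumpParam d c w H) = fun x => ∑ i : Fin d,
      H i * unitBump (c + w * (2 * i : ℕ)) (c + w * (2 * i + 1 : ℕ)) (c + w * (2 * i + 2 : ℕ)) x := by
  funext x
  have hK : bumpParam d c w H ∈ paramK d := by
    intro i
    rw [bumpParam_knot c w H (by omega), bumpParam_knot c w H (by omega)]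
    push_cast; nlinarith
  rw [psi, if_pos hK]
  refine Finset.sum_congr rfl fun i _ => ?_
  have e0 := bumpParam_knot c w H (j := 2 * i) (by omega)
  have e1 := bumpParam_knot c w H (j := 2 * i + 1) (by omega)
  have e2 := bumpParam_knot c w H (j := 2 * i + 2) (by omega)
  rw [bump_eq, bumpParam_height, e0, e1, e2]
  · rw [e0, e1]; push_cast; nlinarith
  · rw [e1, e2]; push_cast; nlinarith

theorem exists_bumps_pos {d : ℕ} (hd : 0 < d) (r₁ r₂ c : ℝ) {w M : ℝ} (hw : 0 < w) (hw1 : w ≤ 1)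
    (H : Fin d → ℝ) (hH : ∀ i, 0 ≤ H i) (hM : ∀ i, H i ≤ M) :
    ∃ k : Fin (3 * d + 1) → ℝ, ‖k‖ ≤ |c| + w * (2 * d) + M ∧
      ContDiff ℝ ∞ (psi d hd r₁ r₂ k) ∧
      (∀ x, |psi d hd r₁ r₂ k x| ≤ d * M) ∧
      (∀ x, |deriv (psi d hd r₁ r₂ k) x| ≤ d * (M * (14000000 / w ^ 2))) ∧
      (∀ x, |deriv (deriv (psi d hd r₁ r₂ k)) x| ≤ d * (M * (14000000 / w ^ 4))) ∧
      (∀ i : Fin d, psi d hd r₁ r₂ k (c + w * (2 * i + 1)) = H i) ∧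
      (∀ i : Fin d, ∀ u ∈ Icc (c + w * (2 * i)) (c + w * (2 * i + 2)),
        psi d hd r₁ r₂ k u ≤ H i) ∧
      (∀ u ≤ c, psi d hd r₁ r₂ k u = 0) ∧
      (∀ u, c + w * (2 * d) ≤ u → psi d hd r₁ r₂ k u = 0) := by
  have hM0 : 0 ≤ M := (hH ⟨0, hd⟩).trans (hM ⟨0, hd⟩)
  have key := psi_bumpParam hd r₁ r₂ c hw H
  have hB : ∀ i : Fin d, ContDiff ℝ ∞ (unitBump (c + w * (2 * i : ℕ)) (c + w * (2 * i + 1 : ℕ))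
      (c + w * (2 * i + 2 : ℕ))) := fun i =>
    contDiff_unitBump (by push_cast; nlinarith) (by push_cast; nlinarith)
  have hB' := fun (i : Fin d) (x : ℝ) => abs_deriv_unitBump_le
    (a := c + w * (2 * i : ℕ)) (b := c + w * (2 * i + 1 : ℕ)) (c := c + w * (2 * i + 2 : ℕ))
    (w := w) (by push_cast; ring) (by push_cast; ring) hw hw1 x
  have hHa : ∀ i, |H i| ≤ M := fun i => by rw [abs_of_nonneg (hH i)]; exact hM i
  -- a bump vanishes outside its own cell
  have hzero : ∀ (i j : Fin d) (u : ℝ), i ≠ j → u ∈ Icc (c + w * (2 * i)) (c + w * (2 * i + 2)) →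
      unitBump (c + w * (2 * j : ℕ)) (c + w * (2 * j + 1 : ℕ)) (c + w * (2 * j + 2 : ℕ)) u = 0 := by
    intro i j u hij hu
    rcases lt_or_gt_of_ne hij with h | h
    · have : ((i : ℕ) : ℝ) + 1 ≤ (j : ℕ) := by exact_mod_cast h
      exact unitBump_of_le (hu.2.trans (by push_cast; nlinarith))
    · have : ((j : ℕ) : ℝ) + 1 ≤ (i : ℕ) := by exact_mod_cast h
      exact unitBump_of_ge (by push_cast; nlinarith) (le_trans (by push_cast; nlinarith) hu.1)
  have hsingle : ∀ (i : Fin d) (u : ℝ), u ∈ Icc (c + w * (2 * i)) (c + w * (2 * i + 2)) →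
      psi d hd r₁ r₂ (bumpParam d c w H) u = H i * unitBump (c + w * (2 * i : ℕ))
        (c + w * (2 * i + 1 : ℕ)) (c + w * (2 * i + 2 : ℕ)) u := by
    intro i u hu
    rw [key]
    exact Finset.sum_eq_single i (fun j _ hj => by rw [hzero i j u (Ne.symm hj) hu, mul_zero])
      (by simp)
  have d1 : ∀ x, HasDerivAt (psi d hd r₁ r₂ (bumpParam d c w H)) (∑ i : Fin d, H i *
      deriv (unitBump (c + w * (2 * i : ℕ)) (c + w * (2 * i + 1 : ℕ))
        (c + w * (2 * i + 2 : ℕ))) x) x := by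
    intro x
    rw [key]
    exact HasDerivAt.fun_sum fun i _ =>
      ((hB i).differentiable (by simp) x).hasDerivAt.const_mul (H i)
  have d2 : ∀ x, HasDerivAt (deriv (psi d hd r₁ r₂ (bumpParam d c w H))) (∑ i : Fin d, H i *
      deriv (deriv (unitBump (c + w * (2 * i : ℕ)) (c + w * (2 * i + 1 : ℕ))
        (c + w * (2 * i + 2 : ℕ)))) x) x := by
    intro x
    rw [funext fun y => (d1 y).deriv]
    exact HasDerivAt.fun_sum fun i _ =>
      ((((contDiff_infty_iff_deriv.1 (hB i)).2).differentiable (by simp) x).hasDerivAt.const_mul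
        (H i))
  have hsum : ∀ (F : Fin d → ℝ) (C : ℝ), (∀ i, |F i| ≤ C) →
      |∑ i : Fin d, H i * F i| ≤ d * (M * C) := by
    intro F C hF
    calc _ ≤ ∑ i : Fin d, |H i * F i| := Finset.abs_sum_le_sum_abs _ _
      _ ≤ ∑ i : Fin d, M * C := by
          refine Finset.sum_le_sum fun i _ => ?_
          rw [abs_mul]
          exact mul_le_mul (hHa i) (hF i) (abs_nonneg _) hM0
      _ = _ := by simp
  refine ⟨bumpParam d c w H, ?_, ?_, ?_, ?_, ?_, ?_, ?_, ?_, ?_⟩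
  · refine (pi_norm_le_iff_of_nonneg (by positivity)).2 fun j => ?_
    rw [Real.norm_eq_abs]
    unfold bumpParam
    split_ifs with h
    · have : ((j : ℕ) : ℝ) ≤ 2 * d := by exact_mod_cast h
      calc |c + w * (j : ℕ)| ≤ |c| + |w * (j : ℕ)| := abs_add_le _ _
        _ ≤ |c| + w * (2 * d) := by
            rw [abs_of_nonneg (by positivity : 0 ≤ w * ((j : ℕ) : ℝ))]; gcongr
        _ ≤ _ := by linarith
    · exact (hHa _).trans (by have := abs_nonneg c; have : 0 ≤ w * (2 * (d : ℝ)) := by positivity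
                              linarith)
  · rw [key]
    exact ContDiff.sum fun i _ => contDiff_const.mul (hB i)
  · intro x
    rw [key]
    have := hsum (fun i => unitBump (c + w * (2 * i : ℕ)) (c + w * (2 * i + 1 : ℕ))
      (c + w * (2 * i + 2 : ℕ)) x) 1 (fun i => by
        rw [abs_of_nonneg (unitBump_nonneg _ _ _ _)]; exact unitBump_le_one _ _ _ _)
    rwa [mul_one] at this
  · intro x
    rw [(d1 x).deriv]
    exact hsum _ _ fun i => (hB' i x).1
  · intro x
    rw [(d2 x).deriv]
    exact hsum _ _ fun i => (hB' i x).2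
  · intro i
    have : unitBump (c + w * (2 * i : ℕ)) (c + w * (2 * i + 1 : ℕ)) (c + w * (2 * i + 2 : ℕ))
        (c + w * (2 * (i : ℕ) + 1)) = 1 := by
      have := unitBump_peak (a := c + w * (2 * i : ℕ)) (b := c + w * (2 * i + 1 : ℕ))
        (c := c + w * (2 * i + 2 : ℕ)) (by push_cast; nlinarith)
      simpa only [Nat.cast_add, Nat.cast_mul, Nat.cast_ofNat, Nat.cast_one] using this
    rw [hsingle i _ ⟨by nlinarith, by nlinarith⟩, this, mul_one]
  · intro i u hu
    rw [hsingle i u hu]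
    exact mul_le_of_le_one_right (hH i) (unitBump_le_one _ _ _ _)
  · intro u hu
    rw [key]
    refine Finset.sum_eq_zero fun i _ => ?_
    rw [unitBump_of_le (hu.trans _), mul_zero]
    have : 0 ≤ w * ((2 * i : ℕ) : ℝ) := by positivity
    linarith
  · intro u hu
    rw [key]
    refine Finset.sum_eq_zero fun i _ => ?_
    rw [unitBump_of_ge (by push_cast; nlinarith) (le_trans _ hu), mul_zero]
    have : ((i : ℕ) : ℝ) + 1 ≤ d := by exact_mod_cast i.2
    push_cast; nlinarith

/-- Bumps of prescribed heights over the cells `[c + 2iw, c + (2i+2)w]` of the coordinate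
`u = σ x`, where `σ = ± 1`. The second derivative costs `w⁻⁴`, and not `w⁻²`, because the cutoff
functions are not scaling invariant. -/
theorem exists_bumps {d : ℕ} (hd : 0 < d) (r₁ r₂ : ℝ) {σ : ℝ} (hσ : σ = 1 ∨ σ = -1) (c : ℝ)
    {w M : ℝ} (hw : 0 < w) (hw1 : w ≤ 1)
    (H : Fin d → ℝ) (hH : ∀ i, 0 ≤ H i) (hM : ∀ i, H i ≤ M) :
    ∃ k : Fin (3 * d + 1) → ℝ, ‖k‖ ≤ |c| + w * (4 * d) + M ∧
      ContDiff ℝ ∞ (psi d hd r₁ r₂ k) ∧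
      (∀ x, |psi d hd r₁ r₂ k x| ≤ d * M) ∧
      (∀ x, |deriv (psi d hd r₁ r₂ k) x| ≤ d * (M * (14000000 / w ^ 2))) ∧
      (∀ x, |deriv (deriv (psi d hd r₁ r₂ k)) x| ≤ d * (M * (14000000 / w ^ 4))) ∧
      (∀ i : Fin d, psi d hd r₁ r₂ k (σ * (c + w * (2 * i + 1))) = H i) ∧
      (∀ i : Fin d, ∀ u ∈ Icc (c + w * (2 * i)) (c + w * (2 * i + 2)),
        psi d hd r₁ r₂ k (σ * u) ≤ H i) ∧
      (∀ u ≤ c, psi d hd r₁ r₂ k (σ * u) = 0) ∧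
      (∀ u, c + w * (2 * d) ≤ u → psi d hd r₁ r₂ k (σ * u) = 0) := by
  have hwd : 0 ≤ w * (2 * (d : ℝ)) := by positivity
  rcases hσ with rfl | rfl
  · obtain ⟨k, h0, h1, h2, h3, h4, h5, h6, h7, h8⟩ := exists_bumps_pos hd r₁ r₂ c hw hw1 H hH hM
    simp only [one_mul]
    exact ⟨k, h0.trans (by linarith), h1, h2, h3, h4, h5, h6, h7, h8⟩
  · obtain ⟨k, h0, h1, h2, h3, h4, h5, h6, h7, h8⟩ := exists_bumps_pos hd r₁ r₂
      (-(c + w * (2 * d))) hw hw1 (fun i => H i.rev) (fun i => hH _) (fun i => hM _)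
    have hrev : ∀ i : Fin d, ((i.rev : ℕ) : ℝ) = d - 1 - i := by
      intro i
      rw [Fin.val_rev, Nat.cast_sub (by omega)]; push_cast; ring
    refine ⟨k, h0.trans ?_, h1, h2, h3, h4, fun i => ?_, fun i u hu => ?_, fun u hu => ?_,
      fun u hu => ?_⟩
    · rw [abs_neg]
      have := abs_add_le c (w * (2 * d))
      rw [abs_of_nonneg hwd] at this
      linarith
    · have := h5 i.rev
      rw [Fin.rev_rev, hrev] at this
      rw [← this]; congr 1; ring
    · have := h6 i.rev (-1 * u) (by
        rw [hrev]
        constructor <;> nlinarith [hu.1, hu.2])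
      rwa [Fin.rev_rev] at this
    · exact h8 _ (by linarith)
    · exact h7 _ (by linarith)

/-! ### The `C¹` distance of systems -/

theorem distC1_nonneg (U : Set (ℝ × ℝ)) (X Y : ℝ × ℝ → ℝ) : 0 ≤ distC1 U X Y := by
  refine Real.sSup_nonneg ?_
  rintro _ ⟨p, -, rfl⟩
  positivity

theorem le_distC1 {U : Set (ℝ × ℝ)} (hU : Bornology.IsBounded U) {X Y : ℝ × ℝ → ℝ}
    (hX : ContDiff ℝ ∞ X) (hY : ContDiff ℝ ∞ Y) {p : ℝ × ℝ} (hp : p ∈ closure U) :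
    |X p - Y p| + |fderiv ℝ (fun q => X q - Y q) p (1, 0)|
      + |fderiv ℝ (fun q => X q - Y q) p (0, 1)| ≤ distC1 U X Y := by
  have hXY : ContDiff ℝ ∞ fun q => X q - Y q := hX.sub hY
  have hf : Continuous (fderiv ℝ fun q => X q - Y q) := hXY.continuous_fderiv (by simp)
  have hc : Continuous fun p => |X p - Y p| + |fderiv ℝ (fun q => X q - Y q) p (1, 0)|
      + |fderiv ℝ (fun q => X q - Y q) p (0, 1)| :=
    (hXY.continuous.abs.add (hf.clm_apply continuous_const).abs).add
      (hf.clm_apply continuous_const).abs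
  exact le_csSup (hU.isCompact_closure.image hc).bddAbove ⟨p, hp, rfl⟩

theorem rho_bounds {U : Set (ℝ × ℝ)} (hU : Bornology.IsBounded U) {S S' : PWS}
    (hS : S.Smooth) (hS' : S'.Smooth) {ε : ℝ} (h : rho U S S' < ε) (s : Side) {p : ℝ × ℝ}
    (hp : p ∈ closure U) :
    |S.f s p - S'.f s p| < ε ∧ |S.g s p - S'.g s p| < ε ∧
      |fderiv ℝ (S.g s) p (1, 0) - fderiv ℝ (S'.g s) p (1, 0)| < ε := by
  have h1 := distC1_nonneg U (S.f .upper) (S'.f .upper)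
  have h2 := distC1_nonneg U (S.g .upper) (S'.g .upper)
  have h3 := distC1_nonneg U (S.f .lower) (S'.f .lower)
  have h4 := distC1_nonneg U (S.g .lower) (S'.g .lower)
  have hf : distC1 U (S.f s) (S'.f s) < ε := by
    unfold rho at h; cases s <;> linarith
  have hg : distC1 U (S.g s) (S'.g s) < ε := by
    unfold rho at h; cases s <;> linarith
  have kf := (le_distC1 hU (hS s).1 (hS' s).1 hp).trans_lt hf
  have kg := (le_distC1 hU (hS s).2 (hS' s).2 hp).trans_lt hg
  have e : fderiv ℝ (fun q => S.g s q - S'.g s q) p =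
      fderiv ℝ (S.g s) p - fderiv ℝ (S'.g s) p :=
    fderiv_fun_sub ((hS s).2.differentiable (by simp) p) ((hS' s).2.differentiable (by simp) p)
  rw [e] at kg
  simp only [sub_apply] at kg
  refine ⟨?_, ?_, ?_⟩
  · linarith [abs_nonneg (fderiv ℝ (fun q => S.f s q - S'.f s q) p (1, 0)),
      abs_nonneg (fderiv ℝ (fun q => S.f s q - S'.f s q) p (0, 1))]
  · linarith [abs_nonneg (fderiv ℝ (S.g s) p (1, 0) - fderiv ℝ (S'.g s) p (1, 0)),
      abs_nonneg (fderiv ℝ (S.g s) p (0, 1) - fderiv ℝ (S'.g s) p (0, 1))]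
  · linarith [abs_nonneg (S.g s p - S'.g s p),
      abs_nonneg (fderiv ℝ (S.g s) p (0, 1) - fderiv ℝ (S'.g s) p (0, 1))]

/-- A continuous function vanishing on `K × {0}` is uniformly small on `K × {e}` for small `e`. -/
theorem exists_forall_abs_lt_of_compact {X Λ : Type*} [TopologicalSpace X] [NormedAddCommGroup Λ]
    {K : Set X} (hK : IsCompact K) {D : X × Λ → ℝ} (hD : Continuous D)
    (h0 : ∀ p ∈ K, D (p, 0) = 0) {ε : ℝ} (hε : 0 < ε) :
    ∃ δ : ℝ, 0 < δ ∧ ∀ e : Λ, ‖e‖ ≤ δ → ∀ p ∈ K, |D (p, e)| < ε := by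
  have := hK.eventually_forall_of_forall_eventually (x₀ := (0 : Λ))
    (P := fun e p => |D (p, e)| < ε) (fun p hp => by
      have hc : ContinuousAt (fun z : Λ × X => |D (z.2, z.1)|) (0, p) := by fun_prop
      refine hc.eventually_lt_const ?_
      simp [h0 p hp, hε])
  obtain ⟨δ, hδ, h⟩ := Metric.eventually_nhds_iff.1 this
  exact ⟨δ / 2, by positivity, fun e he => h (by rw [dist_zero_right]; linarith)⟩

/-- Substituting a `C^2`-small function, its derivative and a small parameter vector into a smooth
function is a `C^1`-small change on the bounded set `U`. -/
theorem exists_distC1_le {U : Set (ℝ × ℝ)} (hU : Bornology.IsBounded U)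
    {Λ : Type*} [NormedAddCommGroup Λ] [NormedSpace ℝ Λ]
    {G : (ℝ × ℝ) × (ℝ × ℝ × Λ) → ℝ} (hG : ContDiff ℝ ∞ G) {ε : ℝ} (hε : 0 < ε) :
    ∃ δ : ℝ, 0 < δ ∧ ∀ ψ : ℝ → ℝ, ContDiff ℝ ∞ ψ → (∀ x, |ψ x| ≤ δ) → (∀ x, |deriv ψ x| ≤ δ) →
      (∀ x, |deriv (deriv ψ) x| ≤ δ) → ∀ l : Λ, ‖l‖ ≤ δ →
      distC1 U (fun p => G (p, 0)) (fun p => G (p, (ψ p.1, deriv ψ p.1, l))) ≤ ε := by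
  have hf : Continuous (fderiv ℝ G) := hG.continuous_fderiv (by simp)
  let D : (ℝ × ℝ) × (ℝ × ℝ × ℝ × Λ) → ℝ := fun z =>
    |G (z.1, 0) - G (z.1, (z.2.1, z.2.2.1, z.2.2.2.2))|
    + |fderiv ℝ G (z.1, 0) ((1, 0), 0) - fderiv ℝ G (z.1, (z.2.1, z.2.2.1, z.2.2.2.2))
        ((1, 0), (z.2.2.1, z.2.2.2.1, 0))|
    + |fderiv ℝ G (z.1, 0) ((0, 1), 0) - fderiv ℝ G (z.1, (z.2.1, z.2.2.1, z.2.2.2.2))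
        ((0, 1), 0)|
  have hGc := hG.continuous
  have hDc : Continuous D := by
    have a1 : Continuous fun z : (ℝ × ℝ) × (ℝ × ℝ × ℝ × Λ) =>
        ((z.1, 0) : (ℝ × ℝ) × (ℝ × ℝ × Λ)) := by fun_prop
    have a2 : Continuous fun z : (ℝ × ℝ) × (ℝ × ℝ × ℝ × Λ) =>
        ((z.1, (z.2.1, z.2.2.1, z.2.2.2.2)) : (ℝ × ℝ) × (ℝ × ℝ × Λ)) := by fun_prop
    have a3 : Continuous fun z : (ℝ × ℝ) × (ℝ × ℝ × ℝ × Λ) =>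
        (((1, 0), (z.2.2.1, z.2.2.2.1, 0)) : (ℝ × ℝ) × (ℝ × ℝ × Λ)) := by fun_prop
    refine (((hGc.comp a1).sub (hGc.comp a2)).abs.add ?_).add ?_
    · exact (((hf.comp a1).clm_apply continuous_const).sub ((hf.comp a2).clm_apply a3)).abs
    · exact (((hf.comp a1).clm_apply continuous_const).sub
        ((hf.comp a2).clm_apply continuous_const)).abs
  have hD0 : ∀ p ∈ closure U, D (p, 0) = 0 := fun p _ => by
    simp [D, ← Prod.zero_eq_mk]
  obtain ⟨δ, hδ, h⟩ := exists_forall_abs_lt_of_compact hU.isCompact_closure hDc hD0 hε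
  refine ⟨δ, hδ, fun ψ hψ h0 h1 h2 l hl => ?_⟩
  refine Real.sSup_le ?_ hε.le
  rintro _ ⟨p, hp, rfl⟩
  have hd1 : HasDerivAt ψ (deriv ψ p.1) p.1 := (hψ.differentiable (by simp) _).hasDerivAt
  have hd2 : HasDerivAt (deriv ψ) (deriv (deriv ψ) p.1) p.1 :=
    (((contDiff_infty_iff_deriv.1 hψ).2).differentiable (by simp) _).hasDerivAt
  have hF : HasFDerivAt (fun q : ℝ × ℝ => G (q, 0) - G (q, (ψ q.1, deriv ψ q.1, l)))
      (((fderiv ℝ G (p, 0)).comp ((ContinuousLinearMap.id ℝ (ℝ × ℝ)).prod 0)) -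
        (fderiv ℝ G (p, (ψ p.1, deriv ψ p.1, l))).comp
          ((ContinuousLinearMap.id ℝ (ℝ × ℝ)).prod
            (((ContinuousLinearMap.toSpanSingleton ℝ (deriv ψ p.1)).comp
              (ContinuousLinearMap.fst ℝ ℝ ℝ)).prod
            (((ContinuousLinearMap.toSpanSingleton ℝ (deriv (deriv ψ) p.1)).comp
              (ContinuousLinearMap.fst ℝ ℝ ℝ)).prod 0)))) p := by
    have b1 : HasFDerivAt (fun q : ℝ × ℝ => ((q, 0) : (ℝ × ℝ) × (ℝ × ℝ × Λ)))
        ((ContinuousLinearMap.id ℝ (ℝ × ℝ)).prod 0) p :=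
      (hasFDerivAt_id p).prodMk (hasFDerivAt_const _ _)
    have b2 : HasFDerivAt (fun q : ℝ × ℝ =>
        ((q, (ψ q.1, deriv ψ q.1, l)) : (ℝ × ℝ) × (ℝ × ℝ × Λ)))
        ((ContinuousLinearMap.id ℝ (ℝ × ℝ)).prod
            (((ContinuousLinearMap.toSpanSingleton ℝ (deriv ψ p.1)).comp
              (ContinuousLinearMap.fst ℝ ℝ ℝ)).prod
            (((ContinuousLinearMap.toSpanSingleton ℝ (deriv (deriv ψ) p.1)).comp
              (ContinuousLinearMap.fst ℝ ℝ ℝ)).prod 0))) p :=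
      (hasFDerivAt_id p).prodMk ((hd1.hasFDerivAt.comp p hasFDerivAt_fst).prodMk
        ((hd2.hasFDerivAt.comp p hasFDerivAt_fst).prodMk (hasFDerivAt_const _ _)))
    exact ((hG.differentiable (by simp) _).hasFDerivAt.comp p b1).sub
      ((hG.differentiable (by simp) _).hasFDerivAt.comp p b2)
  have hDp := h (ψ p.1, deriv ψ p.1, deriv (deriv ψ) p.1, l) (by
    simp only [norm_prod_le_iff, Real.norm_eq_abs]
    exact ⟨h0 _, h1 _, h2 _, hl⟩) p hp
  have hle := (le_abs_self _).trans hDp.le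
  refine le_trans (le_of_eq ?_) hle
  dsimp only
  rw [hF.fderiv]
  simp [D, ← Prod.zero_eq_mk]

/-! ### The reflection that exchanges the two sides -/

/-- The opposite side of the switching line. -/
def Side.flip : Side → Side
  | .upper => .lower
  | .lower => .upper

@[simp] theorem Side.flip_flip (s : Side) : s.flip.flip = s := by cases s <;> rfl

theorem Side.flip_inj {s t : Side} : s.flip = t.flip ↔ s = t := by cases s <;> cases t <;> simp [flip]

/-- The reflection of the plane in the switching line. -/
noncomputable def mirror : (ℝ × ℝ) ≃L[ℝ] (ℝ × ℝ) :=
  (ContinuousLinearEquiv.refl ℝ ℝ).prodCongr (ContinuousLinearEquiv.neg ℝ)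

@[simp] theorem mirror_apply (p : ℝ × ℝ) : mirror p = (p.1, -p.2) := rfl

theorem mirror_mirror (p : ℝ × ℝ) : mirror (mirror p) = p := by simp

theorem mirror_dist (p q : ℝ × ℝ) : dist (mirror p) (mirror q) = dist p q := by
  simp [Prod.dist_eq, dist_neg_neg]

/-- The time reversal of a piecewise-smooth system, reflected in the switching line. It exchanges
the roles of the two sides and preserves the orientation of closed curves. -/
def PWS.reflect (S : PWS) : PWS where
  f := fun s p => - S.f s.flip (p.1, -p.2)
  g := fun s p => S.g s.flip (p.1, -p.2)

theorem PWS.field_reflect (S : PWS) (s : Side) (p : ℝ × ℝ) :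
    S.reflect.field s p = - mirror (S.field s.flip (mirror p)) := by
  simp [field, reflect]

theorem PWS.Smooth.reflect {S : PWS} (hS : S.Smooth) : S.reflect.Smooth := fun s =>
  ⟨((hS s.flip).1.comp (contDiff_fst.prodMk contDiff_snd.neg)).neg,
    (hS s.flip).2.comp (contDiff_fst.prodMk contDiff_snd.neg)⟩

theorem distC1_mirror (U : Set (ℝ × ℝ)) (X Y : ℝ × ℝ → ℝ) :
    distC1 (mirror ⁻¹' U) (fun p => X (p.1, -p.2)) (fun p => Y (p.1, -p.2)) = distC1 U X Y := by
  have hcl : closure (mirror ⁻¹' U) = mirror ⁻¹' closure U :=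
    (mirror.toHomeomorph.preimage_closure U).symm
  unfold distC1
  congr 1
  have himg : mirror ⁻¹' closure U = mirror '' closure U := by
    ext p
    constructor
    · intro hp; exact ⟨mirror p, hp, mirror_mirror p⟩
    · rintro ⟨q, hq, rfl⟩; rw [mem_preimage, mirror_mirror]; exact hq
  rw [hcl, himg, image_image]
  refine image_congr fun p _ => ?_
  have e : fderiv ℝ (fun q : ℝ × ℝ => X (q.1, -q.2) - Y (q.1, -q.2)) (mirror p) =
      (fderiv ℝ (fun q => X q - Y q) p).comp (mirror : (ℝ × ℝ) →L[ℝ] (ℝ × ℝ)) := by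
    have := mirror.comp_right_fderiv (f := fun q => X q - Y q) (x := mirror p)
    rw [mirror_mirror] at this
    exact this
  rw [e]
  have e2 : ((0 : ℝ), (-1 : ℝ)) = -(0, 1) := by simp
  simp only [mirror_apply, neg_neg, Prod.mk.eta, ContinuousLinearMap.comp_apply,
    ContinuousLinearEquiv.coe_coe, neg_zero]
  rw [e2, map_neg, abs_neg]

theorem distC1_neg (U : Set (ℝ × ℝ)) (X Y : ℝ × ℝ → ℝ) :
    distC1 U (fun p => - X p) (fun p => - Y p) = distC1 U X Y := by
  unfold distC1
  congr 1
  refine image_congr fun p _ => ?_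
  have : (fun q => -X q - -Y q) = -(fun q => X q - Y q) := by funext q; simp; ring
  rw [this, fderiv_neg]
  simp only [neg_apply, abs_neg]
  rw [show -X p - -Y p = -(X p - Y p) by ring, abs_neg]

theorem rho_reflect (U : Set (ℝ × ℝ)) (S S' : PWS) :
    rho (mirror ⁻¹' U) S.reflect S'.reflect = rho U S S' := by
  have hf : ∀ s, distC1 (mirror ⁻¹' U) (S.reflect.f s) (S'.reflect.f s) =
      distC1 U (S.f s.flip) (S'.f s.flip) := fun s => by
    rw [← distC1_mirror U (S.f s.flip)]
    exact distC1_neg _ (fun p => S.f s.flip (p.1, -p.2)) _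
  have hg : ∀ s, distC1 (mirror ⁻¹' U) (S.reflect.g s) (S'.reflect.g s) =
      distC1 U (S.g s.flip) (S'.g s.flip) := fun s => by
    rw [← distC1_mirror U (S.g s.flip)]
    rfl
  unfold rho
  rw [hf, hf, hg, hg]
  simp only [Side.flip]
  ring

theorem mem_switchLine_mirror {U : Set (ℝ × ℝ)} {p : ℝ × ℝ} :
    mirror p ∈ switchLine (mirror ⁻¹' U) ↔ p ∈ switchLine U := by
  simp [switchLine]

theorem mem_zone_mirror {U : Set (ℝ × ℝ)} {s : Side} {p : ℝ × ℝ} :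
    mirror p ∈ zone (mirror ⁻¹' U) s ↔ p ∈ zone U s.flip := by
  cases s <;> simp [zone, Side.flip]

theorem mem_crossing_mirror {S : PWS} {U : Set (ℝ × ℝ)} {p : ℝ × ℝ} :
    mirror p ∈ S.reflect.crossing (mirror ⁻¹' U) ↔ p ∈ S.crossing U := by
  simp [PWS.crossing, switchLine, PWS.reflect, Side.flip, mul_comm]

theorem mem_tangent_mirror {S : PWS} {U : Set (ℝ × ℝ)} {p : ℝ × ℝ} :
    mirror p ∈ S.reflect.tangent (mirror ⁻¹' U) ↔ p ∈ S.tangent U := by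
  simp only [PWS.tangent, switchLine, PWS.reflect, Side.flip, mem_ofPred_eq, mem_preimage,
    mirror_apply, neg_neg, Prod.mk.eta, neg_eq_zero, ne_eq, mul_eq_zero]
  tauto

theorem hasDerivWithinAt_reflect {S : PWS} {s : Side} {T : ℝ} {γ : ℝ → ℝ × ℝ}
    (h : ∀ t ∈ Icc 0 T, HasDerivWithinAt γ (S.field s.flip (γ t)) (Icc 0 T) t) :
    ∀ t ∈ Icc 0 T, HasDerivWithinAt (fun t => mirror (γ (T - t)))
      (S.reflect.field s (mirror (γ (T - t)))) (Icc 0 T) t := by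
  intro t ht
  have hm : MapsTo (fun t => T - t) (Icc 0 T) (Icc 0 T) :=
    fun u hu => ⟨by linarith [hu.2], by linarith [hu.1]⟩
  have h1 := (h (T - t) (hm ht)).scomp t ((hasDerivWithinAt_id t _).const_sub T) hm
  have h2 := (mirror : (ℝ × ℝ) →L[ℝ] (ℝ × ℝ)).hasFDerivAt.comp_hasDerivWithinAt t h1
  refine h2.congr_deriv ?_
  rw [PWS.field_reflect, mirror_mirror]
  simp

namespace Loop

variable {S : PWS} {U : Set (ℝ × ℝ)}

/-- The reflected loop, run through backwards. -/
noncomputable def reflect (L : Loop S U) : Loop S.reflect (mirror ⁻¹' U) where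
  n := L.n
  side := fun i => (L.side (-i)).flip
  T := fun i => L.T (-i)
  γ := fun i t => mirror (L.γ (-i) (L.T (-i) - t))
  T_pos := fun i => L.T_pos _
  orbit := fun i => hasDerivWithinAt_reflect (by simpa using L.orbit (-i))
  start_mem := fun i => by
    rw [sub_zero]; exact mem_switchLine_mirror.2 (L.stop_mem _)
  stop_mem := fun i => by
    rw [sub_self]; exact mem_switchLine_mirror.2 (L.start_mem _)
  inside := fun i t ht => mem_zone_mirror.2 (by
    rw [Side.flip_flip]
    exact L.inside _ _ ⟨by linarith [ht.2], by linarith [ht.1]⟩)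
  closes := fun i => by
    have := L.closes (-(i + 1))
    rw [show -(i + 1) + 1 = -i by abel] at this
    rw [sub_self, sub_zero, this]
  simple := by
    intro i j s hs t ht h
    have h := mirror.injective h
    -- the start point of a reversed segment is the start point of the next original segment
    have key : ∀ (i : Fin (L.n + 1)) (s : ℝ), s ∈ Ico 0 (L.T i) → ∃ (i' : Fin (L.n + 1)) (s' : ℝ),
        s' ∈ Ico 0 (L.T i') ∧ L.γ i (L.T i - s) = L.γ i' s' ∧
        ((s = 0 ∧ i' = i + 1 ∧ s' = 0) ∨ (s ≠ 0 ∧ i' = i ∧ s' = L.T i - s)) := by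
      intro i s hs
      by_cases h0 : s = 0
      · exact ⟨i + 1, 0, ⟨le_rfl, L.T_pos _⟩, by rw [h0, sub_zero, L.closes], Or.inl ⟨h0, rfl, rfl⟩⟩
      · have : 0 < s := lt_of_le_of_ne hs.1 (Ne.symm h0)
        exact ⟨i, L.T i - s, ⟨by linarith [hs.2], by linarith⟩, rfl, Or.inr ⟨h0, rfl, rfl⟩⟩
    obtain ⟨i', s', hs', e1, c1⟩ := key (-i) s hs
    obtain ⟨j', t', ht', e2, c2⟩ := key (-j) t ht
    rw [e1, e2] at h
    obtain ⟨hij, hst⟩ := L.simple i' j' s' hs' t' ht' h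
    rcases c1 with ⟨a1, a2, a3⟩ | ⟨a1, a2, a3⟩ <;> rcases c2 with ⟨b1, b2, b3⟩ | ⟨b1, b2, b3⟩
    · rw [a2, b2] at hij
      exact ⟨neg_injective (add_right_cancel hij), by rw [a1, b1]⟩
    · exfalso; rw [a3, b3] at hst; linarith [ht.2]
    · exfalso; rw [a3, b3] at hst; linarith [hs.2]
    · have e : i = j := by rw [a2, b2] at hij; exact neg_injective hij
      subst e
      exact ⟨rfl, by rw [a3, b3] at hst; linarith⟩

theorem carrier_reflect (L : Loop S U) : L.reflect.carrier = mirror ⁻¹' L.carrier := by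
  ext p
  simp only [carrier, mem_preimage, mem_iUnion, mem_image]
  constructor
  · rintro ⟨i, t, ht, rfl⟩
    have ht : t ∈ Icc 0 (L.T (-i)) := ht
    exact ⟨-i, L.T (-i) - t, ⟨by linarith [ht.2], by linarith [ht.1]⟩, (mirror_mirror _).symm⟩
  · rintro ⟨i, t, ht, h⟩
    refine ⟨-i, L.T i - t, ?_, ?_⟩
    · change L.T i - t ∈ Icc 0 (L.T (- -i))
      rw [neg_neg]; exact ⟨by linarith [ht.2], by linarith [ht.1]⟩
    · change mirror (L.γ (- -i) (L.T (- -i) - (L.T i - t))) = p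
      rw [neg_neg, sub_sub_cancel, h, mirror_mirror]

theorem reflect_start (L : Loop S U) (i j : Fin (L.n + 1)) (h : j = i + 1) :
    L.reflect.γ j 0 = mirror (L.γ (-i) 0) := by
  subst h
  change mirror (L.γ (-(i + 1)) (L.T (-(i + 1)) - 0)) = _
  rw [sub_zero, L.closes, show -(i + 1) + 1 = -i by abel]

theorem switchingPoints_reflect (L : Loop S U) {p : ℝ × ℝ} :
    p ∈ L.reflect.switchingPoints ↔ mirror p ∈ L.switchingPoints := by
  constructor
  · rintro ⟨i, hi, rfl⟩
    have key : ∀ i : Fin (L.n + 1), (L.side (-i)).flip ≠ (L.side (-(i + 1))).flip →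
        mirror (mirror (L.γ (-i) 0)) ∈ L.switchingPoints := by
      intro i hi
      refine ⟨-(i + 1), ?_, ?_⟩
      · rw [show -(i + 1) + 1 = -i by abel]
        exact fun h => hi (congrArg Side.flip h.symm)
      · rw [show -(i + 1) + 1 = -i by abel, mirror_mirror]
    have := key i hi
    rwa [← L.reflect_start i _ rfl] at this
  · rintro ⟨i, hi, hp⟩
    have key : ∃ j j' : Fin (L.n + 1), j' = j + 1 ∧ (L.side (-j)).flip ≠ (L.side (-j')).flip ∧
        p = mirror (L.γ (-j) 0) := by
      refine ⟨-(i + 1), -i, by abel, ?_, ?_⟩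
      · rw [neg_neg, neg_neg]
        exact fun h => hi (Side.flip_inj.1 h).symm
      · rw [neg_neg, ← hp, mirror_mirror]
    obtain ⟨j, j', rfl, h1, h2⟩ := key
    exact ⟨j, h1, by rw [h2]; exact (L.reflect_start j _ rfl).symm⟩

theorem IsNonsliding.reflect {L : Loop S U} (h : L.IsNonsliding) : L.reflect.IsNonsliding := by
  obtain ⟨i, hi⟩ := h
  have key : ∃ j : Fin (L.n + 1), mirror (L.γ i 0) = L.reflect.γ j 0 :=
    ⟨-i + 1, by rw [L.reflect_start (-i) _ rfl, neg_neg]⟩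
  obtain ⟨j, hj⟩ := key
  exact ⟨j, by rw [← hj]; exact mem_tangent_mirror.2 hi⟩

theorem tangentPoints_reflect (L : Loop S U) :
    L.reflect.tangentPoints = mirror ⁻¹' L.tangentPoints := by
  ext p
  rw [tangentPoints, mem_inter_iff, carrier_reflect, ← mirror_mirror p, mem_tangent_mirror]
  simp only [mem_preimage, mirror_mirror, tangentPoints, mem_inter_iff]

theorem IsCro.reflect {L : Loop S U} (h : L.IsCro) : L.reflect.IsCro := by
  obtain ⟨h1, ⟨p, hp⟩, h3⟩ := h
  refine ⟨h1.reflect, ⟨mirror p, ?_⟩, fun q hq => ?_⟩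
  · rw [switchingPoints_reflect, mirror_mirror]; exact hp
  · rw [← mirror_mirror q, mem_crossing_mirror]
    exact h3 ((switchingPoints_reflect L).1 hq)

theorem IsCri.reflect {L : Loop S U} (h : L.IsCri) : L.reflect.IsCri := by
  obtain ⟨h1, ⟨p, hp⟩, ⟨q, hq, hqc⟩⟩ := h
  refine ⟨h1.reflect, ⟨mirror p, ?_⟩, ⟨mirror q, ?_, ?_⟩⟩
  · rw [switchingPoints_reflect, mirror_mirror]; exact hp
  · rw [switchingPoints_reflect, mirror_mirror]; exact hq
  · rw [mem_crossing_mirror]; exact hqc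

end Loop

theorem thickening_mirror (ε : ℝ) (K : Set (ℝ × ℝ)) :
    Metric.thickening ε (mirror ⁻¹' K) = mirror ⁻¹' Metric.thickening ε K := by
  ext p
  simp only [Metric.mem_thickening_iff, mem_preimage]
  constructor
  · rintro ⟨q, hq, h⟩
    exact ⟨mirror q, hq, by rwa [mirror_dist]⟩
  · rintro ⟨q, hq, h⟩
    exact ⟨mirror q, by rwa [mirror_mirror], by rwa [← mirror_dist, mirror_mirror]⟩

/-- `Bifurcates`, with the loop `L₀` replaced by the point set `K` near which the new loops lie. -/
def BifurcatesFrom (U : Set (ℝ × ℝ)) (f φ : Side → ℝ × ℝ → ℝ) (m : Side → ℕ)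
    (K : Set (ℝ × ℝ)) (C : (S : PWS) → Loop S U → Prop) (ℓ : ℕ) : Prop :=
  ∃ (d : Side → ℕ) (hd : ∀ s, 0 < d s) (r₁ r₂ : Side → ℝ), (∀ s, r₁ s < r₂ s) ∧
    ∀ ε : ℝ, 0 < ε →
      ∃ (lam : (s : Side) → Fin (m s) → ℝ) (k : (s : Side) → Fin (3 * d s + 1) → ℝ) (S : PWS),
        S = unfolding f φ m lam (fun s => psi (d s) (hd s) (r₁ s) (r₂ s) (k s)) ∧
        (∃ s, lam s ≠ 0) ∧ (∀ s, ‖lam s‖ < ε) ∧ (∀ s, ‖k s‖ < ε) ∧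
        S.Smooth ∧ rho U (baseSystem f φ m) S < ε ∧
        ∃ L : Loop S U, C S L ∧
          L.carrier ⊆ Metric.thickening ε K ∧
          K ⊆ Metric.thickening ε L.carrier ∧
          L.tangentPoints.encard = ℓ ∧ L.tangentPoints ⊆ Metric.ball (0, 0) ε

/-- Change the sign of the heights of the bumps. -/
def negHeights {d : ℕ} (k : Fin (3 * d + 1) → ℝ) (j : Fin (3 * d + 1)) : ℝ :=
  if (j : ℕ) ≤ 2 * d then k j else - k j

theorem negHeights_knot {d : ℕ} (k : Fin (3 * d + 1) → ℝ) {j : Fin (3 * d + 1)}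
    (h : (j : ℕ) ≤ 2 * d) : negHeights k j = k j := by simp [negHeights, h]

theorem negHeights_height {d : ℕ} (k : Fin (3 * d + 1) → ℝ) {j : Fin (3 * d + 1)}
    (h : 2 * d < (j : ℕ)) : negHeights k j = - k j := by simp [negHeights, not_le.2 h]

theorem psi_negHeights {d : ℕ} (hd : 0 < d) (r₁ r₂ : ℝ) (k : Fin (3 * d + 1) → ℝ) (x : ℝ) :
    psi d hd r₁ r₂ (negHeights k) x = - psi d hd r₁ r₂ k x := by
  have hK : negHeights k ∈ paramK d ↔ k ∈ paramK d := by
    simp only [paramK, mem_ofPred_eq]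
    refine forall_congr' fun i => ?_
    rw [negHeights_knot k (by dsimp only; omega), negHeights_knot k (by dsimp only; omega)]
  by_cases h : k ∈ paramK d
  · rw [psi, psi, if_pos h, if_pos (hK.2 h), ← Finset.sum_neg_distrib]
    refine Finset.sum_congr rfl fun i _ => ?_
    have hi := i.2
    have e0 : negHeights k ⟨2 * i, by omega⟩ = k ⟨2 * i, by omega⟩ :=
      negHeights_knot k (by dsimp only; omega)
    have e1 : negHeights k ⟨2 * i + 1, by omega⟩ = k ⟨2 * i + 1, by omega⟩ :=
      negHeights_knot k (by dsimp only; omega)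
    have e2 : negHeights k ⟨2 * i + 2, by omega⟩ = k ⟨2 * i + 2, by omega⟩ :=
      negHeights_knot k (by dsimp only; omega)
    have e3 : negHeights k ⟨2 * d + 1 + i, by omega⟩ = - k ⟨2 * d + 1 + i, by omega⟩ :=
      negHeights_height k (by dsimp only; omega)
    unfold bump
    rw [e0, e1, e2, e3]
    split_ifs <;> ring
  · rw [psi, psi, if_neg h, if_neg (fun h' => h (hK.1 h')),
      negHeights_height k (by dsimp only; omega)]
    ring

theorem norm_negHeights {d : ℕ} (k : Fin (3 * d + 1) → ℝ) : ‖negHeights k‖ = ‖k‖ := by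
  have h : ∀ j, ‖negHeights k j‖ = ‖k j‖ := by
    intro j; unfold negHeights; split_ifs <;> simp
  simp only [Pi.norm_def]
  congr 1
  refine Finset.sup_congr rfl fun j _ => ?_
  exact NNReal.coe_injective (h j)

/-- The component functions of the reflected system, up to the sign of the first. -/
def flipComp (X : Side → ℝ × ℝ → ℝ) (s : Side) (p : ℝ × ℝ) : ℝ := X s.flip (p.1, -p.2)

theorem flipComp_flipComp (X : Side → ℝ × ℝ → ℝ) : flipComp (flipComp X) = X := by
  funext s p; simp [flipComp]

theorem reflect_baseSystem (f φ : Side → ℝ × ℝ → ℝ) (m : Side → ℕ) :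
    (baseSystem f φ m).reflect = baseSystem (-flipComp f) (flipComp φ) (m ∘ Side.flip) := rfl

theorem reflect_unfolding (f φ : Side → ℝ × ℝ → ℝ) (m : Side → ℕ) (lam : (s : Side) → Fin (m s) → ℝ)
    (Ψ Ψ' : Side → ℝ → ℝ) (h : ∀ s x, Ψ' s x = - Ψ s.flip x) :
    (unfolding f φ m lam Ψ).reflect =
      unfolding (-flipComp f) (flipComp φ) (m ∘ Side.flip) (fun s => lam s.flip) Ψ' := by
  have hd : ∀ s x, deriv (Ψ' s) x = - deriv (Ψ s.flip) x := fun s x => by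
    rw [show Ψ' s = fun x => - Ψ s.flip x from funext (h s), deriv.fun_neg]
  unfold unfolding PWS.reflect
  congr 1
  · funext s p
    simp only [Pi.neg_apply, flipComp, h]
    rw [neg_add, neg_neg]
  · funext s p
    simp only [Pi.neg_apply, flipComp, h, hd, Function.comp]
    rw [neg_add, neg_neg, mul_neg, neg_mul, neg_neg]

theorem BifurcatesFrom.reflect {U : Set (ℝ × ℝ)} {f φ : Side → ℝ × ℝ → ℝ} {m : Side → ℕ}
    {K : Set (ℝ × ℝ)} {C : (S : PWS) → Loop S U → Prop}
    {C' : (S : PWS) → Loop S (mirror ⁻¹' U) → Prop}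
    (hC : ∀ S (L : Loop S U), C S L → C' S.reflect L.reflect) {ℓ : ℕ}
    (h : BifurcatesFrom U f φ m K C ℓ) :
    BifurcatesFrom (mirror ⁻¹' U) (-flipComp f) (flipComp φ) (m ∘ Side.flip) (mirror ⁻¹' K) C' ℓ := by
  obtain ⟨d, hd, r₁, r₂, hr, h⟩ := h
  refine ⟨fun s => d s.flip, fun s => hd _, fun s => r₁ s.flip, fun s => r₂ s.flip,
    fun s => hr _, fun ε hε => ?_⟩
  obtain ⟨lam, k, S, hS, ⟨s₀, hs₀⟩, hlam, hk, hsm, hrho, L, hL, h1, h2, h3, h4⟩ := h ε hε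
  refine ⟨fun s => lam s.flip, fun s => negHeights (k s.flip), S.reflect, ?_,
    ⟨s₀.flip, by cases s₀ <;> exact hs₀⟩, fun s => hlam _, fun s => ?_, hsm.reflect, ?_, L.reflect,
    hC S L hL, ?_, ?_, ?_, ?_⟩
  · rw [hS]
    exact reflect_unfolding f φ m lam _ _ fun s x => psi_negHeights _ _ _ _ x
  · rw [norm_negHeights]; exact hk _
  · rw [← reflect_baseSystem, rho_reflect]; exact hrho
  · rw [Loop.carrier_reflect, thickening_mirror]; exact preimage_mono h1
  · rw [Loop.carrier_reflect, thickening_mirror]; exact preimage_mono h2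
  · rw [Loop.tangentPoints_reflect, ← h3]
    exact encard_preimage_of_bijective mirror.bijective _
  · rw [Loop.tangentPoints_reflect]
    intro p hp
    have := h4 hp
    rw [Metric.mem_ball] at this ⊢
    rwa [← mirror_dist, show mirror (0, 0) = (0, 0) by simp]

/-! ### The two arcs of the unperturbed loop and the signs at the origin -/

theorem HasDerivWithinAt.fst_prod {γ : ℝ → ℝ × ℝ} {v : ℝ × ℝ} {s : Set ℝ} {t : ℝ}
    (h : HasDerivWithinAt γ v s t) : HasDerivWithinAt (fun t => (γ t).1) v.1 s t :=
  (ContinuousLinearMap.fst ℝ ℝ ℝ).hasFDerivAt.comp_hasDerivWithinAt t h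

theorem HasDerivWithinAt.snd_prod {γ : ℝ → ℝ × ℝ} {v : ℝ × ℝ} {s : Set ℝ} {t : ℝ}
    (h : HasDerivWithinAt γ v s t) : HasDerivWithinAt (fun t => (γ t).2) v.2 s t :=
  (ContinuousLinearMap.snd ℝ ℝ ℝ).hasFDerivAt.comp_hasDerivWithinAt t h

theorem HasDerivAt.fst_prod {γ : ℝ → ℝ × ℝ} {v : ℝ × ℝ} {t : ℝ}
    (h : HasDerivAt γ v t) : HasDerivAt (fun t => (γ t).1) v.1 t :=
  (ContinuousLinearMap.fst ℝ ℝ ℝ).hasFDerivAt.comp_hasDerivAt t h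

theorem HasDerivAt.snd_prod {γ : ℝ → ℝ × ℝ} {v : ℝ × ℝ} {t : ℝ}
    (h : HasDerivAt γ v t) : HasDerivAt (fun t => (γ t).2) v.2 t :=
  (ContinuousLinearMap.snd ℝ ℝ ℝ).hasFDerivAt.comp_hasDerivAt t h

/-- The two arcs of a clockwise loop that meets the switching line exactly at the crossing point
`(a, 0)`, `a < 0`, and at the origin: an upper arc from `(a, 0)` to the origin and a lower arc
back. -/
structure Arcs (S : PWS) (U : Set (ℝ × ℝ)) (a : ℝ) where
  T : Side → ℝ
  γ : Side → ℝ → ℝ × ℝ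
  T_pos : ∀ s, 0 < T s
  orbit : ∀ s, ∀ t ∈ Icc 0 (T s),
    HasDerivWithinAt (γ s) (S.field s (γ s t)) (Icc 0 (T s)) t
  inside : ∀ s, ∀ t ∈ Ioo 0 (T s), γ s t ∈ zone U s
  upper_start : γ .upper 0 = (a, 0)
  upper_end : γ .upper (T .upper) = (0, 0)
  lower_start : γ .lower 0 = (0, 0)
  lower_end : γ .lower (T .lower) = (a, 0)
  neg : a < 0
  crossing : (a, 0) ∈ S.crossing U

namespace Arcs

variable {S : PWS} {U : Set (ℝ × ℝ)} {a : ℝ}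

/-- The underlying point set. -/
def carrier (A : Arcs S U a) : Set (ℝ × ℝ) := ⋃ s, A.γ s '' Icc 0 (A.T s)

/-- Reflection together with time reversal exchanges the two arcs. -/
noncomputable def reflect (A : Arcs S U a) : Arcs S.reflect (mirror ⁻¹' U) a where
  T := fun s => A.T s.flip
  γ := fun s t => mirror (A.γ s.flip (A.T s.flip - t))
  T_pos := fun s => A.T_pos _
  orbit := fun s => hasDerivWithinAt_reflect (A.orbit s.flip)
  inside := fun s t ht => mem_zone_mirror.2 (A.inside _ _ ⟨by linarith [ht.2], by linarith [ht.1]⟩)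
  upper_start := by
    change mirror (A.γ .lower (A.T .lower - 0)) = _
    rw [sub_zero, A.lower_end]; simp
  upper_end := by
    change mirror (A.γ .lower (A.T .lower - A.T .lower)) = _
    rw [sub_self, A.lower_start]; simp
  lower_start := by
    change mirror (A.γ .upper (A.T .upper - 0)) = _
    rw [sub_zero, A.upper_end]; simp
  lower_end := by
    change mirror (A.γ .upper (A.T .upper - A.T .upper)) = _
    rw [sub_self, A.upper_start]; simp
  neg := A.neg
  crossing := by
    have := mem_crossing_mirror.2 A.crossing
    simpa using this

theorem carrier_reflect (A : Arcs S U a) : A.reflect.carrier = mirror ⁻¹' A.carrier := by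
  ext p
  simp only [carrier, mem_preimage, mem_iUnion, mem_image]
  constructor
  · rintro ⟨s, t, ht, rfl⟩
    have ht : t ∈ Icc 0 (A.T s.flip) := ht
    exact ⟨s.flip, A.T s.flip - t, ⟨by linarith [ht.2], by linarith [ht.1]⟩,
      (mirror_mirror _).symm⟩
  · rintro ⟨s, t, ht, h⟩
    refine ⟨s.flip, A.T s - t, ?_, ?_⟩
    · change A.T s - t ∈ Icc 0 (A.T s.flip.flip)
      rw [Side.flip_flip]; exact ⟨by linarith [ht.2], by linarith [ht.1]⟩
    · change mirror (A.γ s.flip.flip (A.T s.flip.flip - (A.T s - t))) = p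
      rw [Side.flip_flip, sub_sub_cancel, h, mirror_mirror]

theorem continuousOn (A : Arcs S U a) (s : Side) : ContinuousOn (A.γ s) (Icc 0 (A.T s)) :=
  fun t ht => (A.orbit s t ht).continuousWithinAt

theorem isCompact_carrier (A : Arcs S U a) : IsCompact A.carrier := by
  have : Finite Side := Finite.intro (n := 2) ⟨fun s => match s with | .upper => 0 | .lower => 1,
    fun i => if i = 0 then .upper else .lower, fun s => by cases s <;> rfl,
    fun i => by fin_cases i <;> rfl⟩
  exact isCompact_iUnion fun s => isCompact_Icc.image_of_continuousOn (A.continuousOn s)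

theorem mem_zone_or_eq (A : Arcs S U a) (s : Side) {t : ℝ} (ht : t ∈ Icc 0 (A.T s)) :
    A.γ s t ∈ zone U s ∨ A.γ s t = (a, 0) ∨ A.γ s t = (0, 0) := by
  rcases eq_or_lt_of_le ht.1 with h | h
  · right; subst h
    cases s
    · exact Or.inl A.upper_start
    · exact Or.inr A.lower_start
  rcases eq_or_lt_of_le ht.2 with h' | h'
  · right; subst h'
    cases s
    · exact Or.inr A.upper_end
    · exact Or.inl A.lower_end
  · exact Or.inl (A.inside s t ⟨h, h'⟩)

theorem eq_of_mem_carrier (A : Arcs S U a) {p : ℝ × ℝ} (hp : p ∈ A.carrier) (h0 : p.2 = 0) :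
    p = (a, 0) ∨ p = (0, 0) := by
  simp only [carrier, mem_iUnion, mem_image] at hp
  obtain ⟨s, t, ht, rfl⟩ := hp
  rcases A.mem_zone_or_eq s ht with h | h
  · exfalso
    cases s <;> simp only [zone, mem_ofPred_eq, h0, lt_irrefl, and_false] at h
  · exact h

end Arcs

/-- A loop satisfying hypothesis (H) consists of two arcs. -/
theorem Loop.HypH.exists_arcs {S : PWS} {U : Set (ℝ × ℝ)} {L : Loop S U} {a : ℝ} (h : L.HypH a) :
    ∃ A : Arcs S U a, A.carrier = L.carrier := by
  obtain ⟨⟨-, ⟨p, k, hk, -⟩, -⟩, ha, hcr, hmeet, i, hside, hstart, hfin⟩ := h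
  have hnext : L.γ (i + 1) 0 = (0, 0) := by rw [← L.closes, hfin]
  have hinj : ∀ j k, L.γ j 0 = L.γ k 0 → j = k := fun j k h =>
    (L.simple j k 0 ⟨le_rfl, L.T_pos j⟩ 0 ⟨le_rfl, L.T_pos k⟩ h).1
  have hij : i ≠ i + 1 := fun h => by
    have : ((a, 0) : ℝ × ℝ) = (0, 0) := by rw [← hstart, ← hnext, ← h]
    exact ha.ne (congrArg Prod.fst this)
  have hmem : ∀ j, j = i ∨ j = i + 1 := by
    intro j
    have : L.γ j 0 ∈ L.carrier ∩ switchLine U :=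
      ⟨mem_iUnion.2 ⟨j, 0, ⟨le_rfl, (L.T_pos j).le⟩, rfl⟩, L.start_mem j⟩
    rw [hmeet] at this
    rcases this with h | h
    · left; exact hinj _ _ (by rw [h, hstart])
    · right; exact hinj _ _ (by rw [h, hnext])
  have hnn : i + 1 + 1 = i := by
    rcases hmem (i + 1 + 1) with h | h
    · exact h
    · exact absurd (add_right_cancel h) hij.symm
  have hlow : L.side (i + 1) = .lower := by
    have : L.side i ≠ L.side (i + 1) := by
      rcases hmem k with rfl | rfl
      · exact hk
      · rw [hnn] at hk; exact hk.symm
    rw [hside] at this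
    cases h : L.side (i + 1)
    · exact absurd h.symm this
    · rfl
  let idx : Side → Fin (L.n + 1) := fun s => match s with
    | .upper => i
    | .lower => i + 1
  have hidx : ∀ s, L.side (idx s) = s := fun s => by
    cases s
    · exact hside
    · exact hlow
  refine ⟨⟨fun s => L.T (idx s), fun s => L.γ (idx s), fun s => L.T_pos _, fun s t ht => ?_,
    fun s t ht => ?_, hstart, hfin, hnext, ?_, ha, hcr⟩, ?_⟩
  · have := L.orbit (idx s) t ht
    rwa [hidx] at this
  · have := L.inside (idx s) t ht
    rwa [hidx] at this
  · change L.γ (i + 1) (L.T (i + 1)) = _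
    rw [L.closes, hnn, hstart]
  · ext p
    simp only [Arcs.carrier, Loop.carrier, mem_iUnion]
    constructor
    · rintro ⟨s, hs⟩; exact ⟨idx s, hs⟩
    · rintro ⟨j, hj⟩
      rcases hmem j with rfl | rfl
      · exact ⟨.upper, hj⟩
      · exact ⟨.lower, hj⟩

/-- Sign of the vertical speed along an arc that leaves the origin into the lower zone: just after
departure `x` has the sign of `f⁻(O)`, and there `φ⁻ x^m` must be negative. -/
theorem Arcs.lower_sign {f φ : Side → ℝ × ℝ → ℝ} {m : Side → ℕ} {U : Set (ℝ × ℝ)} {a : ℝ}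
    (A : Arcs (baseSystem f φ m) U a) (hφ : Continuous (φ .lower))
    (hf0 : f .lower (0, 0) ≠ 0) (hφ0 : φ .lower (0, 0) ≠ 0) :
    φ .lower (0, 0) * f .lower (0, 0) ^ m .lower < 0 := by
  by_contra hcon
  have hpos : 0 < φ .lower (0, 0) * f .lower (0, 0) ^ m .lower :=
    lt_of_le_of_ne (not_lt.1 hcon) (mul_ne_zero hφ0 (pow_ne_zero _ hf0)).symm
  have hT := A.T_pos .lower
  have h0 : (0 : ℝ) ∈ Icc 0 (A.T .lower) := ⟨le_rfl, hT.le⟩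
  have horb := A.orbit .lower
  have hx : ∀ t ∈ Icc 0 (A.T .lower), HasDerivWithinAt (fun t => (A.γ .lower t).1)
      (f .lower (A.γ .lower t)) (Icc 0 (A.T .lower)) t := fun t ht =>
    HasDerivWithinAt.fst_prod (horb t ht)
  have hy : ∀ t ∈ Icc 0 (A.T .lower), HasDerivWithinAt (fun t => (A.γ .lower t).2)
      (φ .lower (A.γ .lower t) * (A.γ .lower t).1 ^ m .lower) (Icc 0 (A.T .lower)) t :=
    fun t ht => HasDerivWithinAt.snd_prod (horb t ht)
  -- the quotient `x / t` tends to `f⁻(O)`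
  have hslope : Filter.Tendsto (fun t => (A.γ .lower t).1 / t) (nhdsWithin 0 (Ioi 0))
      (nhds (f .lower (0, 0))) := by
    have h1 := hasDerivWithinAt_iff_tendsto_slope.1 (hx 0 h0)
    have hset : nhdsWithin (0 : ℝ) (Icc 0 (A.T .lower) \ {0}) = nhdsWithin 0 (Ioi 0) := by
      rw [Icc_sdiff_left, nhdsWithin_Ioc_eq_nhdsGT hT]
    rw [hset, A.lower_start] at h1
    refine h1.congr fun t => ?_
    rw [slope_def_field, A.lower_start, sub_zero, sub_zero]
  have hφt : Filter.Tendsto (fun t => φ .lower (A.γ .lower t)) (nhdsWithin 0 (Ioi 0))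
      (nhds (φ .lower (0, 0))) := by
    have h1 := (A.continuousOn .lower 0 h0)
    have h2 : Filter.Tendsto (A.γ .lower) (nhdsWithin 0 (Ioi 0)) (nhds (A.γ .lower 0)) :=
      h1.mono_left (by
        rw [← nhdsWithin_Ioc_eq_nhdsGT hT]; exact nhdsWithin_mono _ Ioc_subset_Icc_self)
    rw [A.lower_start] at h2
    exact hφ.continuousAt.tendsto.comp h2
  have hev := (hφt.mul (hslope.pow (m .lower))).eventually (lt_mem_nhds hpos)
  obtain ⟨u, hu, hu'⟩ := (mem_nhdsGT_iff_exists_Ioo_subset).1 hev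
  have hu0 : (0 : ℝ) < u := hu
  set v := min u (A.T .lower) / 2 with hv
  have hv0 : 0 < v := by positivity
  have hvu : v < u := by
    have := min_le_left u (A.T .lower); linarith
  have hvT : v < A.T .lower := by
    have := min_le_right u (A.T .lower); linarith
  have hmono : MonotoneOn (fun t => (A.γ .lower t).2) (Icc 0 v) := by
    refine monotoneOn_of_deriv_nonneg (convex_Icc _ _)
      (fun t ht => ((hy t ⟨ht.1, ht.2.trans hvT.le⟩).continuousWithinAt.mono
        (Icc_subset_Icc_right hvT.le))) ?_ ?_
    · intro t ht
      rw [interior_Icc] at ht ⊢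
      exact ((hy t ⟨ht.1.le, (ht.2.trans hvT).le⟩).mono
        (Ioo_subset_Icc_self.trans (Icc_subset_Icc_right hvT.le))).differentiableWithinAt
    · intro t ht
      rw [interior_Icc] at ht
      have hd := (hy t ⟨ht.1.le, (ht.2.trans hvT).le⟩).hasDerivAt
        (Icc_mem_nhds ht.1 (ht.2.trans hvT))
      rw [hd.deriv]
      have h1 : 0 < φ .lower (A.γ .lower t) * ((A.γ .lower t).1 / t) ^ m .lower :=
        hu' ⟨ht.1, ht.2.trans hvu⟩
      have h2 : φ .lower (A.γ .lower t) * (A.γ .lower t).1 ^ m .lower =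
          φ .lower (A.γ .lower t) * ((A.γ .lower t).1 / t) ^ m .lower * t ^ m .lower := by
        rw [mul_assoc, ← mul_pow, div_mul_cancel₀ _ ht.1.ne']
      rw [h2]
      exact (mul_pos h1 (pow_pos ht.1 _)).le
  have h1 := hmono ⟨le_rfl, hv0.le⟩ ⟨hv0.le, le_rfl⟩ hv0.le
  have h2 := (A.inside .lower v ⟨hv0, hvT⟩).2
  simp only [A.lower_start] at h1
  linarith

theorem Arcs.upper_sign {f φ : Side → ℝ × ℝ → ℝ} {m : Side → ℕ} {U : Set (ℝ × ℝ)} {a : ℝ}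
    (A : Arcs (baseSystem f φ m) U a) (hφ : Continuous (φ .upper))
    (hf0 : f .upper (0, 0) ≠ 0) (hφ0 : φ .upper (0, 0) ≠ 0) :
    φ .upper (0, 0) * (- f .upper (0, 0)) ^ m .upper < 0 := by
  have h := Arcs.lower_sign (f := -flipComp f) (φ := flipComp φ) (m := m ∘ Side.flip) A.reflect
    (hφ.comp (by fun_prop)) (by simpa [flipComp, Side.flip] using hf0)
    (by simpa [flipComp, Side.flip] using hφ0)
  simpa [flipComp, Side.flip] using h

/-! ### Local analysis near the two contacts of the unperturbed loop -/

theorem deriv_nonneg_of_start {y : ℝ → ℝ} {y' T : ℝ} (hT : 0 < T)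
    (h : HasDerivWithinAt y y' (Icc 0 T) 0) (h0 : y 0 = 0) (hy : ∀ t ∈ Icc 0 T, 0 ≤ y t) :
    0 ≤ y' := by
  have h1 := hasDerivWithinAt_iff_tendsto_slope.1 h
  rw [Icc_sdiff_left] at h1
  have : (nhdsWithin (0 : ℝ) (Ioc 0 T)).NeBot := by
    rw [nhdsWithin_Ioc_eq_nhdsGT hT]; infer_instance
  refine ge_of_tendsto h1 ?_
  filter_upwards [self_mem_nhdsWithin] with t ht
  rw [slope_def_field, h0, sub_zero, sub_zero]
  exact div_nonneg (hy t ⟨ht.1.le, ht.2⟩) ht.1.le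

theorem deriv_nonpos_of_end {y : ℝ → ℝ} {y' T : ℝ} (hT : 0 < T)
    (h : HasDerivWithinAt y y' (Icc 0 T) T) (h0 : y T = 0) (hy : ∀ t ∈ Icc 0 T, 0 ≤ y t) :
    y' ≤ 0 := by
  have h1 := hasDerivWithinAt_iff_tendsto_slope.1 h
  rw [Icc_sdiff_right] at h1
  have : (nhdsWithin T (Ico 0 T)).NeBot := by
    rw [nhdsWithin_Ico_eq_nhdsLT hT]; infer_instance
  refine le_of_tendsto h1 ?_
  filter_upwards [self_mem_nhdsWithin] with t ht
  rw [slope_def_field, h0, sub_zero]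
  exact div_nonpos_of_nonneg_of_nonpos (hy t ⟨ht.1, ht.2.le⟩) (by linarith [ht.2])

theorem exists_ball_abs_sub_lt {h : ℝ × ℝ → ℝ} (hc : Continuous h) {q : ℝ × ℝ} (hq : h q ≠ 0) :
    ∃ r : ℝ, 0 < r ∧ ∀ p, dist p q < r → |h p - h q| < |h q| / 2 :=
  Metric.continuousAt_iff.1 hc.continuousAt _ (half_pos (abs_pos.2 hq))

theorem mul_pos_of_abs_sub_lt {u v w : ℝ} (h1 : |u - v| < |v| / 2) (h2 : |u - w| < |v| / 2) :
    0 < w * v := by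
  have h3 : |w - v| < |v| := by
    calc |w - v| ≤ |w - u| + |u - v| := abs_sub_le _ _ _
      _ < |v| := by rw [abs_sub_comm w u]; linarith
  rcases le_total 0 v with h | h
  · rw [abs_of_nonneg h] at h3
    have := (abs_lt.1 h3).1
    have : 0 < v := by
      rcases h.lt_or_eq with h | h
      · exact h
      · rw [← h] at h3; exact absurd h3 (not_lt.2 (abs_nonneg _))
    exact mul_pos (by linarith) this
  · rw [abs_of_nonpos h] at h3
    have := (abs_lt.1 h3).2
    have : v < 0 := by
      rcases h.lt_or_eq with h | h
      · exact h
      · rw [h, neg_zero] at h3; exact absurd h3 (not_lt.2 (abs_nonneg _))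
    exact mul_pos_of_neg_of_neg (by linarith) this

/-- Points of the switching line close to the loop are close to one of its two points there. -/
theorem Arcs.exists_near_ends {S : PWS} {U : Set (ℝ × ℝ)} {a : ℝ} (A : Arcs S U a) {δ : ℝ}
    (hδ : 0 < δ) : ∃ ε : ℝ, 0 < ε ∧ ∀ p : ℝ × ℝ, p.2 = 0 → p ∈ Metric.thickening ε A.carrier →
      dist p (a, 0) < δ ∨ dist p (0, 0) < δ := by
  let K := A.carrier \ (Metric.ball (a, 0) (δ / 2) ∪ Metric.ball (0, 0) (δ / 2))
  have hK : IsCompact K := A.isCompact_carrier.diff (Metric.isOpen_ball.union Metric.isOpen_ball)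
  obtain ⟨c, hc, hcK⟩ : ∃ c > 0, ∀ q ∈ K, c ≤ |q.2| := by
    rcases K.eq_empty_or_nonempty with h | h
    · exact ⟨1, one_pos, by simp [h]⟩
    · obtain ⟨q, hq, hmin⟩ := hK.exists_isMinOn h (f := fun q => |q.2|)
        (continuous_snd.abs).continuousOn
      refine ⟨|q.2|, abs_pos.2 fun h0 => ?_, fun q' hq' => hmin hq'⟩
      rcases A.eq_of_mem_carrier hq.1 h0 with h | h
      · exact hq.2 (Or.inl (by rw [h]; exact Metric.mem_ball_self (by positivity)))
      · exact hq.2 (Or.inr (by rw [h]; exact Metric.mem_ball_self (by positivity)))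
  refine ⟨min c (δ / 2), by positivity, fun p hp0 hp => ?_⟩
  obtain ⟨q, hq, hpq⟩ := Metric.mem_thickening_iff.1 hp
  have h1 : dist p q < δ / 2 := hpq.trans_le (min_le_right _ _)
  have h2 : |q.2| < c := by
    have h3 : dist p.2 q.2 ≤ dist p q := by rw [Prod.dist_eq]; exact le_max_right _ _
    rw [hp0, Real.dist_eq, zero_sub, abs_neg] at h3
    exact h3.trans_lt (hpq.trans_le (min_le_left _ _))
  have hqK : q ∉ K := fun h => absurd (hcK q h) (not_le.2 h2)
  have hq' : q ∈ Metric.ball ((a, 0) : ℝ × ℝ) (δ / 2) ∪ Metric.ball (0, 0) (δ / 2) := by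
    by_contra h; exact hqK ⟨hq, h⟩
  rcases hq' with h | h
  · left; have := dist_triangle p q (a, 0); rw [Metric.mem_ball] at h; linarith
  · right; have := dist_triangle p q (0, 0); rw [Metric.mem_ball] at h; linarith

theorem contDiff_baseSystem {f φ : Side → ℝ × ℝ → ℝ} {m : Side → ℕ}
    (hf : ∀ s, ContDiff ℝ ∞ (f s)) (hφ : ∀ s, ContDiff ℝ ∞ (φ s)) : (baseSystem f φ m).Smooth :=
  fun s => ⟨hf s, (hφ s).mul (contDiff_fst.pow _)⟩

theorem PWS.Smooth.contDiff_field {S : PWS} (hS : S.Smooth) (s : Side) :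
    ContDiff ℝ 1 (S.field s) :=
  ((hS s).1.prodMk (hS s).2).of_le (by exact_mod_cast le_top)

theorem strictMonoOn_of_deriv_mul_pos {x x' : ℝ → ℝ} {F a b : ℝ}
    (hx : ∀ t ∈ Icc a b, HasDerivWithinAt x (x' t) (Icc a b) t)
    (hx' : ∀ t ∈ Ioo a b, 0 < x' t * F) : StrictMonoOn (fun t => x t * F) (Icc a b) := by
  refine strictMonoOn_of_deriv_pos (convex_Icc _ _)
    (fun t ht => ((hx t ht).mul_const F).continuousWithinAt) fun t ht => ?_
  rw [interior_Icc] at ht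
  rw [(((hx t (Ioo_subset_Icc_self ht)).hasDerivAt (Icc_mem_nhds ht.1 ht.2)).mul_const F).deriv]
  exact hx' t ht

/-- If `m⁺ = 1`, the upper orbit of the origin continues beyond the origin into the upper zone, to
points off the loop. -/
theorem Arcs.exists_exit {f φ : Side → ℝ × ℝ → ℝ} {m : Side → ℕ} {U : Set (ℝ × ℝ)} {a : ℝ}
    (A : Arcs (baseSystem f φ m) U a) (hf : ∀ s, ContDiff ℝ ∞ (f s))
    (hφ : ∀ s, ContDiff ℝ ∞ (φ s)) (hf0 : f .upper (0, 0) ≠ 0) (hφ0 : φ .upper (0, 0) ≠ 0)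
    (hm : m .upper = 1) {r : ℝ} (hr : 0 < r) :
    ∃ (τ : ℝ) (Γ : ℝ → ℝ × ℝ), 0 < τ ∧ Γ 0 = (0, 0) ∧
      (∀ t ∈ Icc 0 τ, HasDerivWithinAt Γ ((baseSystem f φ m).field .upper (Γ t)) (Icc 0 τ) t) ∧
      (∀ t ∈ Icc 0 τ, dist (Γ t) (0, 0) < r) ∧ Γ τ ∉ A.carrier := by
  have hsign := A.upper_sign (hφ .upper).continuous hf0 hφ0
  rw [hm, pow_one] at hsign
  set F := f .upper (0, 0) with hF
  set T := A.T .upper with hT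
  have hT0 : 0 < T := A.T_pos .upper
  obtain ⟨r₁, hr₁, h₁⟩ := exists_ball_abs_sub_lt (hf .upper).continuous hf0
  obtain ⟨r₂, hr₂, h₂⟩ := exists_ball_abs_sub_lt (hφ .upper).continuous hφ0
  have hV := (contDiff_baseSystem (m := m) hf hφ).contDiff_field .upper
  obtain ⟨τ₀, Γ, hτ₀, hΓ, hΓeq⟩ := exists_extension hV hT0 (A.orbit .upper)
  have hΓT : Γ T = (0, 0) := by rw [hΓeq ⟨hT0.le, le_rfl⟩]; exact A.upper_end
  have hcT : ContinuousAt Γ T := (hΓ T ⟨by linarith, by linarith⟩).continuousAt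
  obtain ⟨δ₀, hδ₀, hδ⟩ := Metric.continuousAt_iff.1 hcT (min r₁ r₂) (by positivity)
  -- away from its end the upper arc keeps a distance `c` from the origin
  set s₀ := max 0 (T - δ₀ / 2) with hs₀
  have hs₀T : s₀ < T := max_lt hT0 (by linarith)
  have hc : ContinuousOn (A.γ .upper) (Icc 0 s₀) :=
    (A.continuousOn .upper).mono (Icc_subset_Icc_right hs₀T.le)
  obtain ⟨c, hc0, hcK⟩ : ∃ c > 0, ∀ t ∈ Icc 0 s₀, c ≤ dist (A.γ .upper t) (0, 0) := by
    obtain ⟨t, ht, hmin⟩ := isCompact_Icc.exists_isMinOn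
      (nonempty_Icc.2 (le_max_left 0 (T - δ₀ / 2)))
      (f := fun t => dist (A.γ .upper t) (0, 0)) ((Continuous.dist continuous_id continuous_const).comp_continuousOn hc)
    refine ⟨_, dist_pos.2 fun h => ?_, fun t' ht' => hmin ht'⟩
    rcases A.mem_zone_or_eq .upper ⟨ht.1, ht.2.trans hs₀T.le⟩ with h' | h'
    · rw [h] at h'; exact lt_irrefl _ h'.2
    rcases eq_or_lt_of_le ht.1 with h0 | h0
    · rw [← h0, A.upper_start] at h; exact A.neg.ne (congrArg Prod.fst h)
    · have := (A.inside .upper t ⟨h0, lt_of_le_of_lt ht.2 hs₀T⟩).2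
      rw [h] at this; exact lt_irrefl _ this
  obtain ⟨δ₁, hδ₁, hδ'⟩ := Metric.continuousAt_iff.1 hcT (min c r) (by positivity)
  set τ := min (min (δ₀ / 2) (δ₁ / 2)) τ₀ with hτ
  have hτ0 : 0 < τ := by positivity
  have hτ1 : τ ≤ δ₀ / 2 := (min_le_left _ _).trans (min_le_left _ _)
  have hτ2 : τ ≤ δ₁ / 2 := (min_le_left _ _).trans (min_le_right _ _)
  have hτ3 : τ ≤ τ₀ := min_le_right _ _
  have hnear : ∀ t ∈ Icc s₀ (T + τ), dist (Γ t) (0, 0) < min r₁ r₂ := fun t ht => by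
    rw [← hΓT]
    refine hδ ?_
    have := le_max_right 0 (T - δ₀ / 2)
    rw [Real.dist_eq, abs_lt]
    constructor <;> linarith [ht.1, ht.2]
  have hs₀0 : 0 ≤ s₀ := le_max_left _ _
  have hder : ∀ t ∈ Icc s₀ (T + τ), HasDerivAt Γ ((baseSystem f φ m).field .upper (Γ t)) t :=
    fun t ht => hΓ t ⟨by linarith [ht.1], by linarith [ht.2]⟩
  have hxm : StrictMonoOn (fun t => (Γ t).1 * F) (Icc s₀ (T + τ)) :=
    strictMonoOn_of_deriv_mul_pos (x' := fun t => f .upper (Γ t))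
      (fun t ht => (HasDerivAt.fst_prod (hder t ht)).hasDerivWithinAt)
      (fun t ht => mul_pos_of_abs_sub_lt (h₁ _ ((hnear t (Ioo_subset_Icc_self ht)).trans_le
        (min_le_left _ _))) (by rw [sub_self, abs_zero]; have := abs_pos.2 hf0; positivity))
  have hTm : T ∈ Icc s₀ (T + τ) := ⟨hs₀T.le, by linarith⟩
  have hτm : T + τ ∈ Icc s₀ (T + τ) := ⟨by linarith, le_rfl⟩
  -- beyond the origin `x` has the sign of `f⁺(O)`, hence `g⁺ = φ⁺ x` is positive
  have hx0 : ∀ t ∈ Icc s₀ (T + τ), T < t → 0 < (Γ t).1 * F := fun t ht h => by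
    have := hxm hTm ht h
    simpa [hΓT] using this
  have hym : StrictMonoOn (fun t => (Γ t).2 * 1) (Icc T (T + τ)) := by
    refine strictMonoOn_of_deriv_mul_pos (x' := fun t => φ .upper (Γ t) * (Γ t).1 ^ m .upper)
      (fun t ht => (HasDerivAt.snd_prod (hder t ⟨hs₀T.le.trans ht.1, ht.2⟩)).hasDerivWithinAt)
      (fun t ht => ?_)
    have htm : t ∈ Icc s₀ (T + τ) := ⟨hs₀T.le.trans ht.1.le, ht.2.le⟩
    have e1 := hx0 t htm ht.1
    have e2 : 0 < φ .upper (Γ t) * φ .upper (0, 0) :=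
      mul_pos_of_abs_sub_lt (h₂ _ ((hnear t htm).trans_le (min_le_right _ _)))
        (by rw [sub_self, abs_zero]; have := abs_pos.2 hφ0; positivity)
    rw [hm, pow_one, mul_one]
    have e3 : 0 < φ .upper (0, 0) * F := by linarith
    refine (mul_pos_iff_of_pos_right e3).1 ?_
    calc 0 < _ := mul_pos e2 e1
      _ = _ := by ring
  have hy0 : 0 < (Γ (T + τ)).2 := by
    have := hym ⟨le_rfl, by linarith⟩ ⟨by linarith, le_rfl⟩ (by linarith : T < T + τ)
    simpa [hΓT] using this
  have hclose : ∀ t ∈ Icc T (T + τ), dist (Γ t) (0, 0) < min c r := fun t ht => by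
    rw [← hΓT]
    refine hδ' ?_
    rw [Real.dist_eq, abs_lt]
    constructor <;> linarith [ht.1, ht.2]
  refine ⟨τ, fun t => Γ (T + t), hτ0, by simpa using hΓT, fun t ht => ?_, fun t ht =>
    (hclose _ ⟨by linarith [ht.1], by linarith [ht.2]⟩).trans_le (min_le_right _ _), fun hmem => ?_⟩
  · have := hder (T + t) ⟨by linarith [ht.1], by linarith [ht.2]⟩
    exact (this.comp_const_add T t).hasDerivWithinAt
  -- the exit point has `x f⁺(O) > 0`, unlike the end of the upper arc, and is closer to the origin
  -- than the rest of that arc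
  · simp only [Arcs.carrier, mem_iUnion, mem_image] at hmem
    obtain ⟨s, t, ht, h⟩ := hmem
    cases s
    · rcases le_or_gt t s₀ with h' | h'
      · have h1 := hcK t ⟨ht.1, h'⟩
        rw [h] at h1
        exact absurd ((hclose _ ⟨by linarith, le_rfl⟩).trans_le (min_le_left c r)) (not_lt.2 h1)
      · have h1 : (Γ t).1 * F ≤ 0 := by
          have := hxm.monotoneOn ⟨h'.le, by linarith [ht.2]⟩ hTm ht.2
          simpa [hΓT] using this
        rw [hΓeq ht, h] at h1
        exact absurd (hx0 _ hτm (by linarith)) (not_lt.2 h1)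
    · rcases A.mem_zone_or_eq .lower ht with h' | h' | h'
      · rw [h] at h'
        exact absurd h'.2 (not_lt.2 hy0.le)
      · rw [h] at h'; rw [h'] at hy0; exact lt_irrefl _ hy0
      · rw [h] at h'; rw [h'] at hy0; exact lt_irrefl _ hy0

/-! ### No crossing loop near simple tangencies -/

theorem Loop.snd_nonneg_of_upper {S : PWS} {U : Set (ℝ × ℝ)} (L : Loop S U) {i : Fin (L.n + 1)}
    (hi : L.side i = .upper) : ∀ t ∈ Icc 0 (L.T i), 0 ≤ (L.γ i t).2 := by
  intro t ht
  rcases eq_or_lt_of_le ht.1 with h | h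
  · rw [← h, (L.start_mem i).2]
  rcases eq_or_lt_of_le ht.2 with h' | h'
  · rw [h', (L.stop_mem i).2]
  · have := L.inside i t ⟨h, h'⟩
    rw [hi] at this
    exact this.2.le

/-- On the upper side the vertical speed is nonnegative at the start and nonpositive at the end. -/
theorem Loop.speed_ends_of_upper {S : PWS} {U : Set (ℝ × ℝ)} (L : Loop S U) {i : Fin (L.n + 1)}
    (hi : L.side i = .upper) :
    0 ≤ S.g .upper (L.γ i 0) ∧ S.g .upper (L.γ i (L.T i)) ≤ 0 := by
  have hy := L.snd_nonneg_of_upper hi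
  have h0 := L.orbit i 0 ⟨le_rfl, (L.T_pos i).le⟩
  have h1 := L.orbit i (L.T i) ⟨(L.T_pos i).le, le_rfl⟩
  rw [hi] at h0 h1
  exact ⟨deriv_nonneg_of_start (L.T_pos i) (HasDerivWithinAt.snd_prod h0) (L.start_mem i).2 hy,
    deriv_nonpos_of_end (L.T_pos i) (HasDerivWithinAt.snd_prod h1) (L.stop_mem i).2 hy⟩

theorem Loop.mem_of_mem_Icc {S : PWS} {U : Set (ℝ × ℝ)} (L : Loop S U) (i : Fin (L.n + 1))
    {t : ℝ} (ht : t ∈ Icc 0 (L.T i)) : L.γ i t ∈ U := by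
  rcases eq_or_lt_of_le ht.1 with h | h
  · rw [← h]; exact (L.start_mem i).1
  rcases eq_or_lt_of_le ht.2 with h' | h'
  · rw [h']; exact (L.stop_mem i).1
  · have := L.inside i t ⟨h, h'⟩
    cases hs : L.side i <;> rw [hs] at this <;> exact this.1

theorem norm_field_sub_le {S S' : PWS} {s : Side} {p : ℝ × ℝ} {ε : ℝ}
    (hf : |S.f s p - S'.f s p| ≤ ε) (hg : |S.g s p - S'.g s p| ≤ ε) :
    ‖S.field s p - S'.field s p‖ ≤ ε := by
  rw [Prod.norm_def]
  exact max_le hf hg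

set_option maxHeartbeats 1000000 in
/-- An orbit that touches the switching line from above near a fold with `m⁺ ≤ 1` leaves every
small neighbourhood of the given loop: on the switching line the field points upward beyond the
contact, so the orbit follows the base orbit of the origin past the origin, off the loop. -/
theorem Arcs.no_upper_touch {f φ : Side → ℝ × ℝ → ℝ} {m : Side → ℕ} {U : Set (ℝ × ℝ)} {a : ℝ}
    (A : Arcs (baseSystem f φ m) U a) (hUo : IsOpen U) (hUb : Bornology.IsBounded U)
    (hU0 : ((0 : ℝ), (0 : ℝ)) ∈ U) (hf : ∀ s, ContDiff ℝ ∞ (f s))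
    (hφ : ∀ s, ContDiff ℝ ∞ (φ s)) (hf0 : f .upper (0, 0) ≠ 0) (hφ0 : φ .upper (0, 0) ≠ 0)
    (hm : m .upper ≤ 1) :
    ∃ ε : ℝ, 0 < ε ∧ ∀ S : PWS, S.Smooth → rho U (baseSystem f φ m) S < ε →
      ∀ L : Loop S U, L.carrier ⊆ Metric.thickening ε A.carrier → ∀ i,
        L.γ (i + 1) 0 ∈ S.tangent U → L.side i = .upper → L.side (i + 1) = .upper → False := by
  let B := baseSystem f φ m
  have hBs : B.Smooth := contDiff_baseSystem hf hφ
  have hsign := A.upper_sign (hφ .upper).continuous hf0 hφ0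
  -- near `P` there are no tangent points
  have hP := A.crossing
  have hPu : B.g .upper (a, 0) ≠ 0 := fun h => by
    have := hP.2; rw [h, zero_mul] at this; exact lt_irrefl _ this
  have hPl : B.g .lower (a, 0) ≠ 0 := fun h => by
    have := hP.2; rw [h, mul_zero] at this; exact lt_irrefl _ this
  obtain ⟨r₁, hr₁, h₁⟩ := exists_ball_abs_sub_lt (hBs .upper).2.continuous hPu
  obtain ⟨r₂, hr₂, h₂⟩ := exists_ball_abs_sub_lt (hBs .lower).2.continuous hPl
  obtain ⟨r₃, hr₃, h₃⟩ := exists_ball_abs_sub_lt (hf .upper).continuous hf0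
  obtain ⟨r₄, hr₄, hUr⟩ := Metric.isOpen_iff.1 hUo _ hU0
  have hUr : ∀ p, dist p (0, 0) < r₄ → p ∈ closure U := fun p hp => subset_closure (hUr hp)
  -- a touching point has vanishing vertical speed
  have htouch : ∀ (S : PWS) (L : Loop S U) (i), L.side i = .upper → L.side (i + 1) = .upper →
      S.g .upper (L.γ (i + 1) 0) = 0 := fun S L i h h' => by
    have e1 := (L.speed_ends_of_upper h).2
    rw [L.closes] at e1
    exact le_antisymm e1 (L.speed_ends_of_upper h').1
  have hstart : ∀ (S : PWS) (L : Loop S U) (i), L.γ i 0 ∈ L.carrier := fun S L i =>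
    mem_iUnion.2 ⟨i, 0, ⟨le_rfl, (L.T_pos i).le⟩, rfl⟩
  -- the part of the statement that concerns contacts near `P`
  have hfar : ∀ ε, ε ≤ |B.g .upper (a, 0)| / 2 → ε ≤ |B.g .lower (a, 0)| / 2 →
      ∀ S : PWS, S.Smooth → rho U B S < ε → ∀ p ∈ S.tangent U,
      ¬ dist p (a, 0) < min r₁ r₂ := by
    intro ε he1 he2 S hS hrho p hp hd
    have hpU : p ∈ closure U := subset_closure hp.1.1
    have k1 := mul_pos_of_abs_sub_lt (h₁ p (hd.trans_le (min_le_left _ _)))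
      ((rho_bounds hUb hBs hS hrho .upper hpU).2.1.trans_le he1)
    have k2 := mul_pos_of_abs_sub_lt (h₂ p (hd.trans_le (min_le_right _ _)))
      ((rho_bounds hUb hBs hS hrho .lower hpU).2.1.trans_le he2)
    rcases mul_eq_zero.1 hp.2.1 with h | h
    · rw [h, zero_mul] at k1; exact lt_irrefl _ k1
    · rw [h, zero_mul] at k2; exact lt_irrefl _ k2
  rcases Nat.le_one_iff_eq_zero_or_eq_one.1 hm with hm0 | hm1
  · -- without a zero of `g⁺` near the origin there is no contact at all
    have hO : B.g .upper (0, 0) ≠ 0 := by simpa [B, baseSystem, hm0] using hφ0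
    obtain ⟨r₅, hr₅, h₅⟩ := exists_ball_abs_sub_lt (hBs .upper).2.continuous hO
    obtain ⟨ε₀, hε₀, hnear⟩ := A.exists_near_ends (δ := min (min r₁ r₂) r₅) (by positivity)
    have q1 := abs_pos.2 hPu
    have q2 := abs_pos.2 hPl
    have q3 := abs_pos.2 hO
    refine ⟨min (min ε₀ (|B.g .upper (0, 0)| / 2))
      (min (|B.g .upper (a, 0)| / 2) (|B.g .lower (a, 0)| / 2)), by positivity, ?_⟩
    intro S hS hrho L hL i hi hs hs'
    have hp := Metric.thickening_mono ((min_le_left _ _).trans (min_le_left _ _)) _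
      (hL (hstart S L (i + 1)))
    rcases hnear _ (L.start_mem _).2 hp with h | h
    · exact hfar _ ((min_le_right _ _).trans (min_le_left _ _))
        ((min_le_right _ _).trans (min_le_right _ _)) S hS hrho _ hi
        (h.trans_le (min_le_left _ _))
    · have k := mul_pos_of_abs_sub_lt (h₅ _ (h.trans_le (min_le_right _ _)))
        ((rho_bounds hUb hBs hS hrho .upper (subset_closure (L.start_mem (i + 1)).1)).2.1.trans_le
          ((min_le_left _ _).trans (min_le_right _ _)))
      rw [htouch S L i hs hs', zero_mul] at k
      exact lt_irrefl _ k
  · -- `∂g⁺/∂x` does not vanish near the origin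
    rw [hm1, pow_one] at hsign
    have hDc : Continuous fun p => fderiv ℝ (B.g .upper) p (1, 0) :=
      ((hBs .upper).2.continuous_fderiv (by simp)).clm_apply continuous_const
    have hD0 : fderiv ℝ (B.g .upper) (0, 0) (1, 0) = φ .upper (0, 0) := by
      have h1 : HasFDerivAt (B.g .upper) _ ((0, 0) : ℝ × ℝ) :=
        (((hφ .upper).differentiable (by simp) (0, 0)).hasFDerivAt).mul
          ((hasFDerivAt_fst (𝕜 := ℝ) (p := ((0, 0) : ℝ × ℝ))).pow (m .upper))
      rw [h1.fderiv]
      simp [hm1]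
    have hD : fderiv ℝ (B.g .upper) (0, 0) (1, 0) ≠ 0 := by rw [hD0]; exact hφ0
    obtain ⟨r₅, hr₅, h₅⟩ := exists_ball_abs_sub_lt hDc hD
    rw [hD0] at h₅
    set r := min (min r₃ r₄) r₅ with hr
    have hr0 : 0 < r := by positivity
    obtain ⟨τ, Γ, hτ, hΓ0, hΓ, hΓr, hΓz⟩ := A.exists_exit hf hφ hf0 hφ0 hm1 (r := r / 2)
      (by positivity)
    -- the exit point has a positive distance from the loop
    obtain ⟨η, hη, hηz⟩ := Metric.isOpen_iff.1 A.isCompact_carrier.isClosed.isOpen_compl _ hΓz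
    obtain ⟨R, hR⟩ := hUb.exists_norm_le
    have hR0 : 0 ≤ R := (norm_nonneg _).trans (hR _ hU0)
    have hΓc : ContinuousOn Γ (Icc 0 τ) := fun t ht => (hΓ t ht).continuousWithinAt
    obtain ⟨R', hR'⟩ := (isCompact_Icc.image_of_continuousOn hΓc).isBounded.exists_norm_le
    -- the Grönwall estimate needs a globally Lipschitz field: cut off outside a ball that contains
    -- `U` and `Γ`
    obtain ⟨χ, -, hχ1, -, hχ⟩ := exists_cutoff (E := ℝ × ℝ) (le_max_of_le_left hR0 : 0 ≤ max R R')
    obtain ⟨K, -, hK, -⟩ := hχ _ (hBs.contDiff_field .upper)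
    set C := Real.exp ((K + 1) * (τ - 0)) * (1 + 1 / ((K : ℝ) + 1)) with hC
    have hC0 : 0 < C := by positivity
    -- `C` is the Grönwall factor, `δ` the admissible error of initial point and field
    set δ := min (η / 2) (r / 2) / C with hδ
    have hδ0 : 0 < δ := by positivity
    obtain ⟨ε₀, hε₀, hnear⟩ := A.exists_near_ends (δ := min (min r₁ r₂) δ) (by positivity)
    have q1 := abs_pos.2 hPu
    have q2 := abs_pos.2 hPl
    have q3 := abs_pos.2 hf0
    have q4 := abs_pos.2 hφ0
    set ε := min (min (min ε₀ (η / 2)) (min δ (|f .upper (0, 0)| / 2)))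
      (min (|φ .upper (0, 0)| / 2)
        (min (|B.g .upper (a, 0)| / 2) (|B.g .lower (a, 0)| / 2))) with hε
    have l1 : ε ≤ ε₀ := (min_le_left _ _).trans ((min_le_left _ _).trans (min_le_left _ _))
    have l2 : ε ≤ η / 2 := (min_le_left _ _).trans ((min_le_left _ _).trans (min_le_right _ _))
    have l3 : ε ≤ δ := (min_le_left _ _).trans ((min_le_right _ _).trans (min_le_left _ _))
    have l4 : ε ≤ |f .upper (0, 0)| / 2 :=
      (min_le_left _ _).trans ((min_le_right _ _).trans (min_le_right _ _))
    have l5 : ε ≤ |φ .upper (0, 0)| / 2 := (min_le_right _ _).trans (min_le_left _ _)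
    have l6 : ε ≤ |B.g .upper (a, 0)| / 2 :=
      (min_le_right _ _).trans ((min_le_right _ _).trans (min_le_left _ _))
    have l7 : ε ≤ |B.g .lower (a, 0)| / 2 :=
      (min_le_right _ _).trans ((min_le_right _ _).trans (min_le_right _ _))
    refine ⟨ε, by positivity, ?_⟩
    intro S hS hrho L hL i hi hs hs'
    set j := i + 1 with hj
    have hgp : S.g .upper (L.γ j 0) = 0 := htouch S L i hs hs'
    have hpd : dist (L.γ j 0) (0, 0) < δ := by
      rcases hnear _ (L.start_mem j).2
        (Metric.thickening_mono l1 _ (hL (hstart S L j))) with h | h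
      · exact absurd (h.trans_le (min_le_left _ _)) (hfar ε l6 l7 S hS hrho _ hi)
      · exact h.trans_le (min_le_right _ _)
    have horb := L.orbit j
    rw [hs'] at horb
    set τ' := min (L.T j) τ with hτ'
    have hτ'0 : 0 < τ' := lt_min (L.T_pos j) hτ
    have i1 : Icc 0 τ' ⊆ Icc 0 (L.T j) := Icc_subset_Icc_right (min_le_left _ _)
    have i2 : Icc 0 τ' ⊆ Icc 0 τ := Icc_subset_Icc_right (min_le_right _ _)
    -- the orbit issuing from the contact shadows the base orbit issuing from the origin
    have hclose : ∀ t ∈ Icc 0 τ', dist (L.γ j t) (Γ t) ≤ min (η / 2) (r / 2) := by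
      intro t ht
      have := dist_le_of_approx_trajectory hK (a := 0) (b := τ') (t₀ := 0) (δ := δ)
        (Γ := L.γ j) (Γ₀ := Γ) (Γ' := fun t => S.field .upper (L.γ j t)) ⟨le_rfl, hτ'0.le⟩
        (fun t ht => (horb t (i1 ht)).mono i1)
        (fun t ht => by
          have hU := L.mem_of_mem_Icc j (i1 ht)
          rw [hχ1 _ ((hR _ hU).trans (by linarith [le_max_left R R'])), one_smul, dist_comm,
            dist_eq_norm]
          have := rho_bounds hUb hBs hS hrho .upper (subset_closure hU)
          exact norm_field_sub_le (this.1.le.trans l3) (this.2.1.le.trans l3))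
        (fun t ht => by
          rw [hχ1 _ ((hR' _ ⟨t, i2 ht, rfl⟩).trans (by linarith [le_max_right R R'])), one_smul]
          exact (hΓ t (i2 ht)).mono i2)
        (by rw [hΓ0]; exact hpd.le) t ht
      refine this.trans ?_
      calc _ ≤ δ * C := by
            rw [hC]
            gcongr
            exact min_le_right _ _
        _ = _ := by rw [hδ]; field_simp
    have hball : ∀ t ∈ Icc 0 τ', dist (L.γ j t) (0, 0) < r := fun t ht => by
      have h1 := dist_triangle (L.γ j t) (Γ t) (0, 0)
      have h2 := hΓr t (i2 ht)
      have h3 := (hclose t ht).trans (min_le_right _ _)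
      linarith
    rcases lt_or_ge (L.T j) τ with hlt | hge
    · -- the orbit would return to the switching line where the field points upward
      have hτe : τ' = L.T j := min_eq_left hlt.le
      rw [hτe] at hball
      have hxm : StrictMonoOn (fun t => (L.γ j t).1 * f .upper (0, 0)) (Icc 0 (L.T j)) :=
        strictMonoOn_of_deriv_mul_pos (fun t ht => HasDerivWithinAt.fst_prod (horb t ht))
          (fun t ht => mul_pos_of_abs_sub_lt (u := f .upper (L.γ j t))
            (h₃ _ ((hball t (Ioo_subset_Icc_self ht)).trans_le
              ((min_le_left _ _).trans (min_le_left _ _))))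
            ((rho_bounds hUb hBs hS hrho .upper (subset_closure
              (L.mem_of_mem_Icc j (Ioo_subset_Icc_self ht)))).1.trans_le l4))
      have h0m : (0 : ℝ) ∈ Icc 0 (L.T j) := ⟨le_rfl, (L.T_pos j).le⟩
      have h1m : L.T j ∈ Icc 0 (L.T j) := ⟨(L.T_pos j).le, le_rfl⟩
      have hxlt := hxm h0m h1m (L.T_pos j)
      have hgm : StrictMonoOn (fun x => S.g .upper (x, 0) * φ .upper (0, 0))
          (Ioo (-r) r) := by
        have hder : ∀ x, HasDerivAt (fun x : ℝ => S.g .upper (x, 0) * φ .upper (0, 0))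
            (fderiv ℝ (S.g .upper) (x, 0) (1, 0) * φ .upper (0, 0)) x := fun x => by
          have h1 : HasDerivAt (fun x : ℝ => ((x, 0) : ℝ × ℝ)) (1, 0) x :=
            (hasDerivAt_id x).prodMk (hasDerivAt_const x 0)
          exact ((((hS .upper).2.differentiable (by simp) (x, 0)).hasFDerivAt).comp_hasDerivAt x
            h1).mul_const _
        refine strictMonoOn_of_deriv_pos (convex_Ioo _ _)
          (fun x _ => (hder x).continuousAt.continuousWithinAt) fun x hx => ?_
        rw [interior_Ioo] at hx
        rw [(hder x).deriv]
        have hd : dist ((x, 0) : ℝ × ℝ) (0, 0) < r := by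
          rw [Prod.dist_eq]
          simp only [dist_self, Real.dist_eq, sub_zero]
          exact max_lt (abs_lt.2 hx) hr0
        exact mul_pos_of_abs_sub_lt (h₅ _ (hd.trans_le (min_le_right _ _)))
          ((rho_bounds hUb hBs hS hrho .upper (hUr _ (hd.trans_le
            ((min_le_left _ _).trans (min_le_right _ _))))).2.2.trans_le l5)
      have hmem : ∀ t ∈ Icc 0 (L.T j), (L.γ j t).1 ∈ Ioo (-r) r := fun t ht => by
        have h1 : dist (L.γ j t).1 0 ≤ dist (L.γ j t) (0, 0) := by
          rw [Prod.dist_eq]; exact le_max_left _ _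
        rw [Real.dist_eq, sub_zero] at h1
        exact abs_lt.1 (h1.trans_lt (hball t ht))
      have e0 : L.γ j 0 = ((L.γ j 0).1, 0) := Prod.ext rfl (L.start_mem j).2
      have e1 : L.γ j (L.T j) = ((L.γ j (L.T j)).1, 0) := Prod.ext rfl (L.stop_mem j).2
      have hfin := (L.speed_ends_of_upper hs').2
      rw [e1] at hfin
      rw [e0] at hgp
      have hprod : 0 < φ .upper (0, 0) * f .upper (0, 0) := by linarith
      rcases mul_pos_iff.1 hprod with ⟨k1, k2⟩ | ⟨k1, k2⟩
      · have := hgm (hmem _ h0m) (hmem _ h1m) (lt_of_mul_lt_mul_right hxlt k2.le)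
        simp only [hgp, zero_mul] at this
        exact absurd this (not_lt.2 (mul_nonpos_of_nonpos_of_nonneg hfin k1.le))
      · have := hgm (hmem _ h1m) (hmem _ h0m) ((mul_lt_mul_right_of_neg k2).1 hxlt)
        simp only [hgp, zero_mul] at this
        exact absurd this (not_lt.2 (mul_nonneg_of_nonpos_of_nonpos hfin k1.le))
    · -- the orbit reaches a neighbourhood of the exit point
      have hτe : τ' = τ := min_eq_right hge
      have h1 := (hclose τ ⟨hτ.le, hτe.ge⟩).trans (min_le_left _ _)
      have h2 : L.γ j τ ∈ Metric.thickening ε A.carrier :=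
        hL (mem_iUnion.2 ⟨j, τ, ⟨hτ.le, hge⟩, rfl⟩)
      obtain ⟨q, hq, hd⟩ := Metric.mem_thickening_iff.1 h2
      refine hηz ?_ hq
      rw [Metric.mem_ball, dist_comm]
      have h3 := dist_triangle_left (Γ τ) q (L.γ j τ)
      linarith

/-- For `m* = 1` no crossing loop bifurcates. -/
theorem Arcs.no_cro {f φ : Side → ℝ × ℝ → ℝ} {m : Side → ℕ} {U : Set (ℝ × ℝ)} {a : ℝ}
    (A : Arcs (baseSystem f φ m) U a) (hUo : IsOpen U) (hUb : Bornology.IsBounded U)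
    (hU0 : ((0 : ℝ), (0 : ℝ)) ∈ U) (hf : ∀ s, ContDiff ℝ ∞ (f s))
    (hφ : ∀ s, ContDiff ℝ ∞ (φ s)) (hf0 : ∀ s, f s (0, 0) ≠ 0) (hφ0 : ∀ s, φ s (0, 0) ≠ 0)
    (hm : ∀ s, m s ≤ 1) :
    ∃ ε : ℝ, 0 < ε ∧ ∀ S : PWS, S.Smooth → rho U (baseSystem f φ m) S < ε →
      ∀ L : Loop S U, L.carrier ⊆ Metric.thickening ε A.carrier → ¬ L.IsCro := by
  obtain ⟨ε₁, hε₁, h₁⟩ := A.no_upper_touch hUo hUb hU0 hf hφ (hf0 _) (hφ0 _) (hm _)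
  obtain ⟨ε₂, hε₂, h₂⟩ := Arcs.no_upper_touch (f := -flipComp f) (φ := flipComp φ)
    (m := m ∘ Side.flip) A.reflect (hUo.preimage mirror.continuous)
    (by
      have : mirror ⁻¹' U = mirror '' U := by
        ext p
        exact ⟨fun hp => ⟨mirror p, hp, mirror_mirror p⟩, by
          rintro ⟨q, hq, rfl⟩; rw [mem_preimage, mirror_mirror]; exact hq⟩
      rw [this]
      exact mirror.lipschitz.isBounded_image hUb)
    (by simpa using hU0) (fun s => ((hf s.flip).comp (contDiff_fst.prodMk contDiff_snd.neg)).neg)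
    (fun s => (hφ s.flip).comp (contDiff_fst.prodMk contDiff_snd.neg))
    (by simpa [flipComp, Side.flip] using hf0 .lower)
    (by simpa [flipComp, Side.flip] using hφ0 .lower) (hm _)
  refine ⟨min ε₁ ε₂, by positivity, fun S hS hrho L hL hcro => ?_⟩
  obtain ⟨⟨i, hi⟩, -, hsw⟩ := hcro
  obtain ⟨k, rfl⟩ : ∃ k, k + 1 = i := ⟨i - 1, sub_add_cancel i 1⟩
  -- a tangent point is not a switching point
  have hside : L.side k = L.side (k + 1) := by
    by_contra hne
    have := (hsw ⟨k, hne, rfl⟩).2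
    rw [hi.2.1] at this
    exact lt_irrefl _ this
  cases hs : L.side k
  · exact h₁ S hS (hrho.trans_le (min_le_left _ _)) L
      (hL.trans (Metric.thickening_mono (min_le_left _ _) _)) k hi hs (by rw [← hside, hs])
  · have hsub : mirror ⁻¹' L.carrier ⊆ Metric.thickening ε₂ A.reflect.carrier := by
      rw [A.carrier_reflect, thickening_mirror]
      exact preimage_mono (hL.trans (Metric.thickening_mono (min_le_right _ _) _))
    have key : ∀ j : Fin (L.n + 1), j + 1 = -k → L.reflect.γ (j + 1 : Fin (L.n + 1)) 0 ∈
        S.reflect.tangent (mirror ⁻¹' U) → (L.side (-j)).flip = .upper →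
        (L.side (-(j + 1))).flip = .upper → False := fun j _ hj1 hj2 hj3 =>
      h₂ S.reflect hS.reflect (by
        rw [← reflect_baseSystem, rho_reflect]; exact hrho.trans_le (min_le_right _ _))
        L.reflect (by rw [Loop.carrier_reflect]; exact hsub) j hj1 hj2 hj3
    refine key (-(k + 1)) (by abel) ?_ ?_ ?_
    · rw [L.reflect_start (-(k + 1)) _ rfl, neg_neg]
      exact mem_tangent_mirror.2 hi
    · rw [neg_neg, ← hside, hs]; rfl
    · rw [show -(-(k + 1) + 1) = k by abel, hs]; rfl

/-! ### Assembling a loop from an upper orbit with contacts and a lower orbit -/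

/-- The data of a clockwise loop: one upper orbit, cut at the contact times `s 0 < … < s N` into
`N` segments, and one lower orbit leading back from its end to its start. -/
structure LoopData (S : PWS) (U : Set (ℝ × ℝ)) (N : ℕ) where
  s : Fin (N + 1) → ℝ
  γ : ℝ → ℝ × ℝ
  T : ℝ
  γl : ℝ → ℝ × ℝ
  N_pos : 0 < N
  T_pos : 0 < T
  mono : StrictMono s
  orbit : ∀ t ∈ Icc (s 0) (s (Fin.last N)),
    HasDerivWithinAt γ (S.field .upper (γ t)) (Icc (s 0) (s (Fin.last N))) t
  orbitl : ∀ t ∈ Icc 0 T, HasDerivWithinAt γl (S.field .lower (γl t)) (Icc 0 T) t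
  mem : ∀ t ∈ Icc (s 0) (s (Fin.last N)), γ t ∈ U
  nonneg : ∀ t ∈ Icc (s 0) (s (Fin.last N)), 0 ≤ (γ t).2
  zero_iff : ∀ t ∈ Icc (s 0) (s (Fin.last N)), (γ t).2 = 0 ↔ t ∈ range s
  ne_start : ∀ i, i ≠ 0 → γ (s i) ≠ γ (s 0)
  insidel : ∀ t ∈ Ioo 0 T, γl t ∈ zone U .lower
  startl : γl 0 = γ (s (Fin.last N))
  stopl : γl T = γ (s 0)

namespace LoopData

variable {S : PWS} {U : Set (ℝ × ℝ)} {N : ℕ} (D : LoopData S U N)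
include D

theorem s_mem (i : Fin (N + 1)) : D.s i ∈ Icc (D.s 0) (D.s (Fin.last N)) :=
  ⟨D.mono.monotone (Fin.zero_le i), D.mono.monotone (Fin.le_last i)⟩

theorem contact_mem (i : Fin (N + 1)) : D.γ (D.s i) ∈ switchLine U :=
  ⟨D.mem _ (D.s_mem i), (D.zero_iff _ (D.s_mem i)).2 ⟨i, rfl⟩⟩

/-- A return to an earlier point would, by uniqueness of solutions, shift back to a return to the
starting point. -/
theorem injOn (hS : S.Smooth) : InjOn D.γ (Icc (D.s 0) (D.s (Fin.last N))) := by
  have key : ∀ t₁ ∈ Icc (D.s 0) (D.s (Fin.last N)), ∀ t₂ ∈ Icc (D.s 0) (D.s (Fin.last N)),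
      t₁ < t₂ → D.γ t₁ ≠ D.γ t₂ := by
    intro t₁ h₁ t₂ h₂ hlt heq
    set c := t₂ - t₁ with hc
    have i1 : Icc (D.s 0) t₁ ⊆ Icc (D.s 0) (D.s (Fin.last N)) := Icc_subset_Icc_right h₁.2
    have hmaps : MapsTo (fun t => t + c) (Icc (D.s 0) t₁) (Icc (D.s 0) (D.s (Fin.last N))) :=
      fun t ht => ⟨by linarith [ht.1], by linarith [ht.2, h₂.2]⟩
    have := eqOn_of_trajectories (hS.contDiff_field .upper) (t₀ := t₁) ⟨h₁.1, le_rfl⟩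
      (Γ := D.γ) (Γ₀ := fun t => D.γ (t + c)) (fun t ht => (D.orbit t (i1 ht)).mono i1)
      (fun t ht => by
        have h := (D.orbit (t + c) (hmaps ht)).scomp t ((hasDerivWithinAt_id t _).add_const c) hmaps
        rwa [one_smul] at h)
      (by simp [hc, heq])
    have h0 : D.γ (D.s 0) = D.γ (D.s 0 + c) := this ⟨le_rfl, h₁.1⟩
    have hm : D.s 0 + c ∈ Icc (D.s 0) (D.s (Fin.last N)) := hmaps ⟨le_rfl, h₁.1⟩
    have hz : (D.γ (D.s 0 + c)).2 = 0 := by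
      rw [← h0]; exact (D.contact_mem 0).2
    obtain ⟨i, hi⟩ := (D.zero_iff _ hm).1 hz
    refine D.ne_start i (fun h => ?_) (by rw [hi]; exact h0.symm)
    rw [h] at hi; linarith
  intro t₁ h₁ t₂ h₂ heq
  rcases lt_trichotomy t₁ t₂ with h | h | h
  · exact absurd heq (key _ h₁ _ h₂ h)
  · exact h
  · exact absurd heq.symm (key _ h₂ _ h₁ h)

theorem injOn_lower (hS : S.Smooth) : InjOn D.γl (Ico 0 D.T) := by
  have key : ∀ t₁ ∈ Ico 0 D.T, ∀ t₂ ∈ Ico 0 D.T, t₁ < t₂ → D.γl t₁ ≠ D.γl t₂ := by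
    intro t₁ h₁ t₂ h₂ hlt heq
    set c := t₂ - t₁ with hc
    have i1 : Icc 0 t₁ ⊆ Icc 0 D.T := Icc_subset_Icc_right h₁.2.le
    have hmaps : MapsTo (fun t => t + c) (Icc 0 t₁) (Icc 0 D.T) :=
      fun t ht => ⟨by linarith [ht.1], by linarith [ht.2, h₂.2]⟩
    have := eqOn_of_trajectories (hS.contDiff_field .lower) (t₀ := t₁) ⟨h₁.1, le_rfl⟩
      (Γ := D.γl) (Γ₀ := fun t => D.γl (t + c)) (fun t ht => (D.orbitl t (i1 ht)).mono i1)
      (fun t ht => by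
        have h := (D.orbitl (t + c) (hmaps ht)).scomp t ((hasDerivWithinAt_id t _).add_const c) hmaps
        rwa [one_smul] at h)
      (by simp [hc, heq])
    have h0 : D.γl 0 = D.γl (0 + c) := this ⟨le_rfl, h₁.1⟩
    have h1 := (D.insidel (0 + c) ⟨by linarith, by linarith [h₂.2, h₁.1]⟩).2
    rw [← h0, D.startl, (D.contact_mem _).2] at h1
    exact lt_irrefl _ h1
  intro t₁ h₁ t₂ h₂ heq
  rcases lt_trichotomy t₁ t₂ with h | h | h
  · exact absurd heq (key _ h₁ _ h₂ h)
  · exact h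
  · exact absurd heq.symm (key _ h₂ _ h₁ h)

theorem lt_succ {i : Fin (N + 1)} (h : i ≠ Fin.last N) : D.s i < D.s (i + 1) := by
  refine D.mono (Fin.lt_def.2 ?_)
  rw [Fin.val_add_one_of_lt (Fin.lt_last_iff_ne_last.2 h)]
  exact Nat.lt_succ_self _

theorem succ_le_of_lt {i j : Fin (N + 1)} (h : i < j) : D.s (i + 1) ≤ D.s j := by
  refine D.mono.monotone (Fin.le_def.2 ?_)
  rw [Fin.val_add_one_of_lt (lt_of_lt_of_le h (Fin.le_last j))]
  exact h

theorem segment_subset (i : Fin (N + 1)) :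
    MapsTo (fun t => D.s i + t) (Icc 0 (D.s (i + 1) - D.s i))
      (Icc (D.s 0) (D.s (Fin.last N))) :=
  fun t ht => ⟨by linarith [ht.1, (D.s_mem i).1], by linarith [ht.2, (D.s_mem (i + 1)).2]⟩

theorem pos_of_between (i : Fin (N + 1)) {t : ℝ}
    (ht : t ∈ Ioo 0 (D.s (i + 1) - D.s i)) : 0 < (D.γ (D.s i + t)).2 := by
  have hm := D.segment_subset i (Ioo_subset_Icc_self ht)
  refine lt_of_le_of_ne (D.nonneg _ hm) fun h0 => ?_
  obtain ⟨j, hj⟩ := (D.zero_iff _ hm).1 h0.symm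
  rcases le_or_gt j i with hji | hij
  · linarith [D.mono.monotone hji, ht.1]
  · linarith [D.succ_le_of_lt hij, ht.2]

/-- The loop made of the `N` upper segments and the lower one. -/
noncomputable def toLoop (hS : S.Smooth) : Loop S U where
  n := N
  side := fun i => if i = Fin.last N then .lower else .upper
  T := fun i => if i = Fin.last N then D.T else D.s (i + 1) - D.s i
  γ := fun i t => if i = Fin.last N then D.γl t else D.γ (D.s i + t)
  T_pos := fun i => by
    split_ifs with h
    · exact D.T_pos
    · linarith [D.lt_succ h]
  orbit := fun i => by
    by_cases h : i = Fin.last N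
    · simp only [h, if_true]; exact D.orbitl
    · simp only [h, if_false]
      intro t ht
      have hm := D.segment_subset i
      have := (D.orbit (D.s i + t) (hm ht)).scomp t ((hasDerivWithinAt_id t _).const_add (D.s i)) hm
      rwa [one_smul] at this
  start_mem := fun i => by
    by_cases h : i = Fin.last N
    · simp only [h, if_true]; rw [D.startl]; exact D.contact_mem _
    · simp only [h, if_false, add_zero]; exact D.contact_mem _
  stop_mem := fun i => by
    by_cases h : i = Fin.last N
    · simp only [h, if_true]; rw [D.stopl]; exact D.contact_mem _
    · simp only [h, if_false, add_sub_cancel]; exact D.contact_mem _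
  inside := fun i => by
    by_cases h : i = Fin.last N
    · simp only [h, if_true]; exact D.insidel
    · simp only [h, if_false]
      exact fun t ht => ⟨D.mem _ (D.segment_subset i (Ioo_subset_Icc_self ht)),
        D.pos_of_between i ht⟩
  closes := fun i => by
    by_cases h : i = Fin.last N
    · subst h
      have h0 : (0 : Fin (N + 1)) ≠ Fin.last N := fun h => by
        have := congrArg Fin.val h
        simp only [Fin.val_zero, Fin.val_last] at this
        exact D.N_pos.ne this
      simp only [if_true, Fin.last_add_one, h0, if_false, add_zero]
      exact D.stopl
    · simp only [h, if_false, add_sub_cancel]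
      by_cases h' : i + 1 = Fin.last N
      · simp only [h', if_true]; exact D.startl.symm
      · simp only [h', if_false, add_zero]
  simple := by
    have hmix : ∀ (i : Fin (N + 1)) (s t : ℝ), i ≠ Fin.last N →
        s ∈ Ico 0 (D.s (i + 1) - D.s i) → t ∈ Ico 0 D.T → D.γ (D.s i + s) ≠ D.γl t := by
      intro i s t h hs ht heq
      have hm := D.segment_subset i (Ico_subset_Icc_self hs)
      rcases eq_or_lt_of_le ht.1 with h0 | h0
      · rw [← h0, D.startl] at heq
        have := D.injOn hS hm (D.s_mem _) heq
        linarith [hs.2, (D.s_mem (i + 1)).2]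
      · have h1 := D.nonneg _ hm
        rw [heq] at h1
        exact absurd (D.insidel t ⟨h0, ht.2⟩).2 (not_lt.2 h1)
    intro i j s hs t ht heq
    by_cases hi : i = Fin.last N <;> by_cases hj : j = Fin.last N <;>
      simp only [hi, hj, if_true, if_false] at hs ht heq
    · exact ⟨hi.trans hj.symm, D.injOn_lower hS hs ht heq⟩
    · exact absurd heq.symm (hmix j t s hj ht hs)
    · exact absurd heq (hmix i s t hi hs ht)
    · have := D.injOn hS (D.segment_subset i (Ico_subset_Icc_self hs))
        (D.segment_subset j (Ico_subset_Icc_self ht)) heq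
      simp only at this
      rcases lt_trichotomy i j with h | h | h
      · linarith [D.succ_le_of_lt h, hs.2, ht.1]
      · subst h; exact ⟨rfl, by linarith⟩
      · linarith [D.succ_le_of_lt h, ht.2, hs.1]

theorem toLoop_start (hS : S.Smooth) (i : Fin (N + 1)) : (D.toLoop hS).γ i 0 = D.γ (D.s i) := by
  change (if i = Fin.last N then D.γl 0 else D.γ (D.s i + 0)) = _
  split_ifs with h
  · rw [D.startl, h]
  · rw [add_zero]

theorem carrier_toLoop (hS : S.Smooth) : (D.toLoop hS).carrier =
    D.γ '' Icc (D.s 0) (D.s (Fin.last N)) ∪ D.γl '' Icc 0 D.T := by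
  ext p
  rw [Loop.carrier, mem_iUnion]
  constructor
  · rintro ⟨i, t, ht, rfl⟩
    have key : ∀ i : Fin (N + 1),
        t ∈ Icc 0 (if i = Fin.last N then D.T else D.s (i + 1) - D.s i) →
        (if i = Fin.last N then D.γl t else D.γ (D.s i + t)) ∈
        D.γ '' Icc (D.s 0) (D.s (Fin.last N)) ∪ D.γl '' Icc 0 D.T := by
      intro i ht
      split_ifs at ht ⊢ with h
      · exact Or.inr ⟨t, ht, rfl⟩
      · exact Or.inl ⟨_, D.segment_subset i ht, rfl⟩
    exact key i ht
  · have key : ∀ (p : ℝ × ℝ), (∃ (i : Fin (N + 1)) (t : ℝ),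
        t ∈ Icc 0 (if i = Fin.last N then D.T else D.s (i + 1) - D.s i) ∧
        (if i = Fin.last N then D.γl t else D.γ (D.s i + t)) = p) →
        ∃ i, p ∈ (D.toLoop hS).γ i '' Icc 0 ((D.toLoop hS).T i) :=
      fun p ⟨i, t, ht, h⟩ => ⟨i, t, ht, h⟩
    rintro (⟨t, ht, rfl⟩ | ⟨t, ht, rfl⟩)
    · apply key
      -- the last contact time not after `t`
      let F := Finset.univ.filter fun i : Fin (N + 1) => D.s i ≤ t
      have hF : F.Nonempty := ⟨0, by simp [F, ht.1]⟩
      have hmax : D.s (F.max' hF) ≤ t := by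
        have := F.max'_mem hF; simpa [F] using this
      by_cases h : F.max' hF = Fin.last N
      · refine ⟨Fin.last N, 0, by simp [D.T_pos.le], ?_⟩
        rw [h] at hmax
        rw [if_pos rfl, D.startl, le_antisymm ht.2 hmax]
      · refine ⟨F.max' hF, t - D.s (F.max' hF), ?_, ?_⟩
        · rw [if_neg h]
          refine ⟨by linarith, ?_⟩
          by_contra hcon
          have hmem : F.max' hF + 1 ∈ F := by
            simp only [F, Finset.mem_filter, Finset.mem_univ, true_and]
            change D.s (F.max' hF + 1) ≤ t
            linarith [not_le.1 hcon]
          have := D.mono.monotone (F.le_max' _ hmem)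
          linarith [D.lt_succ h]
        · rw [if_neg h, add_sub_cancel]
    · exact key _ ⟨Fin.last N, t, by simpa using ht, by simp⟩

theorem switchingPoints_toLoop (hS : S.Smooth) :
    (D.toLoop hS).switchingPoints = {D.γ (D.s 0), D.γ (D.s (Fin.last N))} := by
  have h0 : (0 : Fin (N + 1)) ≠ Fin.last N := fun h => by
    have := congrArg Fin.val h
    simp only [Fin.val_zero, Fin.val_last] at this
    exact D.N_pos.ne this
  ext p
  constructor
  · rintro ⟨i, hi, rfl⟩
    have key : ∀ i : Fin (N + 1), (if i = Fin.last N then Side.lower else .upper) ≠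
        (if i + 1 = Fin.last N then Side.lower else .upper) →
        (D.toLoop hS).γ (i + 1 : Fin (N + 1)) 0 ∈
          ({D.γ (D.s 0), D.γ (D.s (Fin.last N))} : Set (ℝ × ℝ)) := by
      intro i hi
      rw [D.toLoop_start hS (i + 1)]
      by_cases h : i = Fin.last N
      · subst h; left; rw [Fin.last_add_one]
      · by_cases h' : i + 1 = Fin.last N
        · right; rw [h']; rfl
        · simp [h, h'] at hi
    exact key i hi
  · have key : ∀ i : Fin (N + 1), (if i = Fin.last N then Side.lower else .upper) ≠
        (if i + 1 = Fin.last N then Side.lower else .upper) →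
        D.γ (D.s (i + 1)) ∈ (D.toLoop hS).switchingPoints :=
      fun i hi => ⟨i, hi, (D.toLoop_start hS _).symm⟩
    rintro (rfl | rfl)
    · have := key (Fin.last N) (by rw [Fin.last_add_one, if_pos rfl, if_neg h0]; simp)
      rwa [Fin.last_add_one] at this
    · have h1 : Fin.last N - 1 + 1 = Fin.last N := sub_add_cancel _ _
      have h2 : Fin.last N - 1 ≠ Fin.last N := fun h => h0 (by
        have h3 := h1; rw [h, Fin.last_add_one] at h3; exact h3)
      have := key (Fin.last N - 1) (by rw [h1, if_pos rfl, if_neg h2]; simp)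
      rwa [h1] at this

theorem tangentPoints_toLoop (hS : S.Smooth) :
    (D.toLoop hS).tangentPoints = {p | p ∈ S.tangent U ∧ ∃ i, D.γ (D.s i) = p} := by
  ext p
  rw [Loop.tangentPoints, carrier_toLoop]
  constructor
  · rintro ⟨h, hp⟩
    refine ⟨hp, ?_⟩
    have hp0 : p.2 = 0 := hp.1.2
    rcases h with ⟨t, ht, rfl⟩ | ⟨t, ht, rfl⟩
    · obtain ⟨i, hi⟩ := (D.zero_iff t ht).1 hp0
      exact ⟨i, by rw [hi]⟩
    · rcases eq_or_lt_of_le ht.1 with h | h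
      · exact ⟨Fin.last N, by rw [← h, D.startl]⟩
      rcases eq_or_lt_of_le ht.2 with h' | h'
      · exact ⟨0, by rw [h', D.stopl]⟩
      · exact absurd (D.insidel t ⟨h, h'⟩).2 (by rw [hp0]; exact lt_irrefl _)
  · rintro ⟨hp, i, rfl⟩
    exact ⟨Or.inl ⟨_, D.s_mem i, rfl⟩, hp⟩

theorem isNonsliding_toLoop (hS : S.Smooth) (h : ∃ i, D.γ (D.s i) ∈ S.tangent U) :
    (D.toLoop hS).IsNonsliding := by
  obtain ⟨i, hi⟩ := h
  have key : ∀ i : Fin (N + 1), D.γ (D.s i) ∈ S.tangent U → (D.toLoop hS).IsNonsliding :=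
    fun i hi => ⟨i, by rw [D.toLoop_start hS i]; exact hi⟩
  exact key i hi

end LoopData

/-! ### The shear and the lower arc of the perturbed loop -/

/-- The shear `y = Y - ψ(x)` turns orbits of `(F, G)` into orbits of the sheared field. -/
theorem hasDerivAt_shear {F G : ℝ × ℝ → ℝ} {ψ : ℝ → ℝ} {Γ : ℝ → ℝ × ℝ} {t : ℝ}
    (hψ : DifferentiableAt ℝ ψ (Γ t).1) (h : HasDerivAt Γ (F (Γ t), G (Γ t)) t) :
    HasDerivAt (fun t => ((Γ t).1, (Γ t).2 - ψ (Γ t).1))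
      (F (Γ t), G (Γ t) - F (Γ t) * deriv ψ (Γ t).1) t := by
  have h1 := HasDerivAt.fst_prod h
  have h2 := HasDerivAt.snd_prod h
  have h3 := h2.sub (hψ.hasDerivAt.comp t h1)
  refine h1.prodMk ?_
  rw [mul_comm (F (Γ t))]
  exact h3

namespace Arcs

variable {f φ : Side → ℝ × ℝ → ℝ} {m : Side → ℕ} {U : Set (ℝ × ℝ)} {a : ℝ}

theorem carrier_subset {S : PWS} (A : Arcs S U a) (hU0 : ((0 : ℝ), (0 : ℝ)) ∈ U) :
    A.carrier ⊆ U := by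
  intro p hp
  simp only [carrier, mem_iUnion, mem_image] at hp
  obtain ⟨s, t, ht, rfl⟩ := hp
  rcases A.mem_zone_or_eq s ht with h | h | h
  · cases s <;> exact h.1
  · rw [h]; exact A.crossing.1.1
  · rw [h]; exact hU0

theorem exists_dist_lt_mem {S : PWS} (A : Arcs S U a) (hUo : IsOpen U)
    (hU0 : ((0 : ℝ), (0 : ℝ)) ∈ U) : ∃ ε : ℝ, 0 < ε ∧ ∀ s, ∀ t ∈ Icc 0 (A.T s), ∀ p,
      dist p (A.γ s t) < ε → p ∈ U := by
  obtain ⟨ε, hε, h⟩ := A.isCompact_carrier.exists_thickening_subset_open hUo (A.carrier_subset hU0)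
  refine ⟨ε, hε, fun s t ht p hp => h (Metric.mem_thickening_iff.2 ⟨A.γ s t, ?_, hp⟩)⟩
  exact mem_iUnion.2 ⟨s, t, ht, rfl⟩

/-- Both vertical speeds are positive at the crossing point. -/
theorem speed_pos {S : PWS} (A : Arcs S U a) : ∀ s, 0 < S.g s (a, 0) := by
  have h0 := A.orbit .upper 0 ⟨le_rfl, (A.T_pos _).le⟩
  have h1 := deriv_nonneg_of_start (A.T_pos .upper) (HasDerivWithinAt.snd_prod h0)
    (by rw [A.upper_start]) (fun t ht => by
      rcases A.mem_zone_or_eq .upper ht with h | h | h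
      · exact h.2.le
      · rw [h]
      · rw [h])
  rw [A.upper_start] at h1
  have h1 : 0 ≤ S.g .upper (a, 0) := h1
  have h2 := A.crossing.2
  have h3 : 0 < S.g .upper (a, 0) := lt_of_le_of_ne h1 fun h => by
    rw [← h, zero_mul] at h2; exact lt_irrefl _ h2
  intro s
  cases s
  · exact h3
  · exact (mul_pos_iff_of_pos_left h3).1 h2

end Arcs

/-- The clamp of a time to an interval moves it at most as far as the interval is exceeded. -/
theorem exists_mem_Icc_abs_sub_le {a b a' b' τ t : ℝ} (hab : a ≤ b) (ha : |a' - a| ≤ τ)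
    (hb : |b' - b| ≤ τ) (ht : t ∈ Icc a' b') (hτ : 0 ≤ τ) : ∃ t' ∈ Icc a b, |t - t'| ≤ τ := by
  rw [abs_le] at ha hb
  rcases le_total t a with h | h
  · exact ⟨a, ⟨le_rfl, hab⟩, by rw [abs_le]; constructor <;> linarith [ht.1]⟩
  rcases le_total t b with h' | h'
  · exact ⟨t, ⟨h, h'⟩, by simpa using hτ⟩
  · exact ⟨b, ⟨hab, le_rfl⟩, by rw [abs_le]; constructor <;> linarith [ht.2]⟩

theorem exists_pos_le_of_continuousOn {h : ℝ → ℝ} {a b : ℝ} (hc : ContinuousOn h (Icc a b))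
    (hpos : ∀ t ∈ Icc a b, 0 < h t) : ∃ c : ℝ, 0 < c ∧ ∀ t ∈ Icc a b, c ≤ h t := by
  rcases (Icc a b).eq_empty_or_nonempty with he | he
  · exact ⟨1, one_pos, by simp [he]⟩
  · obtain ⟨t, ht, hmin⟩ := isCompact_Icc.exists_isMinOn he hc
    exact ⟨h t, hpos t ht, fun t' ht' => hmin ht'⟩

theorem exists_dist_lt_of_continuousOn {Γ : ℝ → ℝ × ℝ} {a b : ℝ} (hc : ContinuousOn Γ (Icc a b))
    {ε : ℝ} (hε : 0 < ε) : ∃ τ : ℝ, 0 < τ ∧ ∀ t ∈ Icc a b, ∀ t' ∈ Icc a b, |t - t'| ≤ τ →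
      dist (Γ t) (Γ t') < ε := by
  obtain ⟨δ, hδ, h⟩ := Metric.uniformContinuousOn_iff.1
    (isCompact_Icc.uniformContinuousOn_of_continuous hc) ε hε
  exact ⟨δ / 2, by positivity, fun t ht t' ht' hd => h t ht t' ht' (by
    rw [Real.dist_eq]; linarith)⟩

theorem abs_fst_sub_le_dist (p q : ℝ × ℝ) : |p.1 - q.1| ≤ dist p q := by
  rw [Prod.dist_eq]; exact le_max_left _ _

theorem abs_snd_sub_le_dist (p q : ℝ × ℝ) : |p.2 - q.2| ≤ dist p q := by
  rw [Prod.dist_eq]; exact le_max_right _ _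

theorem mul_self_of_sign {σ : ℝ} (hσ : σ = 1 ∨ σ = -1) : σ * σ = 1 := by
  rcases hσ with rfl | rfl <;> norm_num

set_option maxHeartbeats 1000000 in
/-- The lower part of the perturbed loop: points `(p, 0)` close to `P` and `(q, 0)` close to the
origin, on the side to which the lower arc departs, can be joined by an orbit of a lower system
whose switching line is lifted by a small `κ` near the origin. -/
theorem Arcs.exists_lower_return {f φ : Side → ℝ × ℝ → ℝ} {m : Side → ℕ} {U : Set (ℝ × ℝ)} {a : ℝ}
    (A : Arcs (baseSystem f φ m) U a) (hUo : IsOpen U) (hU0 : ((0 : ℝ), (0 : ℝ)) ∈ U)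
    (hf : ∀ s, ContDiff ℝ ∞ (f s)) (hφ : ∀ s, ContDiff ℝ ∞ (φ s))
    (hf0 : f .lower (0, 0) ≠ 0) (hφ0 : φ .lower (0, 0) ≠ 0) {r₁ r₂ : ℝ} (har : a < r₁)
    (hr : r₁ < r₂) (hr0 : r₂ < 0) {ε : ℝ} (hε : 0 < ε) :
    ∃ δ : ℝ, 0 < δ ∧ ∀ p q : ℝ, |p - a| < δ → |q| < δ → 0 < f .lower (0, 0) * q →
      ∃ (κ T : ℝ) (γ : ℝ → ℝ × ℝ), |κ| < ε ∧ 0 < T ∧ γ 0 = (q, 0) ∧ γ T = (p, 0) ∧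
        (∀ t ∈ Icc 0 T, HasDerivWithinAt γ
          (f .lower ((γ t).1, (γ t).2 + κ * cutUp (γ t).1 r₁ r₂),
            φ .lower ((γ t).1, (γ t).2 + κ * cutUp (γ t).1 r₁ r₂) * (γ t).1 ^ m .lower -
            f .lower ((γ t).1, (γ t).2 + κ * cutUp (γ t).1 r₁ r₂) *
              deriv (fun x => κ * cutUp x r₁ r₂) (γ t).1) (Icc 0 T) t) ∧
        (∀ t ∈ Ioo 0 T, γ t ∈ zone U .lower) ∧
        (∀ t ∈ Icc 0 T, ∃ t' ∈ Icc 0 (A.T .lower), dist (γ t) (A.γ .lower t') < ε) ∧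
        (∀ t' ∈ Icc 0 (A.T .lower), ∃ t ∈ Icc 0 T, dist (γ t) (A.γ .lower t') < ε) := by
  obtain ⟨εU, hεU, hU⟩ := A.exists_dist_lt_mem hUo hU0
  have hsign := A.lower_sign (hφ .lower).continuous hf0 hφ0
  have hgP := A.speed_pos .lower
  have ha := A.neg
  set T := A.T .lower with hT
  have hT0 : 0 < T := A.T_pos .lower
  set F := f .lower (0, 0) with hF
  have hBs := contDiff_baseSystem (m := m) hf hφ
  have hV := hBs.contDiff_field .lower
  obtain ⟨τ₀, Γ₀, hτ₀, hΓ₀, hΓeq⟩ := exists_extension hV hT0 (A.orbit .lower)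
  have hΓ00 : Γ₀ 0 = (0, 0) := by rw [hΓeq ⟨le_rfl, hT0.le⟩]; exact A.lower_start
  have hΓ0T : Γ₀ T = (a, 0) := by rw [hΓeq ⟨hT0.le, le_rfl⟩]; exact A.lower_end
  have hcont : ContinuousOn Γ₀ (Icc (-τ₀) (T + τ₀)) := fun t ht =>
    (hΓ₀ t ht).continuousAt.continuousWithinAt
  -- neighbourhoods of the two ends in which the signs are those at the ends
  obtain ⟨ρ₁, hρ₁, hb₁⟩ := exists_ball_abs_sub_lt (hf .lower).continuous hf0
  obtain ⟨ρ₂, hρ₂, hb₂⟩ := exists_ball_abs_sub_lt (hφ .lower).continuous hφ0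
  obtain ⟨ρ₃, hρ₃, hb₃⟩ := exists_ball_abs_sub_lt (hBs .lower).2.continuous hgP.ne'
  set ρ := min (min (min ρ₁ ρ₂) (min ρ₃ (r₁ - a))) (min (-r₂) (min ε εU)) with hρ
  have hρ0 : 0 < ρ := by
    have : 0 < r₁ - a := by linarith
    have : 0 < -r₂ := by linarith
    positivity
  have hρa : ρ ≤ ρ₁ := (min_le_left _ _).trans ((min_le_left _ _).trans (min_le_left _ _))
  have hρb : ρ ≤ ρ₂ := (min_le_left _ _).trans ((min_le_left _ _).trans (min_le_right _ _))
  have hρc : ρ ≤ ρ₃ := (min_le_left _ _).trans ((min_le_right _ _).trans (min_le_left _ _))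
  have hρd : ρ ≤ r₁ - a := (min_le_left _ _).trans ((min_le_right _ _).trans (min_le_right _ _))
  have hρe : ρ ≤ -r₂ := (min_le_right _ _).trans (min_le_left _ _)
  have hρf : ρ ≤ ε := (min_le_right _ _).trans ((min_le_right _ _).trans (min_le_left _ _))
  have hρg : ρ ≤ εU := (min_le_right _ _).trans ((min_le_right _ _).trans (min_le_right _ _))
  obtain ⟨τ₁, hτ₁, hu₁⟩ := exists_dist_lt_of_continuousOn hcont (half_pos hρ0)
  set τ := min (min τ₀ τ₁) (T / 4) with hτ
  have hτ0 : 0 < τ := by positivity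
  have hτa : τ ≤ τ₀ := (min_le_left _ _).trans (min_le_left _ _)
  have hτb : τ ≤ τ₁ := (min_le_left _ _).trans (min_le_right _ _)
  have hτc : τ ≤ T / 4 := min_le_right _ _
  -- away from its ends the lower arc stays below `-c`
  obtain ⟨c, hc0, hc⟩ := exists_pos_le_of_continuousOn (h := fun t => -(Γ₀ t).2) (a := τ)
    (b := T - τ) ((continuous_snd.neg.comp_continuousOn hcont).mono
      (Icc_subset_Icc (by linarith) (by linarith))) (fun t ht => by
        have h1 := (A.inside .lower t ⟨by linarith [ht.1], by linarith [ht.2]⟩).2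
        rw [hΓeq ⟨by linarith [ht.1], by linarith [ht.2]⟩]; linarith)
  set c' := min c (ρ / 2) with hc'
  have hc'0 : 0 < c' := by positivity
  have hc'c : c' ≤ c := min_le_left _ _
  have hc'ρ : c' ≤ ρ / 2 := min_le_right _ _
  obtain ⟨τ₂', hτ₂', hu₂⟩ := exists_dist_lt_of_continuousOn hcont (ε := c' / 4) (by positivity)
  set τ₂ := min τ₂' τ with hτ₂
  have hτ₂0 : 0 < τ₂ := by positivity
  have hτ₂a : τ₂ ≤ τ₂' := min_le_left _ _
  have hτ₂b : τ₂ ≤ τ := min_le_right _ _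
  -- the base orbit passes the origin with nonzero horizontal speed
  have hx₀m : StrictMonoOn (fun t => (Γ₀ t).1 * F) (Icc (-τ₂) τ₂) :=
    strictMonoOn_of_deriv_mul_pos (x' := fun t => f .lower (Γ₀ t))
      (fun t ht => (HasDerivAt.fst_prod (hΓ₀ t ⟨by linarith [ht.1], by linarith [ht.2]⟩)).hasDerivWithinAt)
      (fun t ht => mul_pos_of_abs_sub_lt (hb₁ _ (by
        have := hu₁ t ⟨by linarith [ht.1], by linarith [ht.2]⟩ 0 ⟨by linarith, by linarith⟩
          (by rw [sub_zero, abs_le]; constructor <;> linarith [ht.1, ht.2])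
        rw [hΓ00] at this; linarith))
        (by rw [sub_self, abs_zero]; have := abs_pos.2 hf0; positivity))
  have hx₀l : (Γ₀ (-τ₂)).1 * F < 0 := by
    have := hx₀m ⟨le_rfl, by linarith⟩ ⟨by linarith, hτ₂0.le⟩ (by linarith : -τ₂ < 0)
    simpa [hΓ00] using this
  have hx₀r : 0 < (Γ₀ τ₂).1 * F := by
    have := hx₀m ⟨by linarith, hτ₂0.le⟩ ⟨by linarith, le_rfl⟩ hτ₂0
    simpa [hΓ00] using this
  have hF0 : 0 < |F| := abs_pos.2 hf0
  have hxl0 : 0 < |(Γ₀ (-τ₂)).1| := abs_pos.2 fun h => by rw [h, zero_mul] at hx₀l; exact lt_irrefl _ hx₀l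
  have hxr0 : 0 < |(Γ₀ τ₂).1| := abs_pos.2 fun h => by rw [h, zero_mul] at hx₀r; exact lt_irrefl _ hx₀r
  set η := min (|(Γ₀ (-τ₂)).1|) (|(Γ₀ τ₂).1|) with hη
  have hη0 : 0 < η := by positivity
  set ε₁ := min (c' / 4) (η / 4) with hε₁
  have hε₁0 : 0 < ε₁ := by positivity
  have hε₁a : ε₁ ≤ c' / 4 := min_le_left _ _
  have hε₁b : ε₁ ≤ η / 4 := min_le_right _ _
  obtain ⟨R, hR⟩ := isCompact_Icc.exists_bound_of_continuousOn hcont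
  have hTm : T ∈ Icc (-τ₀) (T + τ₀) := ⟨by linarith, by linarith⟩
  -- shadow the lower arc backward in time, from its end at `P`
  obtain ⟨δ₁, hδ₁, hsh⟩ := exists_shadowing hV hTm (fun t ht => (hΓ₀ t ht).hasDerivWithinAt) hR hε₁0
  refine ⟨min δ₁ (η / 4), by positivity, fun p q hp hq hqF => ?_⟩
  obtain ⟨Γ, hΓT, hΓ, hclose⟩ := hsh _ hV (fun z _ => by rw [sub_self, norm_zero]; exact hδ₁.le)
    (p, 0) (by
      rw [hΓ0T, Prod.norm_def]
      exact max_le (hp.le.trans (min_le_left _ _)) (by simpa using hδ₁.le))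
  have hclose : ∀ t ∈ Icc (-τ₀) (T + τ₀), dist (Γ t) (Γ₀ t) < ε₁ := fun t ht => by
    rw [dist_eq_norm]; exact hclose t ht
  have hq' : |q| < η / 4 := hq.trans_le (min_le_right _ _)
  have hΓc : ContinuousOn Γ (Icc (-τ₀) (T + τ₀)) := fun t ht =>
    (hΓ t ht).continuousAt.continuousWithinAt
  have hm0 : ∀ t ∈ Icc (-τ) τ, t ∈ Icc (-τ₀) (T + τ₀) := fun t ht =>
    ⟨by linarith [ht.1], by linarith [ht.2]⟩
  have hnear0 : ∀ t ∈ Icc (-τ) τ, dist (Γ t) (0, 0) < ρ := fun t ht => by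
    have h1 := hclose t (hm0 t ht)
    have h2 := hu₁ t (hm0 t ht) 0 ⟨by linarith, by linarith⟩
      (by rw [sub_zero, abs_le]; constructor <;> linarith [ht.1, ht.2])
    rw [hΓ00] at h2
    have := dist_triangle (Γ t) (Γ₀ t) (0, 0)
    linarith
  have hxm : StrictMonoOn (fun t => (Γ t).1 * F) (Icc (-τ) τ) :=
    strictMonoOn_of_deriv_mul_pos (x' := fun t => f .lower (Γ t))
      (fun t ht => (HasDerivAt.fst_prod (hΓ t (hm0 t ht))).hasDerivWithinAt)
      (fun t ht => mul_pos_of_abs_sub_lt (hb₁ _ ((hnear0 t (Ioo_subset_Icc_self ht)).trans_le hρa))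
        (by rw [sub_self, abs_zero]; positivity))
  -- the time at which the orbit is above or below `(q, 0)`
  obtain ⟨tq, htq, hxq⟩ : ∃ tq ∈ Icc (-τ₂) τ₂, (Γ tq).1 = q := by
    have hcc : ContinuousOn (fun t => (Γ t).1 * F) (Icc (-τ₂) τ₂) :=
      ((continuous_fst.comp_continuousOn hΓc).mul continuousOn_const).mono fun t ht =>
        hm0 t ⟨by linarith [ht.1], by linarith [ht.2]⟩
    have hend : ∀ t ∈ Icc (-τ) τ, |(Γ t).1 - (Γ₀ t).1| < ε₁ := fun t ht =>
      (abs_fst_sub_le_dist _ _).trans_lt (hclose t (hm0 t ht))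
    have e1 := hend (-τ₂) ⟨by linarith, by linarith⟩
    have e2 := hend τ₂ ⟨by linarith, by linarith⟩
    have e3 : η ≤ |(Γ₀ (-τ₂)).1| := min_le_left _ _
    have e4 : η ≤ |(Γ₀ τ₂).1| := min_le_right _ _
    have hqq : q * F ∈ Icc ((Γ (-τ₂)).1 * F) ((Γ τ₂).1 * F) := by
      rw [abs_lt] at e1 e2 hq'
      rcases lt_or_gt_of_ne hf0 with h | h
      · have g1 : 0 < (Γ₀ (-τ₂)).1 := by
          by_contra hn; exact absurd (mul_nonneg_of_nonpos_of_nonpos (not_lt.1 hn) h.le) (not_le.2 hx₀l)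
        have g2 : (Γ₀ τ₂).1 < 0 := by
          by_contra hn; exact absurd (mul_nonpos_of_nonneg_of_nonpos (not_lt.1 hn) h.le) (not_le.2 hx₀r)
        rw [abs_of_pos g1] at e3
        rw [abs_of_neg g2] at e4
        exact ⟨mul_le_mul_of_nonpos_right (by linarith) h.le,
          mul_le_mul_of_nonpos_right (by linarith) h.le⟩
      · have g1 : (Γ₀ (-τ₂)).1 < 0 := by
          by_contra hn; exact absurd (mul_nonneg (not_lt.1 hn) h.le) (not_le.2 hx₀l)
        have g2 : 0 < (Γ₀ τ₂).1 := by
          by_contra hn; exact absurd (mul_nonpos_of_nonpos_of_nonneg (not_lt.1 hn) h.le) (not_le.2 hx₀r)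
        rw [abs_of_neg g1] at e3
        rw [abs_of_pos g2] at e4
        exact ⟨mul_le_mul_of_nonneg_right (by linarith) h.le,
          mul_le_mul_of_nonneg_right (by linarith) h.le⟩
    obtain ⟨tq, h1, h2⟩ := intermediate_value_Icc (by linarith) hcc hqq
    exact ⟨tq, h1, mul_right_cancel₀ hf0 h2⟩
  have htq' : tq ∈ Icc (-τ) τ := ⟨by linarith [htq.1], by linarith [htq.2]⟩
  -- the step height is the gap between the orbit and `(q, 0)`, so that the sheared orbit starts
  -- there
  set κ := (Γ tq).2 with hκ
  have hκc : |κ| < c' / 2 := by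
    have h1 := hclose tq (hm0 tq htq')
    have h2 := hu₂ tq (hm0 tq htq') 0 ⟨by linarith, by linarith⟩
      (by rw [sub_zero, abs_le]; constructor <;> linarith [htq.1, htq.2])
    rw [hΓ00] at h2
    have h3 := dist_triangle (Γ tq) (Γ₀ tq) (0, 0)
    have h4 := abs_snd_sub_le_dist (Γ tq) (0, 0)
    simp only [sub_zero] at h4
    linarith
  have hcut : ∀ x, |κ * cutUp x r₁ r₂| ≤ |κ| := fun x => by
    rw [abs_mul, abs_of_nonneg (cutUp_nonneg _ _ _)]
    exact mul_le_of_le_one_right (abs_nonneg _) (cutUp_le_one _ _ _)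
  set ψ : ℝ → ℝ := fun x => κ * cutUp x r₁ r₂ with hψ
  have hψd : Differentiable ℝ ψ :=
    (contDiff_const.mul (contDiff_cutUp hr)).differentiable (by simp)
  set γ : ℝ → ℝ × ℝ := fun t => ((Γ t).1, (Γ t).2 - ψ (Γ t).1) with hγ
  have hγΓ : ∀ t, dist (γ t) (Γ t) ≤ |κ| := fun t => by
    rw [Prod.dist_eq]
    refine max_le (by simp [hγ]) ?_
    simp only [hγ, Real.dist_eq, sub_sub_cancel_left, abs_neg]
    exact hcut _
  have hmT : ∀ t ∈ Icc tq T, t ∈ Icc (-τ₀) (T + τ₀) := fun t ht =>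
    ⟨by linarith [ht.1, htq.1], by linarith [ht.2]⟩
  have hγd : ∀ t ∈ Icc tq T, HasDerivAt γ (f .lower (Γ t),
      φ .lower (Γ t) * (Γ t).1 ^ m .lower - f .lower (Γ t) * deriv ψ (Γ t).1) t := fun t ht =>
    hasDerivAt_shear (F := f .lower) (G := fun p => φ .lower p * p.1 ^ m .lower) (hψd _)
      (hΓ t (hmT t ht))
  have hback : ∀ t, ((γ t).1, (γ t).2 + ψ (γ t).1) = Γ t := fun t => by simp [hγ]
  have hγA : ∀ t ∈ Icc tq T, ∀ t' ∈ Icc 0 T, |t - t'| ≤ τ → dist (γ t) (A.γ .lower t') < ρ := by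
    intro t ht t' ht' htt
    have h1 := hclose t (hmT t ht)
    have h2 := hu₁ t (hmT t ht) t' ⟨by linarith [ht'.1], by linarith [ht'.2]⟩ (htt.trans hτb)
    rw [hΓeq ht'] at h2
    have h3 := dist_triangle4 (γ t) (Γ t) (Γ₀ t) (A.γ .lower t')
    have h4 := hγΓ t
    linarith
  have htq0 : |tq - 0| ≤ τ := by rw [sub_zero, abs_le]; exact htq'
  have htqT : tq < T := by linarith [htq.2]
  -- near the origin the shear is constant and the orbit descends, in the middle the orbit is far
  -- below the axis, and near `P` the shear is trivial and the orbit ascends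
  have hneg : ∀ t ∈ Ioo tq T, (γ t).2 < 0 := by
    intro t ht
    rcases le_total t τ with h1 | h1
    · -- near the origin
      have hψκ : ∀ s ∈ Icc (-τ) τ, ψ (Γ s).1 = κ := fun s hs => by
        have := (abs_fst_sub_le_dist (Γ s) (0, 0)).trans_lt (hnear0 s hs)
        simp only [sub_zero] at this
        rw [hψ]; simp only
        rw [cutUp_of_ge hr (by linarith [(abs_lt.1 this).1]), mul_one]
      have hanti : StrictMonoOn (fun t => (Γ t).2 * (-1)) (Icc tq τ) := by
        refine strictMonoOn_of_deriv_mul_pos (x' := fun t => φ .lower (Γ t) * (Γ t).1 ^ m .lower)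
          (fun s hs => (HasDerivAt.snd_prod (hΓ s (hm0 s ⟨by linarith [hs.1, htq'.1], hs.2⟩))).hasDerivWithinAt)
          (fun s hs => ?_)
        have hsm : s ∈ Icc (-τ) τ := ⟨by linarith [hs.1, htq'.1], hs.2.le⟩
        have g1 : 0 < (Γ s).1 * F := by
          have := hxm htq' hsm hs.1
          simp only [hxq] at this
          linarith
        have g2 := mul_pos_of_abs_sub_lt (hb₂ _ ((hnear0 s hsm).trans_le hρb))
          (by rw [sub_self, abs_zero]; have := abs_pos.2 hφ0; positivity)
        have g3 : 0 < (φ .lower (Γ s) * φ .lower (0, 0)) * ((Γ s).1 * F) ^ m .lower :=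
          mul_pos g2 (pow_pos g1 _)
        have g4 : (φ .lower (Γ s) * φ .lower (0, 0)) * ((Γ s).1 * F) ^ m .lower =
          (φ .lower (Γ s) * (Γ s).1 ^ m .lower) * (φ .lower (0, 0) * F ^ m .lower) := by
          rw [mul_pow]; ring
        rw [g4] at g3
        have : φ .lower (Γ s) * (Γ s).1 ^ m .lower < 0 := by
          by_contra hn
          exact absurd (mul_nonpos_of_nonneg_of_nonpos (not_lt.1 hn) hsign.le) (not_le.2 g3)
        linarith
      have := hanti ⟨le_rfl, ht.1.le.trans h1⟩ ⟨ht.1.le, h1⟩ ht.1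
      change (Γ t).2 - ψ (Γ t).1 < 0
      rw [hψκ t ⟨by linarith [ht.1, htq'.1], h1⟩]
      simp only at this
      linarith
    rcases le_total t (T - τ) with h2 | h2
    · have g1 := hc t ⟨h1, h2⟩
      have g2 := (abs_snd_sub_le_dist _ _).trans_lt (hclose t (hmT t ⟨ht.1.le, ht.2.le⟩))
      have g3 := hcut (Γ t).1
      rw [abs_lt] at g2
      rw [abs_le] at g3
      change (Γ t).2 - κ * cutUp (Γ t).1 r₁ r₂ < 0
      linarith [g2.2, g3.1]
    · -- near `P`
      have hnearP : ∀ s ∈ Icc (T - τ) T, dist (Γ s) (a, 0) < ρ := fun s hs => by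
        have hsm : s ∈ Icc (-τ₀) (T + τ₀) := ⟨by linarith [hs.1], by linarith [hs.2]⟩
        have k1 := hclose s hsm
        have k2 := hu₁ s hsm T hTm (by rw [abs_le]; constructor <;> linarith [hs.1, hs.2])
        rw [hΓ0T] at k2
        have := dist_triangle (Γ s) (Γ₀ s) (a, 0)
        linarith
      have hmono : StrictMonoOn (fun t => (Γ t).2 * (baseSystem f φ m).g .lower (a, 0))
          (Icc (T - τ) T) :=
        strictMonoOn_of_deriv_mul_pos (x' := fun t => (baseSystem f φ m).g .lower (Γ t))
          (fun s hs => (HasDerivAt.snd_prod (hΓ s ⟨by linarith [hs.1], by linarith [hs.2]⟩)).hasDerivWithinAt)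
          (fun s hs => mul_pos_of_abs_sub_lt (hb₃ _ ((hnearP s (Ioo_subset_Icc_self hs)).trans_le hρc))
            (by rw [sub_self, abs_zero]; have := abs_pos.2 hgP.ne'; positivity))
      have k1 := hmono ⟨h2, ht.2.le⟩ ⟨by linarith, le_rfl⟩ ht.2
      simp only [hΓT, zero_mul] at k1
      have k2 := (abs_fst_sub_le_dist (Γ t) (a, 0)).trans_lt (hnearP t ⟨h2, ht.2.le⟩)
      change (Γ t).2 - κ * cutUp (Γ t).1 r₁ r₂ < 0
      rw [cutUp_of_le (by linarith [(abs_lt.1 k2).2]), mul_zero, sub_zero]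
      by_contra hn
      exact absurd (mul_nonneg (not_lt.1 hn) hgP.le) (not_le.2 k1)
  refine ⟨κ, T - tq, fun s => γ (tq + s), by linarith, by linarith, ?_, ?_, fun s hs => ?_,
    fun s hs => ?_, fun s hs => ?_, fun t' ht' => ?_⟩
  · have := (abs_fst_sub_le_dist (Γ tq) (0, 0)).trans_lt (hnear0 tq htq')
    simp only [sub_zero, hxq] at this
    simp only [add_zero, hγ, hψ, hxq]
    rw [cutUp_of_ge hr (by linarith [(abs_lt.1 this).1]), mul_one, ← hκ, sub_self]
  · simp only [add_sub_cancel, hγ, hψ, hΓT]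
    have : |p - a| < ρ := by
      have := (abs_fst_sub_le_dist (Γ T) (Γ₀ T)).trans_lt (hclose T hTm)
      rw [hΓT, hΓ0T] at this
      linarith
    rw [cutUp_of_le (by linarith [(abs_lt.1 this).2]), mul_zero, sub_zero]
  · have h1 := (hγd (tq + s) ⟨by linarith [hs.1], by linarith [hs.2]⟩).comp_const_add tq s
    have h2 := hback (tq + s)
    simp only [hψ] at h2
    simp only [h2]
    exact h1.hasDerivWithinAt
  · have hm1 : tq + s ∈ Icc tq T := ⟨by linarith [hs.1], by linarith [hs.2]⟩
    refine ⟨?_, hneg _ ⟨by linarith [hs.1], by linarith [hs.2]⟩⟩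
    obtain ⟨t', ht', htt⟩ := exists_mem_Icc_abs_sub_le hT0.le htq0
      (by rw [sub_self, abs_zero]; exact hτ0.le) hm1 hτ0.le
    exact hU .lower t' ht' _ ((hγA _ hm1 t' ht' htt).trans_le hρg)
  · have hm1 : tq + s ∈ Icc tq T := ⟨by linarith [hs.1], by linarith [hs.2]⟩
    obtain ⟨t', ht', htt⟩ := exists_mem_Icc_abs_sub_le hT0.le htq0
      (by rw [sub_self, abs_zero]; exact hτ0.le) hm1 hτ0.le
    exact ⟨t', ht', (hγA _ hm1 t' ht' htt).trans_le hρf⟩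
  · obtain ⟨t, ht, htt⟩ := exists_mem_Icc_abs_sub_le (a' := 0) (b' := T) htqT.le
      (by rw [abs_sub_comm]; exact htq0) (by rw [sub_self, abs_zero]; exact hτ0.le) ht' hτ0.le
    refine ⟨t - tq, ⟨by linarith [ht.1], by linarith [ht.2]⟩, ?_⟩
    simp only [add_sub_cancel]
    exact (hγA t ht t' ht' (by rw [abs_sub_comm]; exact htt)).trans_le hρf

/-! ### The upper arc of the perturbed loop near the crossing point -/

/-- The field `(F, Φ ∏ (x - λ_i))`: a subsystem of the unfolding before its switching line is
deformed. -/
def splitField (F Φ : ℝ × ℝ → ℝ) {n : ℕ} (lam : Fin n → ℝ) (p : ℝ × ℝ) : ℝ × ℝ :=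
  (F p, Φ p * ∏ i, (p.1 - lam i))

theorem contDiff_splitField {F Φ : ℝ × ℝ → ℝ} (hF : ContDiff ℝ ∞ F) (hΦ : ContDiff ℝ ∞ Φ) {n : ℕ}
    (lam : Fin n → ℝ) : ContDiff ℝ 1 (splitField F Φ lam) := by
  refine ContDiff.of_le (n := ∞) ?_ (by exact_mod_cast le_top)
  exact hF.prodMk (hΦ.mul (contDiff_prod fun i _ => contDiff_fst.sub contDiff_const))

theorem mul_pos_of_mul_pos_of_mul_pos {u v w : ℝ} (h1 : 0 < u * v) (h2 : 0 < w * v) :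
    0 < w * u := by
  have h3 : 0 < (u * v) * (w * v) := mul_pos h1 h2
  have h4 : (u * v) * (w * v) = (w * u) * v ^ 2 := by ring
  rw [h4] at h3
  by_contra h
  exact absurd (mul_nonpos_of_nonpos_of_nonneg (not_lt.1 h) (sq_nonneg v)) (not_le.2 h3)

set_option maxHeartbeats 1000000 in
/-- The upper orbits of slightly perturbed systems that pass close to the origin come from a
transverse crossing of the switching line close to `P`, and stay above every deformed switching
line that differs from the original one only near the origin until they are near the origin. -/
theorem Arcs.exists_upper_approach {f φ : Side → ℝ × ℝ → ℝ} {m : Side → ℕ} {U : Set (ℝ × ℝ)}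
    {a : ℝ} (A : Arcs (baseSystem f φ m) U a) (hf : ∀ s, ContDiff ℝ ∞ (f s))
    (hφ : ∀ s, ContDiff ℝ ∞ (φ s)) {σ : ℝ} (hσ : 0 < σ * f .upper (0, 0)) {ε : ℝ} (hε : 0 < ε) :
    ∃ τ δ : ℝ, 0 < τ ∧ τ < A.T .upper / 2 ∧ 0 < δ ∧ ∀ lam : Fin (m .upper) → ℝ, ‖lam‖ ≤ δ →
      ∀ z : ℝ × ℝ, ‖z‖ ≤ δ → ∃ Γ : ℝ → ℝ × ℝ, Γ (A.T .upper) = z ∧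
        (∀ t ∈ Icc (-τ) (A.T .upper + τ),
          HasDerivAt Γ (splitField (f .upper) (φ .upper) lam (Γ t)) t) ∧
        σ * (Γ (A.T .upper - τ)).1 < -δ ∧ δ < σ * (Γ (A.T .upper + τ)).1 ∧
        (∀ t' ∈ Icc 0 (A.T .upper), ∀ t ∈ Icc (-τ) (A.T .upper + τ), |t - t'| ≤ τ →
          dist (Γ t) (A.γ .upper t') < ε) ∧
        ∀ ψ : ℝ → ℝ, (∀ x, |ψ x| ≤ δ) → (∀ x, δ ≤ |x| → ψ x = 0) → ∃ ta ∈ Ioo (-τ) τ,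
          (Γ ta).2 = 0 ∧ (∀ᶠ x in nhds (Γ ta).1, ψ x = 0) ∧
          0 < φ .upper (Γ ta) * ∏ i, ((Γ ta).1 - lam i) ∧
          ∀ t ∈ Ioc ta (A.T .upper - τ), ψ (Γ t).1 < (Γ t).2 := by
  have hgP := A.speed_pos .upper
  have ha := A.neg
  have hf0 : f .upper (0, 0) ≠ 0 := fun h => by rw [h, mul_zero] at hσ; exact lt_irrefl _ hσ
  set T := A.T .upper with hT
  have hT0 : 0 < T := A.T_pos .upper
  set F := f .upper (0, 0) with hF
  have hBs := contDiff_baseSystem (m := m) hf hφ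
  have hV := hBs.contDiff_field .upper
  obtain ⟨τ₀, Γ₀, hτ₀, hΓ₀, hΓeq⟩ := exists_extension hV hT0 (A.orbit .upper)
  have hΓ00 : Γ₀ 0 = (a, 0) := by rw [hΓeq ⟨le_rfl, hT0.le⟩]; exact A.upper_start
  have hΓ0T : Γ₀ T = (0, 0) := by rw [hΓeq ⟨hT0.le, le_rfl⟩]; exact A.upper_end
  have hcont : ContinuousOn Γ₀ (Icc (-τ₀) (T + τ₀)) := fun t ht =>
    (hΓ₀ t ht).continuousAt.continuousWithinAt
  obtain ⟨ρ₁, hρ₁, hb₁⟩ := exists_ball_abs_sub_lt (hf .upper).continuous hf0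
  obtain ⟨ρ₂, hρ₂, hb₂⟩ := exists_ball_abs_sub_lt (hBs .upper).2.continuous hgP.ne'
  set gP := (baseSystem f φ m).g .upper (a, 0) with hgPdef
  set ρ := min (min ρ₁ ρ₂) (min ε (-a / 2)) with hρ
  have hρ0 : 0 < ρ := by
    have : 0 < -a / 2 := by linarith
    positivity
  have hρa : ρ ≤ ρ₁ := (min_le_left _ _).trans (min_le_left _ _)
  have hρb : ρ ≤ ρ₂ := (min_le_left _ _).trans (min_le_right _ _)
  have hρc : ρ ≤ ε := (min_le_right _ _).trans (min_le_left _ _)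
  have hρd : ρ ≤ -a / 2 := (min_le_right _ _).trans (min_le_right _ _)
  obtain ⟨τ₁, hτ₁, hu₁⟩ := exists_dist_lt_of_continuousOn hcont (half_pos hρ0)
  set τ := min (min τ₀ τ₁) (T / 4) with hτ
  have hτ0 : 0 < τ := by positivity
  have hτa : τ ≤ τ₀ := (min_le_left _ _).trans (min_le_left _ _)
  have hτb : τ ≤ τ₁ := (min_le_left _ _).trans (min_le_right _ _)
  have hτc : τ ≤ T / 4 := min_le_right _ _
  -- away from its ends the upper arc stays above `c`
  obtain ⟨c, hc0, hc⟩ := exists_pos_le_of_continuousOn (h := fun t => (Γ₀ t).2) (a := τ)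
    (b := T - τ) ((continuous_snd.comp_continuousOn hcont).mono
      (Icc_subset_Icc (by linarith) (by linarith))) (fun t ht => by
        have h1 := (A.inside .upper t ⟨by linarith [ht.1], by linarith [ht.2]⟩).2
        rw [hΓeq ⟨by linarith [ht.1], by linarith [ht.2]⟩]; exact h1)
  have hmP : ∀ t ∈ Icc (-τ) τ, t ∈ Icc (-τ₀) (T + τ₀) := fun t ht =>
    ⟨by linarith [ht.1], by linarith [ht.2]⟩
  have hmO : ∀ t ∈ Icc (T - τ) (T + τ), t ∈ Icc (-τ₀) (T + τ₀) := fun t ht =>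
    ⟨by linarith [ht.1], by linarith [ht.2]⟩
  have hnP₀ : ∀ t ∈ Icc (-τ) τ, dist (Γ₀ t) (a, 0) < ρ / 2 := fun t ht => by
    have := hu₁ t (hmP t ht) 0 ⟨by linarith, by linarith⟩
      (by rw [sub_zero, abs_le]; constructor <;> linarith [ht.1, ht.2])
    rwa [hΓ00] at this
  have hnO₀ : ∀ t ∈ Icc (T - τ) (T + τ), dist (Γ₀ t) (0, 0) < ρ / 2 := fun t ht => by
    have := hu₁ t (hmO t ht) T ⟨by linarith, by linarith⟩
      (by rw [abs_le]; constructor <;> linarith [ht.1, ht.2])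
    rwa [hΓ0T] at this
  have hx₀m : StrictMonoOn (fun t => (Γ₀ t).1 * σ) (Icc (T - τ) (T + τ)) :=
    strictMonoOn_of_deriv_mul_pos (x' := fun t => f .upper (Γ₀ t))
      (fun t ht => (HasDerivAt.fst_prod (hΓ₀ t (hmO t ht))).hasDerivWithinAt)
      (fun t ht => by
        have := mul_pos_of_abs_sub_lt (hb₁ _ ((hnO₀ t (Ioo_subset_Icc_self ht)).trans_le
          (by linarith))) (by rw [sub_self, abs_zero]; have := abs_pos.2 hf0; positivity)
        rw [mul_comm]
        exact mul_pos_of_mul_pos_of_mul_pos this hσ)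
  have hx₀l : (Γ₀ (T - τ)).1 * σ < 0 := by
    have := hx₀m ⟨le_rfl, by linarith⟩ ⟨by linarith, by linarith⟩ (by linarith : T - τ < T)
    simpa [hΓ0T] using this
  have hx₀r : 0 < (Γ₀ (T + τ)).1 * σ := by
    have := hx₀m ⟨by linarith, by linarith⟩ ⟨by linarith, le_rfl⟩ (by linarith : T < T + τ)
    simpa [hΓ0T] using this
  have hy₀m : StrictMonoOn (fun t => (Γ₀ t).2 * gP) (Icc (-τ) τ) :=
    strictMonoOn_of_deriv_mul_pos (x' := fun t => (baseSystem f φ m).g .upper (Γ₀ t))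
      (fun t ht => (HasDerivAt.snd_prod (hΓ₀ t (hmP t ht))).hasDerivWithinAt)
      (fun t ht => mul_pos_of_abs_sub_lt (hb₂ _ ((hnP₀ t (Ioo_subset_Icc_self ht)).trans_le
          (by linarith))) (by rw [sub_self, abs_zero]; have := abs_pos.2 hgP.ne'; positivity))
  have hy₀l : (Γ₀ (-τ)).2 < 0 := by
    have := hy₀m ⟨le_rfl, by linarith⟩ ⟨by linarith, by linarith⟩ (by linarith : -τ < 0)
    simp only [hΓ00, zero_mul] at this
    by_contra h
    exact absurd (mul_nonneg (not_lt.1 h) hgP.le) (not_le.2 this)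
  have hy₀r : 0 < (Γ₀ τ).2 := by
    have := hy₀m ⟨by linarith, by linarith⟩ ⟨by linarith, le_rfl⟩ (by linarith : 0 < τ)
    simp only [hΓ00, zero_mul] at this
    exact pos_of_mul_pos_left this hgP.le
  have hσ0 : 0 < |σ| := abs_pos.2 fun h => by rw [h, zero_mul] at hσ; exact lt_irrefl _ hσ
  -- how close the perturbed orbit has to follow
  set c' := min (min (-((Γ₀ (T - τ)).1 * σ)) ((Γ₀ (T + τ)).1 * σ))
    (min (-(Γ₀ (-τ)).2) (min (Γ₀ τ).2 c)) with hc'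
  have hc'0 : 0 < c' := by
    have : 0 < -((Γ₀ (T - τ)).1 * σ) := by linarith
    have : 0 < -(Γ₀ (-τ)).2 := by linarith
    positivity
  have hc'a : c' ≤ -((Γ₀ (T - τ)).1 * σ) := (min_le_left _ _).trans (min_le_left _ _)
  have hc'b : c' ≤ (Γ₀ (T + τ)).1 * σ := (min_le_left _ _).trans (min_le_right _ _)
  have hc'c : c' ≤ -(Γ₀ (-τ)).2 := (min_le_right _ _).trans (min_le_left _ _)
  have hc'd : c' ≤ (Γ₀ τ).2 := (min_le_right _ _).trans ((min_le_right _ _).trans (min_le_left _ _))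
  have hc'e : c' ≤ c := (min_le_right _ _).trans ((min_le_right _ _).trans (min_le_right _ _))
  set ε₁ := min (min (c' / 4) (c' / 4 / |σ|)) (ρ / 4) with hε₁
  have hε₁0 : 0 < ε₁ := by positivity
  have hε₁a : ε₁ ≤ c' / 4 := (min_le_left _ _).trans (min_le_left _ _)
  have hε₁b : ε₁ * |σ| ≤ c' / 4 :=
    (le_div_iff₀ hσ0).1 ((min_le_left _ _).trans (min_le_right _ _))
  have hε₁c : ε₁ ≤ ρ / 4 := min_le_right _ _
  -- shadow the upper arc backward in time, from its end at the origin
  obtain ⟨R, hR⟩ := isCompact_Icc.exists_bound_of_continuousOn hcont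
  have hTm : T ∈ Icc (-τ₀) (T + τ₀) := ⟨by linarith, by linarith⟩
  obtain ⟨δ₁, hδ₁, hsh⟩ := exists_shadowing hV hTm (fun t ht => (hΓ₀ t ht).hasDerivWithinAt) hR hε₁0
  have hDc : Continuous fun z : (ℝ × ℝ) × (Fin (m .upper) → ℝ) =>
      φ .upper z.1 * ∏ i, (z.1.1 - z.2 i) - φ .upper z.1 * z.1.1 ^ m .upper := by
    have := (hφ .upper).continuous
    fun_prop
  have hD0 : ∀ p : ℝ × ℝ, (fun z : (ℝ × ℝ) × (Fin (m .upper) → ℝ) =>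
      φ .upper z.1 * ∏ i, (z.1.1 - z.2 i) - φ .upper z.1 * z.1.1 ^ m .upper) (p, 0) = 0 := fun p => by
    simp
  obtain ⟨δ₂, hδ₂, hD₂⟩ := exists_forall_abs_lt_of_compact
    (isCompact_closedBall (0 : ℝ × ℝ) (R + 2)) hDc (fun p _ => hD0 p) hδ₁
  obtain ⟨δ₃, hδ₃, hD₃⟩ := exists_forall_abs_lt_of_compact
    (isCompact_closedBall ((a, 0) : ℝ × ℝ) ρ) hDc (fun p _ => hD0 p) (half_pos hgP)
  set δ := min (min δ₁ δ₂) (min δ₃ (min (c' / 4) (-a / 4))) with hδ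
  have hδ0 : 0 < δ := by
    have : 0 < -a / 4 := by linarith
    positivity
  have hδa : δ ≤ δ₁ := (min_le_left _ _).trans (min_le_left _ _)
  have hδb : δ ≤ δ₂ := (min_le_left _ _).trans (min_le_right _ _)
  have hδc : δ ≤ δ₃ := (min_le_right _ _).trans (min_le_left _ _)
  have hδd : δ ≤ c' / 4 := (min_le_right _ _).trans ((min_le_right _ _).trans (min_le_left _ _))
  have hδe : δ ≤ -a / 4 := (min_le_right _ _).trans ((min_le_right _ _).trans (min_le_right _ _))
  refine ⟨τ, δ, hτ0, by linarith, hδ0, fun lam hlam z hz => ?_⟩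
  obtain ⟨Γ, hΓT, hΓ, hclose⟩ := hsh _ (contDiff_splitField (hf .upper) (hφ .upper) lam)
    (fun p hp => by
      rw [Prod.norm_def]
      refine max_le ?_ (hD₂ lam (hlam.trans hδb) p (mem_closedBall_zero_iff.2 hp)).le
      change ‖f .upper p - f .upper p‖ ≤ δ₁
      rw [sub_self, norm_zero]; exact hδ₁.le)
    z (by rw [hΓ0T, show z - ((0 : ℝ), (0 : ℝ)) = z from sub_zero z]; exact hz.trans hδa)
  have hclose : ∀ t ∈ Icc (-τ₀) (T + τ₀), dist (Γ t) (Γ₀ t) < ε₁ := fun t ht => by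
    rw [dist_eq_norm]; exact hclose t ht
  have hΓ : ∀ t ∈ Icc (-τ₀) (T + τ₀),
      HasDerivAt Γ (splitField (f .upper) (φ .upper) lam (Γ t)) t := hΓ
  have hΓc : ContinuousOn Γ (Icc (-τ₀) (T + τ₀)) := fun t ht =>
    (hΓ t ht).continuousAt.continuousWithinAt
  have hxσ : ∀ t ∈ Icc (-τ₀) (T + τ₀), |(Γ t).1 * σ - (Γ₀ t).1 * σ| ≤ c' / 4 := fun t ht => by
    rw [← sub_mul, abs_mul]
    refine le_trans (mul_le_mul_of_nonneg_right ?_ hσ0.le) hε₁b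
    exact (abs_fst_sub_le_dist _ _).trans (hclose t ht).le
  have hy : ∀ t ∈ Icc (-τ₀) (T + τ₀), |(Γ t).2 - (Γ₀ t).2| < c' / 4 := fun t ht =>
    ((abs_snd_sub_le_dist _ _).trans_lt (hclose t ht)).trans_le hε₁a
  refine ⟨Γ, hΓT, fun t ht => hΓ t ⟨by linarith [ht.1], by linarith [ht.2]⟩, ?_, ?_, ?_, ?_⟩
  · have := (abs_le.1 (hxσ (T - τ) (hmO _ ⟨le_rfl, by linarith⟩))).2
    rw [mul_comm]; linarith
  · have := (abs_le.1 (hxσ (T + τ) (hmO _ ⟨by linarith, le_rfl⟩))).1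
    rw [mul_comm]; linarith
  · intro t' ht' t ht htt
    have h0 : t ∈ Icc (-τ₀) (T + τ₀) := ⟨by linarith [ht.1], by linarith [ht.2]⟩
    have h1 := hclose t h0
    have h2 := hu₁ t h0 t' ⟨by linarith [ht'.1], by linarith [ht'.2]⟩ (htt.trans hτb)
    rw [hΓeq ht'] at h2
    have h3 := dist_triangle (Γ t) (Γ₀ t) (A.γ .upper t')
    linarith
  · intro ψ hψδ hψ0
    have hnP : ∀ t ∈ Icc (-τ) τ, dist (Γ t) (a, 0) < ρ := fun t ht => by
      have h1 := hclose t (hmP t ht)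
      have h2 := hnP₀ t ht
      have := dist_triangle (Γ t) (Γ₀ t) (a, 0)
      linarith
    have hψP : ∀ t ∈ Icc (-τ) τ, ∀ᶠ x in nhds (Γ t).1, ψ x = 0 := fun t ht => by
      have h1 := (abs_lt.1 ((abs_fst_sub_le_dist _ _).trans_lt (hnP t ht))).2
      have h2 : (Γ t).1 < -δ := by simp only at h1; linarith
      filter_upwards [Iio_mem_nhds h2] with x hx
      have hx : x < -δ := hx
      exact hψ0 x (by rw [abs_of_neg (by linarith)]; linarith)
    have hGpos : ∀ t ∈ Icc (-τ) τ, 0 < φ .upper (Γ t) * ∏ i, ((Γ t).1 - lam i) := fun t ht => by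
      have h1 := hD₃ lam (hlam.trans hδc) (Γ t) (Metric.mem_closedBall.2 (hnP t ht).le)
      have h2 : |φ .upper (Γ t) * (Γ t).1 ^ m .upper - gP| < |gP| / 2 :=
        hb₂ (Γ t) ((hnP t ht).trans_le hρb)
      rw [abs_of_pos hgP, abs_lt] at h2
      have h1 := (abs_lt.1 h1).1
      simp only at h1
      linarith
    have hym : StrictMonoOn (fun t => (Γ t).2 * 1) (Icc (-τ) τ) :=
      strictMonoOn_of_deriv_mul_pos
        (x' := fun t => φ .upper (Γ t) * ∏ i, ((Γ t).1 - lam i))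
        (fun t ht => (HasDerivAt.snd_prod (hΓ t (hmP t ht))).hasDerivWithinAt)
        (fun t ht => by rw [mul_one]; exact hGpos t (Ioo_subset_Icc_self ht))
    have e1 := (abs_lt.1 (hy (-τ) (hmP _ ⟨le_rfl, by linarith⟩))).2
    have e2 := (abs_lt.1 (hy τ (hmP _ ⟨by linarith, le_rfl⟩))).1
    obtain ⟨ta, hta, hta0⟩ := intermediate_value_Ioo (f := fun t => (Γ t).2)
      (by linarith : -τ ≤ τ) ((continuous_snd.comp_continuousOn hΓc).mono hmP)
      (show (0 : ℝ) ∈ Ioo _ _ from ⟨by linarith, by linarith⟩)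
    have hta' := Ioo_subset_Icc_self hta
    refine ⟨ta, hta, hta0, hψP ta hta', hGpos ta hta', fun t ht => ?_⟩
    rcases le_total t τ with h | h
    · have htm : t ∈ Icc (-τ) τ := ⟨by linarith [ht.1, hta.1], h⟩
      have := hym hta' htm ht.1
      rw [(hψP t htm).self_of_nhds]
      simp only [hta0, mul_one] at this
      exact this
    · have g1 := hc t ⟨h, ht.2⟩
      have g2 := (abs_lt.1 (hy t ⟨by linarith, by linarith [ht.2]⟩)).1
      have g3 := (abs_le.1 (hψδ (Γ t).1)).2
      linarith

/-! ### Parameters for the two sides, and contact with a deformed switching line -/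

/-- The family with value `u` on the upper and `l` on the lower side. -/
def bySide {β : Side → Type*} (u : β .upper) (l : β .lower) : ∀ s, β s
  | .upper => u
  | .lower => l

/-- Parameters with `d = 1` and unordered knots, for which `ψ` is the step `κ h^*(x, r₁, r₂)`. -/
def stepParam (κ : ℝ) (i : Fin (3 * 1 + 1)) : ℝ := if (i : ℕ) = 3 then κ else 0

theorem psi_stepParam (κ r₁ r₂ : ℝ) (h : 0 < 1) :
    psi 1 h r₁ r₂ (stepParam κ) = fun x => κ * cutUp x r₁ r₂ := by
  funext x
  have hk : stepParam κ ∉ paramK 1 := fun hk => by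
    have := hk ⟨0, by omega⟩
    simp [stepParam] at this
  rw [psi, if_neg hk]
  simp [stepParam]

theorem norm_stepParam_le (κ : ℝ) : ‖stepParam κ‖ ≤ |κ| := by
  refine (pi_norm_le_iff_of_nonneg (abs_nonneg _)).2 fun i => ?_
  rw [stepParam]
  split_ifs
  · exact le_rfl
  · simp

/-- The unfolded subsystem on one side depends continuously, in the `C^1` distance, on `λ` and, in
the `C^2` norm, on `ψ`. -/
theorem exists_unfolding_side_le {U : Set (ℝ × ℝ)} (hU : Bornology.IsBounded U)
    {f φ : Side → ℝ × ℝ → ℝ} {m : Side → ℕ} (hf : ∀ s, ContDiff ℝ ∞ (f s))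
    (hφ : ∀ s, ContDiff ℝ ∞ (φ s)) (s : Side) {ε : ℝ} (hε : 0 < ε) :
    ∃ δ : ℝ, 0 < δ ∧ ∀ (lam : (s : Side) → Fin (m s) → ℝ) (Ψ : Side → ℝ → ℝ),
      ContDiff ℝ ∞ (Ψ s) → (∀ x, |Ψ s x| ≤ δ) → (∀ x, |deriv (Ψ s) x| ≤ δ) →
      (∀ x, |deriv (deriv (Ψ s)) x| ≤ δ) → ‖lam s‖ ≤ δ →
      distC1 U ((baseSystem f φ m).f s) ((unfolding f φ m lam Ψ).f s) +
        distC1 U ((baseSystem f φ m).g s) ((unfolding f φ m lam Ψ).g s) ≤ ε := by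
  have hfs := hf s
  have hφs := hφ s
  have hsh : ContDiff ℝ ∞ fun z : (ℝ × ℝ) × (ℝ × ℝ × (Fin (m s) → ℝ)) => (z.1.1, z.1.2 + z.2.1) := by fun_prop
  have h1 : ContDiff ℝ ∞ fun z : (ℝ × ℝ) × (ℝ × ℝ × (Fin (m s) → ℝ)) => f s (z.1.1, z.1.2 + z.2.1) :=
    hfs.comp hsh
  have h2 : ContDiff ℝ ∞ fun z : (ℝ × ℝ) × (ℝ × ℝ × (Fin (m s) → ℝ)) =>
      φ s (z.1.1, z.1.2 + z.2.1) * ∏ i, (z.1.1 - z.2.2.2 i)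
        - f s (z.1.1, z.1.2 + z.2.1) * z.2.2.1 := by
    refine ((hφs.comp hsh).mul (contDiff_prod fun i _ => ?_)).sub (h1.mul (by fun_prop))
    have : ContDiff ℝ ∞ fun z : (ℝ × ℝ) × (ℝ × ℝ × (Fin (m s) → ℝ)) => z.2.2.2 := by fun_prop
    exact (by fun_prop : ContDiff ℝ ∞ fun z : (ℝ × ℝ) × (ℝ × ℝ × (Fin (m s) → ℝ)) => z.1.1).sub
      ((contDiff_pi.1 this) i)
  obtain ⟨δ₁, hδ₁, H₁⟩ := exists_distC1_le hU h1 (half_pos hε)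
  obtain ⟨δ₂, hδ₂, H₂⟩ := exists_distC1_le hU h2 (half_pos hε)
  refine ⟨min δ₁ δ₂, by positivity, fun lam Ψ hΨ e0 e1 e2 el => ?_⟩
  have k1 := H₁ (Ψ s) hΨ (fun x => (e0 x).trans (min_le_left _ _))
    (fun x => (e1 x).trans (min_le_left _ _)) (fun x => (e2 x).trans (min_le_left _ _)) (lam s)
    (el.trans (min_le_left _ _))
  have k2 := H₂ (Ψ s) hΨ (fun x => (e0 x).trans (min_le_right _ _))
    (fun x => (e1 x).trans (min_le_right _ _)) (fun x => (e2 x).trans (min_le_right _ _)) (lam s)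
    (el.trans (min_le_right _ _))
  simp only [Prod.fst_zero, Prod.snd_zero, Pi.zero_apply, add_zero, sub_zero, mul_zero,
    Finset.prod_const, Finset.card_univ, Fintype.card_fin] at k1 k2
  have h3 : ε / 2 + ε / 2 = ε := by ring
  rw [← h3]
  exact add_le_add k1 k2

theorem smooth_unfolding {f φ : Side → ℝ × ℝ → ℝ} {m : Side → ℕ}
    (hf : ∀ s, ContDiff ℝ ∞ (f s)) (hφ : ∀ s, ContDiff ℝ ∞ (φ s))
    {lam : (s : Side) → Fin (m s) → ℝ} {Ψ : Side → ℝ → ℝ} (hΨ : ∀ s, ContDiff ℝ ∞ (Ψ s)) :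
    (unfolding f φ m lam Ψ).Smooth := by
  intro s
  have h0 : ContDiff ℝ ∞ fun p : ℝ × ℝ => Ψ s p.1 := (hΨ s).comp contDiff_fst
  have h1 : ContDiff ℝ ∞ fun p : ℝ × ℝ => (p.1, p.2 + Ψ s p.1) :=
    contDiff_fst.prodMk (contDiff_snd.add h0)
  have h2 : ContDiff ℝ ∞ (deriv (Ψ s)) := by
    have : ContDiff ℝ (∞ + 1) (Ψ s) := hΨ s
    exact (contDiff_succ_iff_deriv.1 this).2.2
  exact ⟨(hf s).comp h1, (((hφ s).comp h1).mul
    (contDiff_prod fun i _ => contDiff_fst.sub contDiff_const)).sub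
    (((hf s).comp h1).mul (h2.comp contDiff_fst))⟩

/-- An orbit `Γ` that stays on or above the graph of `ψ` from time `t₁` on until its last contact
with the graph, and has contact exactly at the times `s 0 < … < s n`, all before `t₂`. -/
structure Touches (ψ : ℝ → ℝ) (Γ : ℝ → ℝ × ℝ) (t₁ t₂ : ℝ) {n : ℕ} (s : Fin (n + 1) → ℝ) :
    Prop where
  mono : StrictMono s
  mem : ∀ i, s i ∈ Ioo t₁ t₂
  le : ∀ t ∈ Icc t₁ (s (Fin.last n)), ψ (Γ t).1 ≤ (Γ t).2
  eq_iff : ∀ t ∈ Icc t₁ (s (Fin.last n)), (Γ t).2 = ψ (Γ t).1 ↔ t ∈ range s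

/-- Every contact but the last one is tangential. -/
theorem Touches.deriv_eq_zero {ψ : ℝ → ℝ} {Γ : ℝ → ℝ × ℝ} {t₁ t₂ : ℝ} {n : ℕ}
    {s : Fin (n + 1) → ℝ} (h : Touches ψ Γ t₁ t₂ s) {i : Fin (n + 1)} (hi : i ≠ Fin.last n)
    {y' : ℝ} (hy : HasDerivAt (fun t => (Γ t).2 - ψ (Γ t).1) y' (s i)) : y' = 0 := by
  have hlt : s i < s (Fin.last n) := h.mono (Fin.lt_last_iff_ne_last.2 hi)
  refine IsLocalMin.hasDerivAt_eq_zero ?_ hy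
  have h0 : (Γ (s i)).2 = ψ (Γ (s i)).1 := (h.eq_iff _ ⟨(h.mem i).1.le, hlt.le⟩).2 ⟨i, rfl⟩
  filter_upwards [Icc_mem_nhds (h.mem i).1 hlt] with t ht
  rw [h0, sub_self]
  exact sub_nonneg.2 (h.le t ht)

/-! ### Closing up the perturbed loop -/

set_option maxHeartbeats 2000000 in
/-- Closing up: every configuration of contacts near the origin between an upper orbit and a
deformed switching line is realized by a loop of the unfolding close to the given one. -/
theorem Arcs.exists_loop {f φ : Side → ℝ × ℝ → ℝ} {m : Side → ℕ} {U : Set (ℝ × ℝ)} {a : ℝ}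
    (A : Arcs (baseSystem f φ m) U a) (hUo : IsOpen U) (hUb : Bornology.IsBounded U)
    (hU0 : ((0 : ℝ), (0 : ℝ)) ∈ U) (hf : ∀ s, ContDiff ℝ ∞ (f s)) (hφ : ∀ s, ContDiff ℝ ∞ (φ s))
    (hf0 : ∀ s, f s (0, 0) ≠ 0) (hφ0 : ∀ s, φ s (0, 0) ≠ 0)
    {σ : ℝ} (hσ : 0 < σ * f .upper (0, 0))
    {r₁ r₂ : ℝ} (har : a < r₁) (hr : r₁ < r₂) (hr0 : r₂ < 0) (hr1 : r₂ - r₁ ≤ 1)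
    {ε : ℝ} (hε : 0 < ε) :
    ∃ t₁ t₀ t₂ δ : ℝ, t₁ < t₀ ∧ t₀ < t₂ ∧ 0 < δ ∧ ∀ lam : Fin (m .upper) → ℝ, ‖lam‖ ≤ δ →
      ∀ z : ℝ × ℝ, ‖z‖ ≤ δ → ∃ Γ : ℝ → ℝ × ℝ, Γ t₀ = z ∧
        (∀ t ∈ Icc t₁ t₂, HasDerivAt Γ (splitField (f .upper) (φ .upper) lam (Γ t)) t) ∧
        (∀ t ∈ Icc t₁ t₂, dist (Γ t) (0, 0) < ε) ∧
        σ * (Γ t₁).1 < -δ ∧ δ < σ * (Γ t₂).1 ∧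
        ∀ ψ : ℝ → ℝ, ContDiff ℝ ∞ ψ → (∀ x, |ψ x| ≤ δ) → (∀ x, |deriv ψ x| ≤ δ) →
          (∀ x, |deriv (deriv ψ) x| ≤ δ) → (∀ x, δ ≤ |x| → ψ x = 0) →
        ∀ (n : ℕ) (s : Fin (n + 1) → ℝ), Touches ψ Γ t₁ t₂ s →
          |(Γ (s (Fin.last n))).1| < δ → 0 < f .lower (0, 0) * (Γ (s (Fin.last n))).1 →
        ∃ (κ : ℝ) (S : PWS), |κ| < ε ∧
          S = unfolding f φ m (bySide lam 0) (bySide ψ fun x => κ * cutUp x r₁ r₂) ∧ S.Smooth ∧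
          rho U (baseSystem f φ m) S < ε ∧ ∃ L : Loop S U,
            L.carrier ⊆ Metric.thickening ε A.carrier ∧
            A.carrier ⊆ Metric.thickening ε L.carrier ∧
            L.tangentPoints ⊆ Metric.ball (0, 0) ε ∧
            ∀ D, HasDerivAt (fun t => (Γ t).2 - ψ (Γ t).1) D (s (Fin.last n)) →
            (D < 0 → 0 < n → L.IsCro ∧ L.tangentPoints.encard = n) ∧
            (D = 0 → L.IsCri ∧ L.tangentPoints.encard = (n + 1 : ℕ)) := by
  obtain ⟨εU, hεU, hU⟩ := A.exists_dist_lt_mem hUo hU0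
  have hsign := A.lower_sign (hφ .lower).continuous (hf0 .lower) (hφ0 .lower)
  have hgP := A.speed_pos .lower
  have ha := A.neg
  have hBs := contDiff_baseSystem (m := m) hf hφ
  obtain ⟨ρ₁, hρ₁, hb₁⟩ := exists_ball_abs_sub_lt (hf .upper).continuous (hf0 .upper)
  obtain ⟨ρ₂, hρ₂, hb₂⟩ := exists_ball_abs_sub_lt (hf .lower).continuous (hf0 .lower)
  obtain ⟨ρ₃, hρ₃, hb₃⟩ := exists_ball_abs_sub_lt (hφ .lower).continuous (hφ0 .lower)
  obtain ⟨ρ₄, hρ₄, hb₄⟩ := exists_ball_abs_sub_lt (hBs .lower).2.continuous hgP.ne'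
  obtain ⟨δu, hδu, Hu⟩ := exists_unfolding_side_le hUb (m := m) hf hφ .upper
    (show 0 < ε / 4 by positivity)
  obtain ⟨δl, hδl, Hl⟩ := exists_unfolding_side_le hUb (m := m) hf hφ .lower
    (show 0 < ε / 4 by positivity)
  obtain ⟨M, hM0, hM1, hM2⟩ : ∃ M : ℝ, 1 ≤ M ∧ (∀ x, |deriv (fun x => cutUp x r₁ r₂) x| ≤ M) ∧
      ∀ x, |deriv (deriv fun x => cutUp x r₁ r₂) x| ≤ M :=
    ⟨max 1 (max (2560 / (r₂ - r₁) ^ 2) (2560 / (r₂ - r₁) ^ 4)), le_max_left _ _,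
      fun x => (abs_deriv_cutUp_le hr hr1 x).1.trans ((le_max_left _ _).trans (le_max_right _ _)),
      fun x => (abs_deriv_cutUp_le hr hr1 x).2.trans ((le_max_right _ _).trans (le_max_right _ _))⟩
  -- `ρ` bounds all distances
  set ρ := min (min (min ρ₁ ρ₂) (min ρ₃ ρ₄)) (min (min ε εU) (min (r₁ - a) (-r₂))) / 2 with hρ
  have hρ0 : 0 < ρ := by
    have : 0 < r₁ - a := by linarith
    have : 0 < -r₂ := by linarith
    positivity
  have h2ρ : 2 * ρ = min (min (min ρ₁ ρ₂) (min ρ₃ ρ₄)) (min (min ε εU) (min (r₁ - a) (-r₂))) := by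
    rw [hρ]; ring
  have hρa : 2 * ρ ≤ ρ₁ := h2ρ.trans_le
    ((min_le_left _ _).trans ((min_le_left _ _).trans (min_le_left _ _)))
  have hρb : 2 * ρ ≤ ρ₂ := h2ρ.trans_le
    ((min_le_left _ _).trans ((min_le_left _ _).trans (min_le_right _ _)))
  have hρc : 2 * ρ ≤ ρ₃ := h2ρ.trans_le
    ((min_le_left _ _).trans ((min_le_right _ _).trans (min_le_left _ _)))
  have hρd : 2 * ρ ≤ ρ₄ := h2ρ.trans_le
    ((min_le_left _ _).trans ((min_le_right _ _).trans (min_le_right _ _)))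
  have hρe : 2 * ρ ≤ ε := h2ρ.trans_le
    ((min_le_right _ _).trans ((min_le_left _ _).trans (min_le_left _ _)))
  have hρf : 2 * ρ ≤ εU := h2ρ.trans_le
    ((min_le_right _ _).trans ((min_le_left _ _).trans (min_le_right _ _)))
  have hρg : 2 * ρ ≤ r₁ - a := h2ρ.trans_le
    ((min_le_right _ _).trans ((min_le_right _ _).trans (min_le_left _ _)))
  have hρh : 2 * ρ ≤ -r₂ := h2ρ.trans_le
    ((min_le_right _ _).trans ((min_le_right _ _).trans (min_le_right _ _)))
  -- the tolerances: the lower arc joins up whatever the upper arc does within `δA`, and the step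
  -- `κ` it needs is small enough in `C^2` for the distance of the systems
  obtain ⟨δA, hδA, HA⟩ := A.exists_lower_return hUo hU0 hf hφ (hf0 .lower) (hφ0 .lower) har hr hr0
    (show 0 < min ρ (δl / M) by positivity)
  obtain ⟨τ, δB, hτ0, hτT, hδB, HB⟩ := A.exists_upper_approach hf hφ hσ
    (show 0 < min ρ δA by positivity)
  set T := A.T .upper with hT
  have hT0 : 0 < T := A.T_pos .upper
  set δ := min (min δA δB) (min δu ρ) with hδ
  have hδ0 : 0 < δ := by positivity
  have hδa : δ ≤ δA := (min_le_left _ _).trans (min_le_left _ _)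
  have hδb : δ ≤ δB := (min_le_left _ _).trans (min_le_right _ _)
  have hδc : δ ≤ δu := (min_le_right _ _).trans (min_le_left _ _)
  have hδd : δ ≤ ρ := (min_le_right _ _).trans (min_le_right _ _)
  refine ⟨T - τ, T, T + τ, δ, by linarith, by linarith, hδ0, fun lam hlam z hz => ?_⟩
  obtain ⟨Γ, hΓT, hΓ, hxl, hxr, hclose, Happ⟩ := HB lam (hlam.trans hδb) z (hz.trans hδb)
  have hΓO : ∀ t ∈ Icc (T - τ) (T + τ), dist (Γ t) (0, 0) < ρ := fun t ht => by
    have := hclose T ⟨hT0.le, le_rfl⟩ t ⟨by linarith [ht.1], by linarith [ht.2]⟩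
      (by rw [abs_le]; constructor <;> linarith [ht.1, ht.2])
    rw [hT, A.upper_end] at this
    exact this.trans_le (min_le_left _ _)
  refine ⟨Γ, hΓT, fun t ht => hΓ t ⟨by linarith [ht.1], by linarith [ht.2]⟩,
    fun t ht => (hΓO t ht).trans_le (by linarith), by linarith, by linarith, ?_⟩
  intro ψ hψs hψ0 hψ1 hψ2 hψsupp n s hs hqδ hqf
  obtain ⟨ta, hta, hta0, hψta, hgta, habove⟩ := Happ ψ (fun x => (hψ0 x).trans hδb)
    (fun x hx => hψsupp x (hδb.trans hx))
  set e := s (Fin.last n) with he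
  have he' := hs.mem (Fin.last n)
  have hxta : dist (Γ ta) (a, 0) < min ρ δA := by
    have := hclose 0 ⟨le_rfl, hT0.le⟩ ta ⟨hta.1.le, by linarith [hta.2]⟩
      (by rw [sub_zero, abs_le]; exact ⟨hta.1.le, hta.2.le⟩)
    rwa [A.upper_start] at this
  have hpa : |(Γ ta).1 - a| < min ρ δA := (abs_fst_sub_le_dist (Γ ta) (a, 0)).trans_lt hxta
  obtain ⟨κ, Tl, γl, hκ, hTl, hl0, hlT, hlorb, hlin, hlc1, hlc2⟩ := HA (Γ ta).1 (Γ e).1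
    (hpa.trans_le (min_le_right _ _)) (hqδ.trans_le hδa) hqf
  have hκρ : |κ| < ρ := hκ.trans_le (min_le_left _ _)
  have hκM : |κ| * M ≤ δl := by
    have := hκ.le.trans (min_le_right _ _)
    rwa [le_div_iff₀ (by linarith)] at this
  -- the deformation of the lower switching line: zero near `P` and `κ` near the origin
  set χ : ℝ → ℝ := fun x => κ * cutUp x r₁ r₂ with hχ
  have hcuts := contDiff_cutUp hr
  have hχs : ContDiff ℝ ∞ χ := contDiff_const.mul hcuts
  have hcutd : Differentiable ℝ (fun x => cutUp x r₁ r₂) := hcuts.differentiable (by simp)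
  have hχ1 : deriv χ = fun x => κ * deriv (fun x => cutUp x r₁ r₂) x := by
    funext x; exact deriv_const_mul κ (hcutd x)
  have hχ2 : ∀ x, deriv (deriv χ) x = κ * deriv (deriv fun x => cutUp x r₁ r₂) x := fun x => by
    rw [hχ1]
    have h2 : ContDiff ℝ ∞ (deriv fun x => cutUp x r₁ r₂) := by
      have : ContDiff ℝ (∞ + 1) fun x => cutUp x r₁ r₂ := hcuts
      exact (contDiff_succ_iff_deriv.1 this).2.2
    exact deriv_const_mul κ ((h2.differentiable (by simp)) x)
  have hκb : ∀ v : ℝ, |v| ≤ M → |κ * v| ≤ δl := fun v hv => by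
    rw [abs_mul]
    exact (mul_le_mul_of_nonneg_left hv (abs_nonneg _)).trans hκM
  let S := unfolding f φ m (bySide lam 0) (bySide ψ χ)
  have hS : S.Smooth := smooth_unfolding hf hφ fun s => by
    cases s
    · exact hψs
    · exact hχs
  have hrho : rho U (baseSystem f φ m) S < ε := by
    have k1 := Hu (bySide lam 0) (bySide ψ χ) hψs (fun x => (hψ0 x).trans hδc)
      (fun x => (hψ1 x).trans hδc) (fun x => (hψ2 x).trans hδc) (hlam.trans hδc)
    have k2 := Hl (bySide lam 0) (bySide ψ χ) hχs
      (fun x => hκb _ (by rw [abs_of_nonneg (cutUp_nonneg _ _ _)]; exact (cutUp_le_one _ _ _).trans hM0))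
      (fun x => by change |deriv χ x| ≤ δl; rw [hχ1]; exact hκb _ (hM1 x))
      (fun x => by change |deriv (deriv χ) x| ≤ δl; rw [hχ2]; exact hκb _ (hM2 x))
      (by change ‖(0 : Fin (m .lower) → ℝ)‖ ≤ δl; rw [norm_zero]; exact hδl.le)
    unfold rho
    linarith
  -- the upper orbit in the coordinates of the unfolding
  set γ : ℝ → ℝ × ℝ := fun t => ((Γ t).1, (Γ t).2 - ψ (Γ t).1) with hγ
  have hψd : Differentiable ℝ ψ := hψs.differentiable (by simp)
  have hback : ∀ t, ((γ t).1, (γ t).2 + ψ (γ t).1) = Γ t := fun t => by simp [hγ]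
  have hSg : ∀ t, S.g .upper (γ t) = φ .upper (Γ t) * ∏ i, ((Γ t).1 - lam i) -
      f .upper (Γ t) * deriv ψ (Γ t).1 := fun t => by
    rw [← hback t]; rfl
  have hSf : ∀ t, S.f .upper (γ t) = f .upper (Γ t) := fun t => by rw [← hback t]; rfl
  have hγd : ∀ t ∈ Icc (-τ) (T + τ), HasDerivAt γ (S.field .upper (γ t)) t := fun t ht => by
    have := hasDerivAt_shear (F := f .upper) (G := fun p => φ .upper p * ∏ i, (p.1 - lam i))
      (hψd _) (hΓ t ht)
    rw [PWS.field, hSf, hSg]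
    exact this
  have hγΓ : ∀ t, dist (γ t) (Γ t) ≤ ρ := fun t => by
    rw [Prod.dist_eq]
    refine max_le (by simp [hγ, hρ0.le]) ?_
    simp only [hγ, Real.dist_eq, sub_sub_cancel_left, abs_neg]
    exact (hψ0 _).trans hδd
  have hγA : ∀ t' ∈ Icc 0 T, ∀ t ∈ Icc (-τ) (T + τ), |t - t'| ≤ τ →
      dist (γ t) (A.γ .upper t') < 2 * ρ := fun t' ht' t ht htt => by
    have k1 := (hclose t' ht' t ht htt).trans_le (min_le_left _ _)
    have k2 := hγΓ t
    have k3 := dist_triangle (γ t) (Γ t) (A.γ .upper t')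
    linarith
  have hseg : ∀ t ∈ Icc ta e, t ∈ Icc (-τ) (T + τ) := fun t ht =>
    ⟨by linarith [ht.1, hta.1], by linarith [ht.2, he'.2]⟩
  have htab : |ta - 0| ≤ τ := by rw [sub_zero, abs_le]; exact ⟨hta.1.le, hta.2.le⟩
  have heb : |e - T| ≤ τ := by rw [abs_le]; constructor <;> linarith [he'.1, he'.2]
  have hclamp : ∀ t ∈ Icc ta e, ∃ t' ∈ Icc 0 T, |t - t'| ≤ τ := fun t ht =>
    exists_mem_Icc_abs_sub_le hT0.le htab heb ht hτ0.le
  have hta_lt : ∀ i, ta < s i := fun i => by linarith [hta.2, (hs.mem i).1]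
  have hs_le : ∀ i, s i ≤ e := fun i => hs.mono.monotone (Fin.le_last i)
  have hγta : γ ta = ((Γ ta).1, 0) := by
    simp only [hγ, hta0, hψta.self_of_nhds, sub_zero]
  have hcontact : ∀ i, γ (s i) = ((Γ (s i)).1, 0) := fun i => by
    have := (hs.eq_iff (s i) ⟨(hs.mem i).1.le, hs_le i⟩).2 ⟨i, rfl⟩
    simp only [hγ, this, sub_self]
  have hx_contact : ∀ i, |(Γ (s i)).1| < ρ := fun i => by
    have := (abs_fst_sub_le_dist _ _).trans_lt (hΓO (s i) (Ioo_subset_Icc_self (hs.mem i)))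
    simpa using this
  have hxpta := abs_lt.1 (hpa.trans_le (min_le_left _ _))
  let s' : Fin (n + 2) → ℝ := Fin.cons ta s
  have hs'0 : s' 0 = ta := rfl
  have hs's : ∀ i, s' (Fin.succ i) = s i := fun i => Fin.cons_succ _ _ _
  have hs'l : s' (Fin.last (n + 1)) = e := by rw [← Fin.succ_last, hs's]
  have hposlt : ∀ t ∈ Ioc ta (T - τ), 0 < (γ t).2 := fun t ht => sub_pos.2 (habove t ht)
  -- the contact times are preceded by the time `ta` of the crossing near `P`
  let D : LoopData S U (n + 1) :=
    { s := s'
      γ := γ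
      T := Tl
      γl := γl
      N_pos := Nat.succ_pos n
      T_pos := hTl
      mono := by
        intro i j hij
        induction i using Fin.cases with
        | zero =>
          induction j using Fin.cases with
          | zero => exact absurd hij (lt_irrefl _)
          | succ j => rw [hs'0, hs's]; exact hta_lt j
        | succ i =>
          induction j using Fin.cases with
          | zero => exact absurd hij (Fin.not_lt_zero _)
          | succ j => rw [hs's, hs's]; exact hs.mono (Fin.succ_lt_succ_iff.1 hij)
      orbit := by
        rw [hs'0, hs'l]
        exact fun t ht => (hγd t (hseg t ht)).hasDerivWithinAt
      orbitl := fun t ht => by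
        have := hlorb t ht
        have k : S.field .lower (γl t) = (f .lower ((γl t).1, (γl t).2 + κ * cutUp (γl t).1 r₁ r₂),
            φ .lower ((γl t).1, (γl t).2 + κ * cutUp (γl t).1 r₁ r₂) * (γl t).1 ^ m .lower -
            f .lower ((γl t).1, (γl t).2 + κ * cutUp (γl t).1 r₁ r₂) *
              deriv (fun x => κ * cutUp x r₁ r₂) (γl t).1) := by
          simp only [PWS.field, S, unfolding, bySide, Pi.zero_apply, sub_zero, Finset.prod_const,
            Finset.card_univ, Fintype.card_fin, hχ]
        rw [k]; exact this
      mem := by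
        rw [hs'0, hs'l]
        intro t ht
        obtain ⟨t', ht', htt⟩ := hclamp t ht
        exact hU .upper t' ht' _ ((hγA t' ht' t (hseg t ht) htt).trans_le hρf)
      nonneg := by
        rw [hs'0, hs'l]
        intro t ht
        rcases eq_or_lt_of_le ht.1 with h | h
        · rw [← h, hγta]
        rcases le_total t (T - τ) with h' | h'
        · exact (hposlt t ⟨h, h'⟩).le
        · exact sub_nonneg.2 (hs.le t ⟨h', ht.2⟩)
      zero_iff := by
        rw [hs'0, hs'l]
        intro t ht
        have hrange : t ∈ range s' ↔ t = ta ∨ t ∈ range s := by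
          constructor
          · rintro ⟨i, rfl⟩
            induction i using Fin.cases with
            | zero => left; rfl
            | succ i => right; exact ⟨i, (hs's i).symm⟩
          · rintro (rfl | ⟨i, rfl⟩)
            · exact ⟨0, hs'0⟩
            · exact ⟨i.succ, hs's i⟩
        rw [hrange]
        rcases eq_or_lt_of_le ht.1 with h | h
        · rw [← h, hγta]; simp
        rcases le_total t (T - τ) with h' | h'
        · have h1 := hposlt t ⟨h, h'⟩
          constructor
          · intro h2; rw [h2] at h1; exact absurd h1 (lt_irrefl _)
          · rintro (h2 | ⟨i, rfl⟩)
            · exact absurd h2 h.ne'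
            · exact absurd (hs.mem i).1 (not_lt.2 h')
        · rw [show (γ t).2 = (Γ t).2 - ψ (Γ t).1 from rfl, sub_eq_zero, hs.eq_iff t ⟨h', ht.2⟩]
          constructor
          · exact Or.inr
          · rintro (h2 | h2)
            · exact absurd h2 h.ne'
            · exact h2
      ne_start := by
        intro i hi heq
        induction i using Fin.cases with
        | zero => exact hi rfl
        | succ i =>
          rw [hs's, hs'0, hγta, hcontact] at heq
          have k1 := congrArg Prod.fst heq
          have k2 := abs_lt.1 (hx_contact i)
          simp only at k1
          linarith
      insidel := hlin
      startl := by rw [hs'l, hl0, he, hcontact]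
      stopl := by rw [hs'0, hlT, hγta] }
  have hcar : (D.toLoop hS).carrier = γ '' Icc ta e ∪ γl '' Icc 0 Tl := by
    rw [D.carrier_toLoop hS]
    change γ '' Icc (s' 0) (s' (Fin.last (n + 1))) ∪ _ = _
    rw [hs'0, hs'l]
  have hmemA : ∀ s, ∀ t ∈ Icc 0 (A.T s), A.γ s t ∈ A.carrier := fun s t ht =>
    mem_iUnion.2 ⟨s, t, ht, rfl⟩
  -- the two switching points
  have hlamlow : ∀ x : ℝ, ∏ i, (x - (bySide lam 0 : (s : Side) → Fin (m s) → ℝ) .lower i) =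
      x ^ m .lower := fun x => by simp [bySide]
  have hPg : S.g .lower (γ ta) = (baseSystem f φ m).g .lower ((Γ ta).1, 0) := by
    have hev : χ =ᶠ[nhds (Γ ta).1] fun _ => 0 := by
      have h1 : (Γ ta).1 < r₁ := by linarith [hxpta.2]
      filter_upwards [Iio_mem_nhds h1] with x hx
      simp only [hχ, cutUp_of_le (le_of_lt hx), mul_zero]
    have k : S.g .lower (γ ta) = φ .lower ((γ ta).1, (γ ta).2 + χ (γ ta).1) *
      ∏ i, ((γ ta).1 - (bySide lam 0 : (s : Side) → Fin (m s) → ℝ) .lower i) -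
      f .lower ((γ ta).1, (γ ta).2 + χ (γ ta).1) * deriv χ (γ ta).1 := rfl
    rw [k, hγta, hlamlow]
    simp only
    rw [hev.deriv_eq, deriv_const, hev.eq_of_nhds, add_zero, mul_zero, sub_zero]
    rfl
  have hPcross : γ ta ∈ S.crossing U := by
    refine ⟨D.contact_mem 0, mul_pos ?_ ?_⟩
    · rw [hSg, Filter.EventuallyEq.deriv_eq (f₁ := ψ) (f := fun _ => 0) hψta, deriv_const, mul_zero,
        sub_zero]
      exact hgta
    · rw [hPg]
      have := mul_pos_of_abs_sub_lt (hb₄ ((Γ ta).1, 0) (by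
        rw [Prod.dist_eq]
        exact max_lt (by rw [Real.dist_eq]; linarith [hpa.trans_le (min_le_left _ _)])
          (by rw [dist_self]; exact hρ₄))) (by rw [sub_self, abs_zero]; have := abs_pos.2 hgP.ne'; positivity)
      exact (mul_pos_iff_of_pos_right hgP).1 this
  have hlow : ∀ i, S.f .lower (γ (s i)) = f .lower ((Γ (s i)).1, κ) ∧
      S.g .lower (γ (s i)) = φ .lower ((Γ (s i)).1, κ) * (Γ (s i)).1 ^ m .lower := fun i => by
    have h1 : r₂ < (Γ (s i)).1 := by linarith [(abs_lt.1 (hx_contact i)).1]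
    have hev : χ =ᶠ[nhds (Γ (s i)).1] fun _ => κ := by
      filter_upwards [Ioi_mem_nhds h1] with x hx
      simp only [hχ, cutUp_of_ge hr (le_of_lt hx), mul_one]
    have k : S.f .lower (γ (s i)) = f .lower ((γ (s i)).1, (γ (s i)).2 + χ (γ (s i)).1) := rfl
    have k' : S.g .lower (γ (s i)) = φ .lower ((γ (s i)).1, (γ (s i)).2 + χ (γ (s i)).1) *
      ∏ j, ((γ (s i)).1 - (bySide lam 0 : (s : Side) → Fin (m s) → ℝ) .lower j) -
      f .lower ((γ (s i)).1, (γ (s i)).2 + χ (γ (s i)).1) * deriv χ (γ (s i)).1 := rfl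
    rw [k, k', hcontact, hlamlow]
    simp only
    rw [hev.deriv_eq, deriv_const, hev.eq_of_nhds, zero_add, mul_zero, sub_zero]
    exact ⟨rfl, rfl⟩
  have hdist : ∀ i, dist ((Γ (s i)).1, κ) ((0, 0) : ℝ × ℝ) < 2 * ρ := fun i => by
    rw [Prod.dist_eq]
    exact max_lt (by rw [Real.dist_eq, sub_zero]; linarith [hx_contact i])
      (by rw [Real.dist_eq, sub_zero]; linarith)
  have hself : ∀ u v : ℝ, v ≠ 0 → |u - u| < |v| / 2 := fun u v hv => by
    rw [sub_self, abs_zero]; have := abs_pos.2 hv; positivity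
  have hQg : S.g .lower (γ e) < 0 := by
    rw [he, (hlow _).2]
    have g2 := mul_pos_of_abs_sub_lt (hb₃ _ ((hdist (Fin.last n)).trans_le hρc)) (hself _ _ (hφ0 .lower))
    have g3 := mul_pos g2 (pow_pos hqf (m .lower))
    have g4 : (φ .lower ((Γ e).1, κ) * φ .lower (0, 0)) * (f .lower (0, 0) * (Γ e).1) ^ m .lower =
      (φ .lower ((Γ e).1, κ) * (Γ e).1 ^ m .lower) * (φ .lower (0, 0) * f .lower (0, 0) ^ m .lower) := by
      rw [mul_pow]; ring
    rw [g4] at g3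
    by_contra hn
    exact absurd (mul_nonpos_of_nonneg_of_nonpos (not_lt.1 hn) hsign.le) (not_le.2 g3)
  have hyd : ∀ i, HasDerivAt (fun t => (Γ t).2 - ψ (Γ t).1) (S.g .upper (γ (s i))) (s i) := fun i =>
    HasDerivAt.snd_prod (hγd (s i) (hseg _ ⟨(hta_lt i).le, hs_le i⟩))
  -- the horizontal speeds do not vanish near the origin
  have htan : ∀ i, S.g .upper (γ (s i)) = 0 → γ (s i) ∈ S.tangent U := fun i h => by
    refine ⟨?_, by rw [h, zero_mul], ?_, ?_⟩
    · have := D.contact_mem i.succ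
      change γ (s' i.succ) ∈ switchLine U at this
      rwa [hs's] at this
    · rw [hSf]
      intro h0
      have := mul_pos_of_abs_sub_lt (hb₁ (Γ (s i)) ((hΓO _ (Ioo_subset_Icc_self (hs.mem i))).trans_le
        (by linarith))) (hself _ _ (hf0 .upper))
      rw [h0, zero_mul] at this; exact lt_irrefl _ this
    · rw [(hlow i).1]
      intro h0
      have := mul_pos_of_abs_sub_lt (hb₂ _ ((hdist i).trans_le hρb)) (hself _ _ (hf0 .lower))
      rw [h0, zero_mul] at this; exact lt_irrefl _ this
  have hswitch : (D.toLoop hS).switchingPoints = {γ ta, γ e} := by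
    rw [D.switchingPoints_toLoop hS]
    change {γ (s' 0), γ (s' (Fin.last (n + 1)))} = _
    rw [hs'0, hs'l]
  have htp : (D.toLoop hS).tangentPoints = {p | p ∈ S.tangent U ∧ ∃ i, γ (s i) = p} := by
    rw [D.tangentPoints_toLoop hS]
    ext p
    constructor
    · rintro ⟨hp, i, hi⟩
      refine ⟨hp, ?_⟩
      change γ (s' i) = p at hi
      induction i using Fin.cases with
      | zero =>
        exfalso
        rw [hs'0] at hi
        have h1 := hPcross.2
        rw [hi, hp.2.1] at h1
        exact lt_irrefl _ h1
      | succ i => exact ⟨i, by rw [← hs's]; exact hi⟩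
    · rintro ⟨hp, i, rfl⟩
      exact ⟨hp, i.succ, by change γ (s' i.succ) = _; rw [hs's]⟩
  have hnons : ∀ i, γ (s i) ∈ S.tangent U → (D.toLoop hS).IsNonsliding := fun i hi =>
    D.isNonsliding_toLoop hS ⟨i.succ, by change γ (s' i.succ) ∈ S.tangent U; rwa [hs's]⟩
  have hinj : Function.Injective fun i => γ (s i) := fun i j h => by
    have hm : ∀ i, s i ∈ Icc (s' 0) (s' (Fin.last (n + 1))) := fun i => by
      rw [hs'0, hs'l]; exact ⟨(hta_lt i).le, hs_le i⟩
    exact hs.mono.injective (D.injOn hS (hm i) (hm j) h)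
  refine ⟨κ, S, by linarith, rfl, hS, hrho, D.toLoop hS, ?_, ?_, ?_, ?_⟩
  · rw [hcar]
    rintro p (⟨t, ht, rfl⟩ | ⟨t, ht, rfl⟩)
    · obtain ⟨t', ht', htt⟩ := hclamp t ht
      exact Metric.mem_thickening_iff.2 ⟨_, hmemA .upper t' ht',
        (hγA t' ht' t (hseg t ht) htt).trans_le hρe⟩
    · obtain ⟨t', ht', htt⟩ := hlc1 t ht
      exact Metric.mem_thickening_iff.2 ⟨_, hmemA .lower t' ht',
        htt.trans_le ((min_le_left _ _).trans (by linarith))⟩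
  · rw [hcar]
    intro p hp
    simp only [Arcs.carrier, mem_iUnion, mem_image] at hp
    obtain ⟨side, t', ht', rfl⟩ := hp
    cases side
    · obtain ⟨t, ht, htt⟩ := exists_mem_Icc_abs_sub_le (a := ta) (b := e) (a' := 0) (b' := T)
        (by linarith [hta.2, he'.1]) (by rw [abs_sub_comm]; exact htab)
        (by rw [abs_sub_comm]; exact heb) ht' hτ0.le
      refine Metric.mem_thickening_iff.2 ⟨γ t, Or.inl ⟨t, ht, rfl⟩, ?_⟩
      rw [dist_comm]
      exact (hγA t' ht' t (hseg t ht) (by rw [abs_sub_comm]; exact htt)).trans_le hρe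
    · obtain ⟨t, ht, htt⟩ := hlc2 t' ht'
      refine Metric.mem_thickening_iff.2 ⟨γl t, Or.inr ⟨t, ht, rfl⟩, ?_⟩
      rw [dist_comm]
      exact htt.trans_le ((min_le_left _ _).trans (by linarith))
  · rw [htp]
    rintro p ⟨-, i, rfl⟩
    rw [Metric.mem_ball, hcontact, Prod.dist_eq]
    exact max_lt (by rw [Real.dist_eq, sub_zero]; linarith [hx_contact i])
      (by rw [dist_self]; exact hε)
  · intro y' hy'
    have hy'' : y' = S.g .upper (γ e) := hy'.unique (hyd (Fin.last n))
    refine ⟨fun hneg hn => ?_, fun h0 => ?_⟩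
    · have hint : ∀ i, i ≠ Fin.last n → γ (s i) ∈ S.tangent U := fun i hi =>
        htan i (hs.deriv_eq_zero hi (hyd i))
      have hQcross : γ e ∈ S.crossing U := by
        refine ⟨?_, mul_pos_of_neg_of_neg (by rw [← hy'']; exact hneg) hQg⟩
        have := D.contact_mem (Fin.last (n + 1))
        change γ (s' (Fin.last (n + 1))) ∈ switchLine U at this
        rwa [hs'l] at this
      refine ⟨⟨hnons 0 (hint 0 fun h => ?_), ?_, ?_⟩, ?_⟩
      · have := congrArg Fin.val h
        simp at this; omega
      · rw [hswitch]; exact ⟨_, Or.inl rfl⟩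
      · rw [hswitch]
        rintro p (rfl | rfl)
        · exact hPcross
        · exact hQcross
      · have hset : (D.toLoop hS).tangentPoints = range fun i : Fin n => γ (s i.castSucc) := by
          rw [htp]
          ext p
          constructor
          · rintro ⟨hp, i, rfl⟩
            induction i using Fin.lastCases with
            | last =>
              exfalso
              have h1 := hQcross.2
              rw [hp.2.1] at h1
              exact lt_irrefl _ h1
            | cast i => exact ⟨i, rfl⟩
          · rintro ⟨i, rfl⟩
            exact ⟨hint _ (Fin.castSucc_ne_last i), _, rfl⟩
        have hinj' : Function.Injective fun i : Fin n => γ (s i.castSucc) :=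
          hinj.comp (Fin.castSucc_injective n)
        rw [hset, ← image_univ, hinj'.encard_image]
        simp
    · have hall : ∀ i, γ (s i) ∈ S.tangent U := fun i => by
        by_cases hi : i = Fin.last n
        · rw [hi]; exact htan _ (hy''.symm.trans h0)
        · exact htan i (hs.deriv_eq_zero hi (hyd i))
      refine ⟨⟨hnons 0 (hall 0), ?_, ?_⟩, ?_⟩
      · rw [hswitch]; exact ⟨_, Or.inl rfl⟩
      · rw [hswitch]
        refine ⟨γ e, Or.inr rfl, fun h => ?_⟩
        have h1 := h.2
        rw [← hy'', h0, zero_mul] at h1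
        exact lt_irrefl _ h1
      · have hset : (D.toLoop hS).tangentPoints = range fun i => γ (s i) := by
          rw [htp]
          ext p
          exact ⟨fun ⟨_, i, h⟩ => ⟨i, h⟩, fun ⟨i, h⟩ => ⟨h ▸ hall i, i, h⟩⟩
        rw [hset, ← image_univ, hinj.encard_image]
        simp

/-! ### Local orbits as graphs over the switching line -/

/-- An orbit whose `x`-coordinate moves in the direction `σ = ±1` is the graph of a function `y` of
`v = σ x`; `θ v` is the time at which the orbit is above `σ v`. -/
theorem exists_reparametrization {Γ : ℝ → ℝ × ℝ} {t₁ t₂ : ℝ} (h12 : t₁ < t₂) {σ : ℝ}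
    (hσ : σ = 1 ∨ σ = -1) {F G : ℝ × ℝ → ℝ}
    (hΓ : ∀ t ∈ Icc t₁ t₂, HasDerivAt Γ (F (Γ t), G (Γ t)) t) {f₀ : ℝ} (hf₀ : 0 < f₀)
    (hF : ∀ t ∈ Icc t₁ t₂, f₀ ≤ σ * F (Γ t)) :
    ∃ y θ : ℝ → ℝ, StrictMonoOn θ (Icc (σ * (Γ t₁).1) (σ * (Γ t₂).1)) ∧
      (∀ v ∈ Icc (σ * (Γ t₁).1) (σ * (Γ t₂).1), θ v ∈ Icc t₁ t₂ ∧ Γ (θ v) = (σ * v, y v)) ∧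
      (∀ t ∈ Icc t₁ t₂, σ * (Γ t).1 ∈ Icc (σ * (Γ t₁).1) (σ * (Γ t₂).1) ∧ θ (σ * (Γ t).1) = t) ∧
      ContinuousOn y (Icc (σ * (Γ t₁).1) (σ * (Γ t₂).1)) ∧
      ∀ v ∈ Ioo (σ * (Γ t₁).1) (σ * (Γ t₂).1),
        HasDerivAt y (G (σ * v, y v) / (σ * F (σ * v, y v))) v := by
  set u : ℝ → ℝ := fun t => σ * (Γ t).1 with hu
  have hud : ∀ t ∈ Icc t₁ t₂, HasDerivAt u (σ * F (Γ t)) t := fun t ht =>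
    (HasDerivAt.fst_prod (hΓ t ht)).const_mul σ
  have huc : ContinuousOn u (Icc t₁ t₂) := fun t ht => (hud t ht).continuousAt.continuousWithinAt
  have hgrow : ∀ s ∈ Icc t₁ t₂, ∀ t ∈ Icc t₁ t₂, s ≤ t → f₀ * (t - s) ≤ u t - u s :=
    (convex_Icc t₁ t₂).mul_sub_le_image_sub_of_le_deriv huc
      (fun t ht => (hud t (interior_subset ht)).differentiableAt.differentiableWithinAt)
      (fun t ht => by rw [(hud t (interior_subset ht)).deriv]; exact hF t (interior_subset ht))
  have hmono : StrictMonoOn u (Icc t₁ t₂) := fun s hs t ht hst => by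
    have := hgrow s hs t ht hst.le
    have h2 : 0 < f₀ * (t - s) := mul_pos hf₀ (sub_pos.2 hst)
    linarith
  have hl : t₁ ∈ Icc t₁ t₂ := ⟨le_rfl, h12.le⟩
  have hr : t₂ ∈ Icc t₁ t₂ := ⟨h12.le, le_rfl⟩
  have hsurj : ∀ v ∈ Icc (u t₁) (u t₂), ∃ t ∈ Icc t₁ t₂, u t = v := fun v hv =>
    intermediate_value_Icc h12.le huc hv
  set θ : ℝ → ℝ := Function.invFunOn u (Icc t₁ t₂) with hθ
  have hθm : ∀ v ∈ Icc (u t₁) (u t₂), θ v ∈ Icc t₁ t₂ := fun v hv =>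
    Function.invFunOn_mem (hsurj v hv)
  have hθu : ∀ v ∈ Icc (u t₁) (u t₂), u (θ v) = v := fun v hv =>
    Function.invFunOn_eq (hsurj v hv)
  have hum : ∀ t ∈ Icc t₁ t₂, u t ∈ Icc (u t₁) (u t₂) := fun t ht =>
    ⟨hmono.monotoneOn hl ht ht.1, hmono.monotoneOn ht hr ht.2⟩
  have huθ : ∀ t ∈ Icc t₁ t₂, θ (u t) = t := fun t ht =>
    hmono.injOn (hθm _ (hum t ht)) ht (hθu _ (hum t ht))
  have hθmono : StrictMonoOn θ (Icc (u t₁) (u t₂)) := fun v hv v' hv' hlt => by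
    by_contra h
    have := hmono.monotoneOn (hθm v' hv') (hθm v hv) (not_lt.1 h)
    rw [hθu v hv, hθu v' hv'] at this
    linarith
  have hθlip : ∀ v ∈ Icc (u t₁) (u t₂), ∀ v' ∈ Icc (u t₁) (u t₂), dist (θ v) (θ v') ≤
      f₀⁻¹ * dist v v' := by
    have key : ∀ v ∈ Icc (u t₁) (u t₂), ∀ v' ∈ Icc (u t₁) (u t₂), v ≤ v' → dist (θ v) (θ v') ≤
        f₀⁻¹ * dist v v' := fun v hv v' hv' hle => by
      have h1 := hθmono.monotoneOn hv hv' hle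
      have h2 := hgrow _ (hθm v hv) _ (hθm v' hv') h1
      rw [hθu v hv, hθu v' hv'] at h2
      rw [dist_comm, dist_comm v, Real.dist_eq, Real.dist_eq, abs_of_nonneg (sub_nonneg.2 h1),
        abs_of_nonneg (sub_nonneg.2 hle), inv_mul_eq_div, le_div_iff₀ hf₀]
      linarith
    intro v hv v' hv'
    rcases le_total v v' with h | h
    · exact key v hv v' hv' h
    · rw [dist_comm, dist_comm v]; exact key v' hv' v hv h
  have hθc : ContinuousOn θ (Icc (u t₁) (u t₂)) :=
    (LipschitzOnWith.of_dist_le_mul (K := ⟨f₀⁻¹, by positivity⟩) hθlip).continuousOn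
  have hσσ := mul_self_of_sign hσ
  have hΓθ : ∀ v ∈ Icc (u t₁) (u t₂), Γ (θ v) = (σ * v, (Γ (θ v)).2) := fun v hv => by
    refine Prod.ext ?_ rfl
    have h1 : σ * (Γ (θ v)).1 = v := hθu v hv
    calc (Γ (θ v)).1 = σ * σ * (Γ (θ v)).1 := by rw [hσσ, one_mul]
      _ = σ * v := by rw [mul_assoc, h1]
  refine ⟨fun v => (Γ (θ v)).2, θ, hθmono, fun v hv => ⟨hθm v hv, hΓθ v hv⟩,
    fun t ht => ⟨hum t ht, huθ t ht⟩, ?_, fun v hv => ?_⟩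
  · exact continuous_snd.comp_continuousOn (ContinuousOn.comp (t := Icc t₁ t₂)
      (fun t ht => (hΓ t ht).continuousAt.continuousWithinAt) hθc hθm)
  · have hv' := Ioo_subset_Icc_self hv
    have hpos : 0 < σ * F (Γ (θ v)) := hf₀.trans_le (hF _ (hθm v hv'))
    have h1 : HasDerivAt θ (σ * F (Γ (θ v)))⁻¹ v :=
      HasDerivAt.of_local_left_inverse (hθc.continuousAt (Icc_mem_nhds hv.1 hv.2))
        (hud _ (hθm v hv')) hpos.ne' (by
          filter_upwards [Icc_mem_nhds hv.1 hv.2] with w hw using hθu w hw)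
    have h2 := (HasDerivAt.snd_prod (hΓ _ (hθm v hv'))).comp v h1
    have h3 : G (σ * v, (Γ (θ v)).2) / (σ * F (σ * v, (Γ (θ v)).2)) =
        G (Γ (θ v)) * (σ * F (Γ (θ v)))⁻¹ := by
      rw [← hΓθ v hv', div_eq_mul_inv]
    rw [h3]
    exact h2

/-- Contacts of the graph of `y` are contacts of the orbit. -/
theorem Touches.of_reparametrization {Γ : ℝ → ℝ × ℝ} {t₁ t₂ u₁ u₂ : ℝ} {σ : ℝ} {y θ ψ : ℝ → ℝ}
    (hmono : StrictMonoOn θ (Icc u₁ u₂))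
    (hΓθ : ∀ v ∈ Icc u₁ u₂, θ v ∈ Icc t₁ t₂ ∧ Γ (θ v) = (σ * v, y v))
    (hθ : ∀ t ∈ Icc t₁ t₂, σ * (Γ t).1 ∈ Icc u₁ u₂ ∧ θ (σ * (Γ t).1) = t) {n : ℕ}
    {v : Fin (n + 1) → ℝ} (h : Touches ψ (fun v => (σ * v, y v)) u₁ u₂ v) :
    Touches ψ Γ t₁ t₂ (fun i => θ (v i)) := by
  have hv : ∀ i, v i ∈ Icc u₁ u₂ := fun i => Ioo_subset_Icc_self (h.mem i)
  have hu : u₁ ≤ u₂ := (hv 0).1.trans (hv 0).2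
  have hl : u₁ ∈ Icc u₁ u₂ := ⟨le_rfl, hu⟩
  have hr : u₂ ∈ Icc u₁ u₂ := ⟨hu, le_rfl⟩
  have key : ∀ t ∈ Icc t₁ (θ (v (Fin.last n))), ∃ w ∈ Icc u₁ (v (Fin.last n)), θ w = t := by
    intro t ht
    have ht' : t ∈ Icc t₁ t₂ := ⟨ht.1, ht.2.trans (hΓθ _ (hv _)).1.2⟩
    obtain ⟨h1, h2⟩ := hθ t ht'
    refine ⟨_, ⟨h1.1, ?_⟩, h2⟩
    by_contra hcon
    have := hmono (hv _) h1 (not_le.1 hcon)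
    rw [h2] at this
    exact absurd ht.2 (not_le.2 this)
  refine ⟨fun i j hij => hmono (hv i) (hv j) (h.mono hij), fun i => ?_, fun t ht => ?_,
    fun t ht => ?_⟩
  · exact ⟨(hΓθ _ hl).1.1.trans_lt (hmono hl (hv i) (h.mem i).1),
      (hmono (hv i) hr (h.mem i).2).trans_le (hΓθ _ hr).1.2⟩
  · obtain ⟨w, hw, rfl⟩ := key t ht
    rw [(hΓθ w ⟨hw.1, hw.2.trans (hv _).2⟩).2]
    exact h.le w hw
  · obtain ⟨w, hw, rfl⟩ := key t ht
    have hw' : w ∈ Icc u₁ u₂ := ⟨hw.1, hw.2.trans (hv _).2⟩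
    rw [(hΓθ w hw').2]
    have := h.eq_iff w hw
    simp only at this ⊢
    rw [this]
    constructor
    · rintro ⟨i, rfl⟩; exact ⟨i, rfl⟩
    · rintro ⟨i, hi⟩; exact ⟨i, hmono.injOn (hv i) hw' hi⟩

/-- The slope of an orbit near the origin, with the zeros on the switching line split off. With
`v = σ x` and zeros `λ_i = σ μ_i` the slope `dy/dv` is `-slopeFactor * ∏ (μ_i - v)`. -/
noncomputable def slopeFactor (F Φ : ℝ × ℝ → ℝ) (σ : ℝ) (m : ℕ) (z : ℝ × ℝ) : ℝ :=
  -(Φ z * (-σ) ^ m) / (σ * F z)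

theorem exists_slopeFactor_bounds {F Φ : ℝ × ℝ → ℝ} (hF : ContDiff ℝ ∞ F) (hΦ : ContDiff ℝ ∞ Φ)
    {σ : ℝ} {m : ℕ} (hσF : 0 < σ * F (0, 0)) (hsign : Φ (0, 0) * (-σ) ^ m < 0) :
    ∃ r f₀ g₀ g₁ L : ℝ, 0 < r ∧ 0 < f₀ ∧ 0 < g₀ ∧ g₀ ≤ g₁ ∧ 0 ≤ L ∧ ∀ z, dist z (0, 0) < r →
      f₀ ≤ σ * F z ∧ g₀ ≤ slopeFactor F Φ σ m z ∧ slopeFactor F Φ σ m z ≤ g₁ ∧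
      |slopeFactor F Φ σ m z - slopeFactor F Φ σ m (0, 0)| ≤ L * dist z (0, 0) := by
  set g := slopeFactor F Φ σ m with hg
  have hg0 : 0 < g (0, 0) := div_pos (by linarith) hσF
  have hgd : ContDiffAt ℝ 1 g (0, 0) := by
    have h1 : ContDiffAt ℝ ∞ g (0, 0) :=
      ((hΦ.mul contDiff_const).neg.contDiffAt).div (contDiff_const.mul hF).contDiffAt hσF.ne'
    exact h1.of_le (by exact_mod_cast le_top)
  obtain ⟨K, s, hs, hlip⟩ := hgd.exists_lipschitzOnWith
  have hFc : ∀ᶠ z in nhds ((0 : ℝ), (0 : ℝ)), σ * F (0, 0) / 2 < σ * F z :=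
    (show ContinuousAt (fun z => σ * F z) (0, 0) from
      (continuous_const.mul hF.continuous).continuousAt).eventually_const_lt (half_lt_self hσF)
  have h1 : ∀ᶠ z in nhds ((0 : ℝ), (0 : ℝ)), g (0, 0) / 2 < g z :=
    hgd.continuousAt.eventually_const_lt (by linarith)
  have h2 : ∀ᶠ z in nhds ((0 : ℝ), (0 : ℝ)), g z < 2 * g (0, 0) :=
    hgd.continuousAt.eventually_lt_const (by linarith)
  obtain ⟨r, hr, H⟩ := Metric.eventually_nhds_iff.1 (hFc.and (h1.and (h2.and hs)))
  refine ⟨r, σ * F (0, 0) / 2, g (0, 0) / 2, 2 * g (0, 0), K, hr, by linarith, by linarith,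
    by linarith, K.2, fun z hz => ?_⟩
  obtain ⟨e1, e2, e3, e4⟩ := H hz
  refine ⟨e1.le, e2.le, e3.le, ?_⟩
  have := hlip.dist_le_mul z e4 (0, 0) (mem_of_mem_nhds hs)
  rwa [Real.dist_eq] at this

/-- The sign of a product of `m` differences of which exactly the first `j` are negative. -/
theorem prod_sub_sign {m j : ℕ} (hj : j ≤ m) {μ : Fin m → ℝ} {v : ℝ}
    (h1 : ∀ i : Fin m, (i : ℕ) < j → μ i < v) (h2 : ∀ i : Fin m, j ≤ i → v < μ i) :
    0 < (-1) ^ j * ∏ i, (μ i - v) := by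
  have h3 : 0 < ∏ i : Fin m, (if (i : ℕ) < j then -1 else 1) * (μ i - v) :=
    Finset.prod_pos fun i _ => by
      split_ifs with h
      · linarith [h1 i h]
      · linarith [h2 i (not_lt.1 h)]
  have h4 : (∏ i : Fin m, (if (i : ℕ) < j then (-1 : ℝ) else 1)) = (-1) ^ j := by
    rw [Finset.prod_ite, Finset.prod_const, Finset.prod_const_one, mul_one]
    congr 1
    rw [Fin.card_filter_val_lt]
    exact min_eq_right hj
  rwa [Finset.prod_mul_distrib, h4] at h3

/-! ### Placing zeros and bumps so that exactly the minima touch -/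

/-- Bumps whose tops lie on the graph of `y`, at points where `y` has its strict minimum over the
support of the bump, touch the graph exactly at these points. -/
theorem touches_of_bumps {ψ y : ℝ → ℝ} {σ c w u₁ u₂ : ℝ} {n : ℕ} (hw : 0 < w) (hu₁ : u₁ < c)
    (hu₂ : c + w * (2 * n + 1) < u₂)
    (htop : ∀ i : Fin (n + 1), ψ (σ * (c + w * (2 * i + 1))) = y (c + w * (2 * i + 1)))
    (hle : ∀ i : Fin (n + 1), ∀ u ∈ Icc (c + w * (2 * i)) (c + w * (2 * i + 2)),
      ψ (σ * u) ≤ y (c + w * (2 * i + 1)))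
    (hψ0 : ∀ u ≤ c, ψ (σ * u) = 0) (hy0 : ∀ u ∈ Icc u₁ c, 0 < y u)
    (hmin : ∀ i : Fin (n + 1), ∀ u ∈ Icc (c + w * (2 * i)) (c + w * (2 * i + 2)),
      u ≤ c + w * (2 * n + 1) → u ≠ c + w * (2 * i + 1) → y (c + w * (2 * i + 1)) < y u) :
    Touches ψ (fun v => (σ * v, y v)) u₁ u₂
      (fun i : Fin (n + 1) => c + w * (2 * ((i : ℕ) : ℝ) + 1)) := by
  have hbump : ∀ u, c ≤ u → u ≤ c + w * (2 * n + 1) → ∃ i : Fin (n + 1),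
      u ∈ Icc (c + w * (2 * i)) (c + w * (2 * i + 2)) := by
    intro u h1 h2
    -- the number of the cell that contains `u` is the integer part of `q`
    set q := (u - c) / (2 * w) with hq
    have hq0 : 0 ≤ q := by have := sub_nonneg.2 h1; positivity
    have hqu : u = c + w * (2 * q) := by rw [hq]; field_simp; ring
    have hqn : q < n + 1 := by
      rw [hqu] at h2
      have : w * (2 * q) ≤ w * (2 * n + 1) := by linarith
      have := le_of_mul_le_mul_left this hw
      linarith
    have hfl : ⌊q⌋₊ < n + 1 := (Nat.floor_lt hq0).2 (by exact_mod_cast hqn)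
    refine ⟨⟨⌊q⌋₊, hfl⟩, ?_, ?_⟩
    · rw [hqu]
      have := mul_le_mul_of_nonneg_left (Nat.floor_le hq0) hw.le
      simp only; linarith
    · rw [hqu]
      have := mul_le_mul_of_nonneg_left (Nat.lt_floor_add_one q).le hw.le
      simp only; linarith
  have hknot : ∀ i : Fin (n + 1), u₁ < c + w * (2 * ((i : ℕ) : ℝ) + 1) ∧
      c + w * (2 * ((i : ℕ) : ℝ) + 1) ≤ c + w * (2 * n + 1) := fun i => by
    have h1 : ((i : ℕ) : ℝ) ≤ n := by exact_mod_cast Nat.lt_succ_iff.1 i.2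
    have h2 : (0 : ℝ) ≤ ((i : ℕ) : ℝ) := Nat.cast_nonneg _
    have h3 : 0 < w * (2 * ((i : ℕ) : ℝ) + 1) := by positivity
    have h4 : w * (2 * ((i : ℕ) : ℝ) + 1) ≤ w * (2 * n + 1) :=
      mul_le_mul_of_nonneg_left (by linarith) hw.le
    exact ⟨by linarith, by linarith⟩
  refine ⟨fun i j hij => ?_, fun i => ⟨(hknot i).1, (hknot i).2.trans_lt hu₂⟩, fun u hu => ?_,
    fun u hu => ?_⟩
  · have h1 : ((i : ℕ) : ℝ) < ((j : ℕ) : ℝ) := by exact_mod_cast hij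
    have := mul_lt_mul_of_pos_left h1 hw
    linarith
  · simp only [Fin.val_last] at hu ⊢
    rcases le_total u c with h | h
    · rw [hψ0 u h]; exact (hy0 u ⟨hu.1, h⟩).le
    · obtain ⟨i, hi⟩ := hbump u h hu.2
      by_cases he : u = c + w * (2 * i + 1)
      · rw [he]; exact (htop i).le
      · exact (hle i u hi).trans (hmin i u hi hu.2 he).le
  · simp only [Fin.val_last] at hu ⊢
    constructor
    · intro heq
      rcases le_total u c with h | h
      · rw [hψ0 u h] at heq; exact absurd heq (hy0 u ⟨hu.1, h⟩).ne'
      · obtain ⟨i, hi⟩ := hbump u h hu.2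
        by_contra he
        have h1 := hle i u hi
        have h2 := hmin i u hi hu.2 fun h => he ⟨i, h.symm⟩
        linarith
    · rintro ⟨i, rfl⟩
      exact (htop i).symm

/-- Zeros at the knots `c + w, …, c + r w`, and `m - r` zeros at the knot `c + N w`, which lies beyond
all contacts. -/
def knotZeros (c w : ℝ) (r N m : ℕ) (i : Fin m) : ℝ :=
  c + w * (if (i : ℕ) < r then ((i : ℕ) : ℝ) + 1 else (N : ℝ))

theorem knotZeros_mem {c w : ℝ} (hw : 0 < w) {r N m : ℕ} (hrN : r ≤ N) (i : Fin m) :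
    knotZeros c w r N m i ∈ Icc c (c + w * N) := by
  unfold knotZeros
  split_ifs with h
  · have h1 : ((i : ℕ) : ℝ) + 1 ≤ N := by exact_mod_cast (Nat.succ_le_of_lt h).trans hrN
    have h2 : (0 : ℝ) ≤ (i : ℕ) := Nat.cast_nonneg _
    have h3 : 0 ≤ w * (((i : ℕ) : ℝ) + 1) := by positivity
    exact ⟨by linarith, by linarith [mul_le_mul_of_nonneg_left h1 hw.le]⟩
  · exact ⟨by have : 0 ≤ w * (N : ℝ) := by positivity
              linarith, le_rfl⟩

theorem prod_knotZeros_sign {c w : ℝ} (hw : 0 < w) {r N m j : ℕ} (hjr : j ≤ r) (hrm : r ≤ m)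
    (hjN : j + 1 ≤ N) {v : ℝ} (h1 : j = 0 ∨ c + w * j < v) (h2 : v < c + w * (j + 1)) :
    0 < (-1) ^ j * ∏ i, (knotZeros c w r N m i - v) := by
  refine prod_sub_sign (hjr.trans hrm) (fun i hi => ?_) fun i hi => ?_
  · have hij : ((i : ℕ) : ℝ) + 1 ≤ j := by exact_mod_cast hi
    rw [knotZeros, if_pos (lt_of_lt_of_le hi hjr)]
    have h3 := mul_le_mul_of_nonneg_left hij hw.le
    rcases h1 with h | h
    · omega
    · linarith
  · refine h2.trans_le ?_
    rw [knotZeros]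
    have key : ∀ x : ℝ, (j : ℝ) + 1 ≤ x → c + w * (j + 1) ≤ c + w * x := fun x hx => by
      linarith [mul_le_mul_of_nonneg_left hx hw.le]
    split_ifs with h
    · exact key _ (by have : (j : ℝ) ≤ (i : ℕ) := by exact_mod_cast hi
                      linarith)
    · exact key _ (by exact_mod_cast hjN)

theorem abs_prod_knotZeros_le {c w : ℝ} (hw : 0 < w) {r N m : ℕ} (hrN : r ≤ N) {v : ℝ}
    (hv : v ∈ Icc c (c + w * N)) : |∏ i, (knotZeros c w r N m i - v)| ≤ (w * N) ^ m := by
  rw [Finset.abs_prod]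
  calc ∏ i, |knotZeros c w r N m i - v| ≤ ∏ _i : Fin m, (w * N) :=
        Finset.prod_le_prod (fun _ _ => abs_nonneg _) fun i _ => by
          have := knotZeros_mem (m := m) (c := c) hw hrN i
          rw [abs_le]; constructor <;> linarith [this.1, this.2, hv.1, hv.2]
    _ = (w * N) ^ m := by simp

/-- A curve with slope `-g ∏ (μ_i - v)`, `g > 0`, and zeros at the knots has strict minima at the
odd knots. -/
theorem knot_minima {c w u₁ u₂ : ℝ} {y g : ℝ → ℝ} {n r m : ℕ} (hw : 0 < w) (hu₁ : u₁ < c)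
    (hu₂ : c + w * (2 * n + 2) < u₂) (hr : 2 * n ≤ r) (hrm : r ≤ m)
    (hyd : ∀ v ∈ Ioo u₁ u₂, HasDerivAt y (-(g v * ∏ i, (knotZeros c w r (2 * n + 2) m i - v))) v)
    (hyc : ContinuousOn y (Icc u₁ u₂)) (hg : ∀ v ∈ Ioo u₁ u₂, 0 < g v) :
    StrictAntiOn y (Icc u₁ (c + w)) ∧
    ∀ i : Fin (n + 1), ∀ u ∈ Icc (c + w * (2 * i)) (c + w * (2 * i + 2)),
      u ≤ c + w * (2 * n + 1) → u ≠ c + w * (2 * i + 1) → y (c + w * (2 * i + 1)) < y u := by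
  have hcN : w * (2 * n + 1) < w * (2 * n + 2) := mul_lt_mul_of_pos_left (by linarith) hw
  have hsub : ∀ p q, u₁ ≤ p → q ≤ u₂ → Icc p q ⊆ Icc u₁ u₂ := fun p q h1 h2 => Icc_subset_Icc h1 h2
  have hanti : ∀ p q, u₁ ≤ p → q ≤ u₂ →
      (∀ v ∈ Ioo p q, 0 < ∏ i, (knotZeros c w r (2 * n + 2) m i - v)) →
      StrictAntiOn y (Icc p q) := fun p q h1 h2 h => by
    refine strictAntiOn_of_deriv_neg (convex_Icc _ _) (hyc.mono (hsub p q h1 h2)) fun v hv => ?_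
    rw [interior_Icc] at hv
    have hv' : v ∈ Ioo u₁ u₂ := ⟨by linarith [hv.1], by linarith [hv.2]⟩
    rw [(hyd v hv').deriv]
    exact neg_neg_of_pos (mul_pos (hg v hv') (h v hv))
  have hmono : ∀ p q, u₁ ≤ p → q ≤ u₂ →
      (∀ v ∈ Ioo p q, ∏ i, (knotZeros c w r (2 * n + 2) m i - v) < 0) →
      StrictMonoOn y (Icc p q) := fun p q h1 h2 h => by
    refine strictMonoOn_of_deriv_pos (convex_Icc _ _) (hyc.mono (hsub p q h1 h2)) fun v hv => ?_
    rw [interior_Icc] at hv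
    have hv' : v ∈ Ioo u₁ u₂ := ⟨by linarith [hv.1], by linarith [hv.2]⟩
    rw [(hyd v hv').deriv]
    exact neg_pos_of_neg (mul_neg_of_pos_of_neg (hg v hv') (h v hv))
  have hn0 : (0 : ℝ) ≤ n := Nat.cast_nonneg _
  have hw1 : w ≤ w * (2 * n + 1) := le_mul_of_one_le_right hw.le (by linarith)
  refine ⟨hanti _ _ le_rfl (by linarith) fun v hv => ?_, fun i u hu hul hne => ?_⟩
  · have := prod_knotZeros_sign (c := c) (v := v) (j := 0) hw (Nat.zero_le r) hrm
      (show 0 + 1 ≤ 2 * n + 2 by omega) (Or.inl rfl) (by simpa using hv.2)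
    simpa using this
  · have hi : (i : ℕ) ≤ n := Nat.lt_succ_iff.1 i.2
    have hi' : ((i : ℕ) : ℝ) ≤ n := by exact_mod_cast hi
    have hi0 : (0 : ℝ) ≤ ((i : ℕ) : ℝ) := Nat.cast_nonneg _
    have k0 : 0 ≤ w * (2 * ((i : ℕ) : ℝ)) := by positivity
    have k1 : w * (2 * ((i : ℕ) : ℝ) + 1) ≤ w * (2 * n + 1) :=
      mul_le_mul_of_nonneg_left (by linarith) hw.le
    have k2 : w * (2 * ((i : ℕ) : ℝ) + 2) ≤ w * (2 * n + 2) :=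
      mul_le_mul_of_nonneg_left (by linarith) hw.le
    have k3 : w * (2 * ((i : ℕ) : ℝ)) < w * (2 * ((i : ℕ) : ℝ) + 1) :=
      mul_lt_mul_of_pos_left (by linarith) hw
    have k4 : w * (2 * ((i : ℕ) : ℝ) + 1) < w * (2 * ((i : ℕ) : ℝ) + 2) :=
      mul_lt_mul_of_pos_left (by linarith) hw
    rcases lt_or_gt_of_ne hne with h | h
    · refine hanti (c + w * (2 * i)) (c + w * (2 * i + 1)) (by linarith) (by linarith)
        (fun v hv => ?_) ⟨hu.1, h.le⟩ ⟨by linarith, le_rfl⟩ h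
      have := prod_knotZeros_sign (c := c) (v := v) (j := 2 * i) hw (by omega) hrm
        (show 2 * (i : ℕ) + 1 ≤ 2 * n + 2 by omega) (Or.inr (by push_cast; exact hv.1))
        (by push_cast; exact hv.2)
      rwa [Even.neg_one_pow ⟨i, by ring⟩, one_mul] at this
    · have hin : (i : ℕ) < n := by
        rcases hi.lt_or_eq with h' | h'
        · exact h'
        · rw [h'] at h; linarith
      refine hmono (c + w * (2 * i + 1)) (c + w * (2 * i + 2)) (by linarith) (by linarith)
        (fun v hv => ?_) ⟨le_rfl, by linarith⟩ ⟨h.le, hu.2⟩ h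
      have := prod_knotZeros_sign (c := c) (v := v) (j := 2 * i + 1) hw (by omega) hrm
        (show 2 * (i : ℕ) + 1 + 1 ≤ 2 * n + 2 by omega) (Or.inr (by push_cast; exact hv.1))
        (by push_cast; linarith [hv.2])
      rw [Odd.neg_one_pow ⟨i, rfl⟩] at this
      linarith

/-- The minima at the odd knots of the curves `y` with slope `-h ∏ (μ_i - v)`, where the `μ_i` are the
zeros at the knots of distance `w`, agree up to `O(w^5)`, uniformly in the curve. Since a bump of
width `w` has second derivative `O(w⁻⁴)`, bumps of this height are small in `C^2`. -/
def LevelBound (h : ℝ × ℝ → ℝ) (σ : ℝ) (n r m : ℕ) : Prop :=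
  ∃ C ρ : ℝ, 0 < C ∧ 0 < ρ ∧ ∀ (c w u₁ u₂ : ℝ) (y : ℝ → ℝ), 0 < w → w ≤ 1 →
    |c| ≤ w * (2 * n + 2) → u₁ < c → c + w * (2 * n + 2) < u₂ →
    (∀ v ∈ Ioo u₁ u₂, HasDerivAt y
      (-(h (σ * v, y v) * ∏ i, (knotZeros c w r (2 * n + 2) m i - v))) v) →
    (∀ v ∈ Ioo u₁ u₂, dist (σ * v, y v) (0, 0) < ρ) → |y (c + w * (2 * n + 1))| ≤ w →
    ∀ i : Fin (n + 1), |y (c + w * (2 * i + 1)) - y (c + w * (2 * n + 1))| ≤ C * w ^ 5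

theorem levelBound_zero (h : ℝ × ℝ → ℝ) (σ : ℝ) (r m : ℕ) : LevelBound h σ 0 r m := by
  refine ⟨1, 1, one_pos, one_pos, fun c w u₁ u₂ y hw _ _ _ _ _ _ _ i => ?_⟩
  have : i = 0 := Fin.ext (by omega)
  subst this
  simp only [Fin.val_zero, Nat.cast_zero, sub_self, abs_zero]
  positivity

/-- The slope is `O(w^m)` between the outermost knots. -/
theorem abs_sub_le_of_knotZeros {h : ℝ × ℝ → ℝ} {σ g₁ c w u₁ u₂ : ℝ} {y : ℝ → ℝ} {n r m : ℕ}
    (hw : 0 < w) (hu₁ : u₁ < c) (hu₂ : c + w * (2 * n + 2) < u₂) (hr : r ≤ 2 * n + 2)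
    (hyd : ∀ v ∈ Ioo u₁ u₂, HasDerivAt y
      (-(h (σ * v, y v) * ∏ i, (knotZeros c w r (2 * n + 2) m i - v))) v)
    (hh : ∀ v ∈ Ioo u₁ u₂, |h (σ * v, y v)| ≤ g₁) {p q : ℝ}
    (hp : p ∈ Icc c (c + w * (2 * n + 2))) (hq : q ∈ Icc c (c + w * (2 * n + 2))) :
    |y p - y q| ≤ g₁ * (w * (2 * n + 2)) ^ m * (w * (2 * n + 2)) := by
  have hsub : ∀ v ∈ Icc c (c + w * (2 * n + 2)), v ∈ Ioo u₁ u₂ := fun v hv =>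
    ⟨by linarith [hv.1], by linarith [hv.2]⟩
  have hg₁ : 0 ≤ g₁ := (abs_nonneg _).trans (hh p (hsub p hp))
  have hb := (convex_Icc c (c + w * (2 * n + 2))).norm_image_sub_le_of_norm_hasDerivWithin_le
    (f := y) (C := g₁ * (w * (2 * n + 2)) ^ m)
    (fun v hv => (hyd v (hsub v hv)).hasDerivWithinAt) (fun v hv => by
      rw [Real.norm_eq_abs, abs_neg, abs_mul]
      refine mul_le_mul (hh v (hsub v hv)) ?_ (abs_nonneg _) hg₁
      have := abs_prod_knotZeros_le (c := c) (w := w) (r := r) (N := 2 * n + 2) (m := m) (v := v) hw hr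
        (by push_cast; exact hv)
      push_cast at this
      exact this) hq hp
  rw [Real.norm_eq_abs, Real.norm_eq_abs] at hb
  refine hb.trans (mul_le_mul_of_nonneg_left ?_ (by positivity))
  rw [abs_le]; constructor <;> linarith [hp.1, hp.2, hq.1, hq.2]

theorem odd_knot_mem {c w : ℝ} {n : ℕ} (hw : 0 < w) {i : ℝ} (hi0 : 0 ≤ i) (hi : i ≤ n) :
    c + w * (2 * i + 1) ∈ Icc c (c + w * (2 * n + 2)) := by
  have h1 : 0 ≤ w * (2 * i + 1) := by positivity
  have h2 : w * (2 * i + 1) ≤ w * (2 * n + 2) := mul_le_mul_of_nonneg_left (by linarith) hw.le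
  exact ⟨by linarith, by linarith⟩

/-- With at least four zeros the minima agree to the required order for the trivial reason that
the slope is `O(w^4)`. -/
theorem levelBound_of_four_le {h : ℝ × ℝ → ℝ} {ρ g₁ : ℝ} (hρ : 0 < ρ) (hg₁ : 0 < g₁)
    (hh : ∀ z, dist z (0, 0) < ρ → |h z| ≤ g₁) (σ : ℝ) {n r m : ℕ} (hr : r ≤ 2 * n + 2)
    (hm : 4 ≤ m) : LevelBound h σ n r m := by
  refine ⟨g₁ * (2 * n + 2) ^ m * (2 * n + 2), ρ, by positivity, hρ,
    fun c w u₁ u₂ y hw hw1 _ hu₁ hu₂ hyd hyρ _ i => ?_⟩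
  have h1 := abs_sub_le_of_knotZeros hw hu₁ hu₂ hr hyd (fun v hv => hh _ (hyρ v hv))
    (odd_knot_mem (c := c) hw (Nat.cast_nonneg (i : ℕ))
      (by exact_mod_cast Nat.lt_succ_iff.1 i.2 : ((i : ℕ) : ℝ) ≤ n))
    (odd_knot_mem (c := c) hw (Nat.cast_nonneg n) le_rfl)
  refine h1.trans ?_
  have h2 : w ^ m ≤ w ^ 4 := pow_le_pow_of_le_one hw.le hw1 hm
  calc g₁ * (w * (2 * n + 2)) ^ m * (w * (2 * n + 2))
      = g₁ * (2 * n + 2) ^ m * (2 * n + 2) * (w ^ m * w) := by rw [mul_pow]; ring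
    _ ≤ g₁ * (2 * n + 2) ^ m * (2 * n + 2) * (w ^ 4 * w) := by gcongr
    _ = _ := by ring

/-- Three equidistant zeros: to leading order the slope is odd about the middle one, so that its
integral between the outer ones vanishes to leading order. -/
theorem levelBound_three {h : ℝ × ℝ → ℝ} {ρ g₁ L : ℝ} (hρ : 0 < ρ) (hg₁ : 0 < g₁) (hL : 0 ≤ L)
    (hh : ∀ z, dist z (0, 0) < ρ → |h z| ≤ g₁ ∧ |h z - h (0, 0)| ≤ L * dist z (0, 0)) {σ : ℝ}
    (hσ : σ = 1 ∨ σ = -1) : LevelBound h σ 1 3 3 := by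
  refine ⟨2 * (L * (9 + 256 * g₁)) + 1, ρ, by positivity, hρ,
    fun c w u₁ u₂ y hw hw1 hc hu₁ hu₂ hyd hyρ hy i => ?_⟩
  have hr : 3 ≤ 2 * 1 + 2 := by norm_num
  have hsub : ∀ v ∈ Icc c (c + w * 4), v ∈ Ioo u₁ u₂ := fun v hv => by
    norm_num at hu₂
    exact ⟨by linarith [hv.1], by linarith [hv.2]⟩
  norm_num at hy hc ⊢
  have hyb : ∀ v ∈ Icc c (c + w * 4), |y v| ≤ w * (1 + 256 * g₁) := fun v hv => by
    have h1 := abs_sub_le_of_knotZeros hw hu₁ hu₂ hr hyd (fun v hv => (hh _ (hyρ v hv)).1)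
      (p := v) (q := c + w * 3) (by norm_num; exact hv) (by norm_num; constructor <;> linarith)
    norm_num at h1
    have h2 : w ^ 3 ≤ 1 := pow_le_one₀ hw.le hw1
    have h3 : g₁ * (w * 4) ^ 3 * (w * 4) ≤ w * (256 * g₁) := by
      calc g₁ * (w * 4) ^ 3 * (w * 4) = 256 * g₁ * w * w ^ 3 := by ring
        _ ≤ 256 * g₁ * w * 1 := by gcongr
        _ = _ := by ring
    have h4 := abs_sub_abs_le_abs_sub (y v) (y (c + w * 3))
    linarith
  have hdist : ∀ v ∈ Icc c (c + w * 4), dist (σ * v, y v) ((0 : ℝ), (0 : ℝ)) ≤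
      w * (9 + 256 * g₁) := fun v hv => by
    have h1 : |σ| = 1 := by rcases hσ with rfl | rfl <;> norm_num
    have h2 : |v| ≤ 8 * w := by
      have := abs_le.1 hc
      rw [abs_le]; constructor <;> linarith [hv.1, hv.2]
    have h3 : 0 ≤ w * g₁ := by positivity
    rw [Prod.dist_eq]
    refine max_le ?_ ?_
    · rw [Real.dist_eq, sub_zero, abs_mul, h1, one_mul]; linarith
    · rw [Real.dist_eq, sub_zero]; linarith [hyb v hv]
  have hprod : ∀ v, ∏ i, (knotZeros c w 3 4 3 i - v) =
      (v - (c + w * 2)) * (w ^ 2 - (v - (c + w * 2)) ^ 2) := fun v => by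
    simp [Fin.prod_univ_three, knotZeros]; ring
  -- subtracting the symmetric leading part leaves a function of slope `O(w^4)`
  let Z : ℝ → ℝ := fun v => y v + h (0, 0) *
    (w ^ 2 * (v - (c + w * 2)) ^ 2 / 2 - (v - (c + w * 2)) ^ 4 / 4)
  have hZ : ∀ v ∈ Icc (c + w) (c + w * 3), HasDerivWithinAt Z
      (-((h (σ * v, y v) - h (0, 0)) * ((v - (c + w * 2)) * (w ^ 2 - (v - (c + w * 2)) ^ 2))))
      (Icc (c + w) (c + w * 3)) v := fun v hv => by
    have h1 := hyd v (hsub v ⟨by linarith [hv.1], by linarith [hv.2]⟩)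
    norm_num at h1
    rw [hprod] at h1
    have h2 : HasDerivAt (fun v : ℝ => v - (c + w * 2)) 1 v := (hasDerivAt_id v).sub_const _
    have h3 := h1.add ((((h2.pow 2).const_mul (w ^ 2)).div_const 2).sub
      ((h2.pow 4).div_const 4) |>.const_mul (h (0, 0)))
    refine (h3.congr_deriv ?_).hasDerivWithinAt
    norm_num
    ring
  have hb := (convex_Icc (c + w) (c + w * 3)).norm_image_sub_le_of_norm_hasDerivWithin_le
    (C := L * (9 + 256 * g₁) * w ^ 4) hZ (fun v hv => by
      have hv' : v ∈ Icc c (c + w * 4) := ⟨by linarith [hv.1], by linarith [hv.2]⟩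
      have h1 := (hh _ (hyρ v (hsub v hv'))).2.trans (mul_le_mul_of_nonneg_left (hdist v hv') hL)
      have h2 : |v - (c + w * 2)| ≤ w := by
        rw [abs_le]; constructor <;> linarith [hv.1, hv.2]
      have h3 : |w ^ 2 - (v - (c + w * 2)) ^ 2| ≤ w ^ 2 := by
        have := sq_le_sq' (abs_le.1 h2).1 (abs_le.1 h2).2
        rw [abs_of_nonneg (by linarith)]
        linarith [sq_nonneg (v - (c + w * 2))]
      rw [Real.norm_eq_abs, abs_neg, abs_mul, abs_mul]
      calc _ ≤ L * (w * (9 + 256 * g₁)) * (w * w ^ 2) := by gcongr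
        _ = _ := by ring) (x := c + w * 3) (y := c + w) ⟨by linarith, le_rfl⟩ ⟨le_rfl, by linarith⟩
  have hZZ : Z (c + w) - Z (c + w * 3) = y (c + w) - y (c + w * 3) := by
    simp only [Z]; ring
  have hlen : ‖c + w - (c + w * 3)‖ = 2 * w := by
    rw [Real.norm_eq_abs, abs_of_neg (by linarith)]; ring
  rw [hZZ, hlen, Real.norm_eq_abs] at hb
  have hw5 : 0 ≤ w ^ 5 := by positivity
  have hfin : |y (c + w) - y (c + w * 3)| ≤ (2 * (L * (9 + 256 * g₁)) + 1) * w ^ 5 := by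
    calc _ ≤ L * (9 + 256 * g₁) * w ^ 4 * (2 * w) := hb
      _ = 2 * (L * (9 + 256 * g₁)) * w ^ 5 := by ring
      _ ≤ _ := by linarith
  fin_cases i
  · simpa using hfin
  · norm_num
    positivity

/-! ### From a local contact configuration to a bifurcating loop -/

theorem prod_sub_mul_sign {σ v : ℝ} {m : ℕ} (μ : Fin m → ℝ) :
    ∏ i, (σ * v - σ * μ i) = (-σ) ^ m * ∏ i, (μ i - v) := by
  have : ∀ i, σ * v - σ * μ i = -σ * (μ i - v) := fun i => by ring
  simp only [this, Finset.prod_mul_distrib, Finset.prod_const, Finset.card_univ, Fintype.card_fin]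

theorem Arcs.upper_sign_of_direction {f φ : Side → ℝ × ℝ → ℝ} {m : Side → ℕ} {U : Set (ℝ × ℝ)}
    {a : ℝ} (A : Arcs (baseSystem f φ m) U a) (hφ : Continuous (φ .upper))
    (hφ0 : φ .upper (0, 0) ≠ 0) {σ : ℝ} (hσ : σ = 1 ∨ σ = -1) (hσf : 0 < σ * f .upper (0, 0)) :
    φ .upper (0, 0) * (-σ) ^ m .upper < 0 := by
  have h1 := A.upper_sign hφ (fun h => by rw [h, mul_zero] at hσf; exact lt_irrefl _ hσf) hφ0
  have h2 : -f .upper (0, 0) = (-σ) * (σ * f .upper (0, 0)) := by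
    rw [← mul_assoc, neg_mul, mul_self_of_sign hσ, neg_one_mul]
  rw [h2, mul_pow, ← mul_assoc] at h1
  by_contra hn
  exact absurd (mul_nonneg (not_lt.1 hn) (pow_pos hσf _).le) (not_le.2 h1)

/-- The curve `y` is a piece of orbit close to the origin, parametrized by `v = σ x`, of the upper
subsystem with zeros `σ μ_i`. -/
structure LocalOrbit (h : ℝ × ℝ → ℝ) (σ : ℝ) {m : ℕ} (μ : Fin m → ℝ) (ρ δ u₁ u₂ : ℝ)
    (y : ℝ → ℝ) : Prop where
  left : u₁ < -δ
  right : δ < u₂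
  cont : ContinuousOn y (Icc u₁ u₂)
  deriv : ∀ v ∈ Ioo u₁ u₂, HasDerivAt y (-(h (σ * v, y v) * ∏ i, (μ i - v))) v
  near : ∀ v ∈ Icc u₁ u₂, dist (σ * v, y v) ((0 : ℝ), (0 : ℝ)) < ρ

set_option maxHeartbeats 1000000 in
/-- Reduction of the bifurcation problem to the contacts of curves `y` with graphs `ψ`. The sign of
the product of the `μ_i - v` at the last contact decides whether the contact is transverse. The
predicate `hit` stands for the case at hand, a positive or a vanishing product. -/
theorem Arcs.bifurcatesFrom_of_touches {f φ : Side → ℝ × ℝ → ℝ} {m : Side → ℕ}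
    {U : Set (ℝ × ℝ)} {a : ℝ}
    (A : Arcs (baseSystem f φ m) U a) (hUo : IsOpen U) (hUb : Bornology.IsBounded U)
    (hU0 : ((0 : ℝ), (0 : ℝ)) ∈ U) (hf : ∀ s, ContDiff ℝ ∞ (f s)) (hφ : ∀ s, ContDiff ℝ ∞ (φ s))
    (hf0 : ∀ s, f s (0, 0) ≠ 0) (hφ0 : ∀ s, φ s (0, 0) ≠ 0)
    {σ : ℝ} (hσ : σ = 1 ∨ σ = -1) (hσf : 0 < σ * f .upper (0, 0))
    {C : (S : PWS) → Loop S U → Prop} {ℓ n d : ℕ} (hd : 0 < d) {hit : ℝ → Prop} {ρ : ℝ}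
    (hρ : 0 < ρ)
    (hC : ∀ p S (L : Loop S U), hit p →
      (0 < p → 0 < n → L.IsCro ∧ L.tangentPoints.encard = n) →
      (p = 0 → L.IsCri ∧ L.tangentPoints.encard = (n + 1 : ℕ)) →
      C S L ∧ L.tangentPoints.encard = ℓ)
    (H : ∀ δ : ℝ, 0 < δ → δ ≤ 1 → ∃ (μ : Fin (m .upper) → ℝ) (v₀ y₀ : ℝ), μ ≠ 0 ∧ (∀ i, |μ i| ≤ δ) ∧
      |v₀| ≤ δ ∧ |y₀| ≤ δ ∧ ∀ (u₁ u₂ : ℝ) (y : ℝ → ℝ),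
        LocalOrbit (slopeFactor (f .upper) (φ .upper) σ (m .upper)) σ μ ρ δ u₁ u₂ y → y v₀ = y₀ →
        ∃ k : Fin (3 * d + 1) → ℝ, ‖k‖ ≤ δ ∧ ContDiff ℝ ∞ (psi d hd 0 1 k) ∧
          (∀ x, |psi d hd 0 1 k x| ≤ δ) ∧ (∀ x, |deriv (psi d hd 0 1 k) x| ≤ δ) ∧
          (∀ x, |deriv (deriv (psi d hd 0 1 k)) x| ≤ δ) ∧
          (∀ x, δ ≤ |x| → psi d hd 0 1 k x = 0) ∧
          ∃ s : Fin (n + 1) → ℝ, Touches (psi d hd 0 1 k) (fun v => (σ * v, y v)) u₁ u₂ s ∧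
            |s (Fin.last n)| < δ ∧ 0 < f .lower (0, 0) * (σ * s (Fin.last n)) ∧
            deriv (psi d hd 0 1 k) (σ * s (Fin.last n)) = 0 ∧
            hit (∏ i, (μ i - s (Fin.last n)))) :
    BifurcatesFrom U f φ m A.carrier C ℓ := by
  have hσσ := mul_self_of_sign hσ
  have hσabs : |σ| = 1 := by rcases hσ with rfl | rfl <;> norm_num
  have hsign := A.upper_sign_of_direction (hφ .upper).continuous (hφ0 .upper) hσ hσf
  obtain ⟨ρ', f₀, g₀, g₁, L, hρ', hf₀, hg₀, -, -, hb⟩ :=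
    exists_slopeFactor_bounds (hf .upper) (hφ .upper) hσf hsign
  -- the step of the lower switching line lies between `a` and `0`
  have ha := A.neg
  set r₂ := a / 4 with hr₂
  set r₁ := max (3 * a / 4) (a / 4 - 1) with hr₁
  have har : a < r₁ := lt_of_lt_of_le (by linarith) (le_max_left _ _)
  have hr : r₁ < r₂ := max_lt (by linarith) (by linarith)
  have hr1 : r₂ - r₁ ≤ 1 := by linarith [le_max_right (3 * a / 4) (a / 4 - 1)]
  have hd' : ∀ s, 0 < (bySide d 1 : Side → ℕ) s := fun s => by
    cases s
    · exact hd
    · exact one_pos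
  refine ⟨bySide d 1, hd', bySide 0 r₁, bySide 1 r₂, fun s => ?_, fun ε hε => ?_⟩
  · cases s
    · exact one_pos
    · exact hr
  obtain ⟨t₁, t₀, t₂, δ₀, h10, h02, hδ₀, HL⟩ := A.exists_loop hUo hUb hU0 hf hφ hf0 hφ0 hσf har hr
    (by linarith) hr1 (show 0 < min ε (min ρ ρ') by positivity)
  set δ := min (min δ₀ (ε / 2)) 1 with hδdef
  have hδ : 0 < δ := by positivity
  have hδ1 : δ ≤ 1 := min_le_right _ _
  have hδa : δ ≤ δ₀ := (min_le_left _ _).trans (min_le_left _ _)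
  have hδb : δ ≤ ε / 2 := (min_le_left _ _).trans (min_le_right _ _)
  obtain ⟨μ, v₀, y₀, hμ0, hμ, hv₀, hy₀, H⟩ := H δ hδ hδ1
  have hlamδ : ‖fun i => σ * μ i‖ ≤ δ := (pi_norm_le_iff_of_nonneg hδ.le).2 fun i => by
    rw [Real.norm_eq_abs, abs_mul, hσabs, one_mul]; exact hμ i
  obtain ⟨Γ, hΓ0, hΓ, hΓρ, hΓl, hΓr, HΓ⟩ := HL (fun i => σ * μ i) (hlamδ.trans hδa) (σ * v₀, y₀) (by
    rw [Prod.norm_def]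
    refine (max_le ?_ ?_).trans hδa
    · rw [Real.norm_eq_abs, abs_mul, hσabs, one_mul]; exact hv₀
    · exact hy₀)
  have hnear : ∀ t ∈ Icc t₁ t₂, dist (Γ t) (0, 0) < ρ' := fun t ht =>
    (hΓρ t ht).trans_le ((min_le_right _ _).trans (min_le_right _ _))
  obtain ⟨y, θ, hθm, hΓθ, hθ, hyc, hyd⟩ := exists_reparametrization (h10.trans h02) hσ
    (F := f .upper) (G := fun p => φ .upper p * ∏ i, (p.1 - σ * μ i)) hΓ hf₀
    (fun t ht => (hb _ (hnear t ht)).1)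
  set u₁ := σ * (Γ t₁).1 with hu₁
  set u₂ := σ * (Γ t₂).1 with hu₂
  have hyρ : ∀ v ∈ Icc u₁ u₂, dist (σ * v, y v) ((0 : ℝ), (0 : ℝ)) < min ε (min ρ ρ') :=
    fun v hv => by
      rw [← (hΓθ v hv).2]; exact hΓρ _ (hΓθ v hv).1
  have hlocal : LocalOrbit (slopeFactor (f .upper) (φ .upper) σ (m .upper)) σ μ ρ δ u₁ u₂ y := by
    refine ⟨by linarith, by linarith, hyc, fun v hv => ?_, fun v hv => (hyρ v hv).trans_le
      ((min_le_right _ _).trans (min_le_left _ _))⟩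
    refine (hyd v hv).congr_deriv ?_
    simp only
    rw [prod_sub_mul_sign, slopeFactor]
    ring
  have hyv₀ : y v₀ = y₀ := by
    have h1 := hθ t₀ ⟨h10.le, h02.le⟩
    rw [hΓ0] at h1
    simp only [← mul_assoc, hσσ, one_mul] at h1
    have h2 := (hΓθ v₀ h1.1).2
    rw [h1.2, hΓ0] at h2
    exact (congrArg Prod.snd h2).symm
  obtain ⟨k, hk, hψs, hψ0, hψ1, hψ2, hψsupp, s, hs, hsδ, hsf, hsψ, hhit⟩ := H u₁ u₂ y hlocal hyv₀
  set ψ := psi d hd 0 1 k with hψ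
  set e := s (Fin.last n) with he
  have hem : e ∈ Ioo u₁ u₂ := hs.mem (Fin.last n)
  have hΓe := hΓθ e (Ioo_subset_Icc_self hem)
  obtain ⟨κ, S, hκ, hSdef, hS, hrho, Lp, hL1, hL2, hL3, hL4⟩ := HΓ ψ hψs (fun x => (hψ0 x).trans hδa)
    (fun x => (hψ1 x).trans hδa) (fun x => (hψ2 x).trans hδa) (fun x hx => hψsupp x (hδa.trans hx))
    n (fun i => θ (s i)) (hs.of_reparametrization hθm hΓθ hθ)
    (by rw [← he, hΓe.2]; simp only [abs_mul, hσabs, one_mul]; exact hsδ.trans_le hδa)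
    (by rw [← he, hΓe.2]; exact hsf)
  have hmin : min ε (min ρ ρ') ≤ ε := min_le_left _ _
  -- the slope of the upper orbit, relative to the switching line, at the last contact
  have hD := HasDerivAt.snd_prod (hasDerivAt_shear (F := f .upper)
    (G := fun p => φ .upper p * ∏ i, (p.1 - σ * μ i))
    ((hψs.differentiable (by simp)) (Γ (θ e)).1) (hΓ (θ e) hΓe.1))
  obtain ⟨e1, e2, -, -⟩ := hb _ (hnear _ hΓe.1)
  rw [hΓe.2] at e1 e2
  have hDval : (fun p : ℝ × ℝ => φ .upper p * ∏ i, (p.1 - σ * μ i)) (Γ (θ e)) -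
      f .upper (Γ (θ e)) * deriv ψ (Γ (θ e)).1 =
      -(slopeFactor (f .upper) (φ .upper) σ (m .upper) (σ * e, y e) *
        (σ * f .upper (σ * e, y e))) * ∏ i, (μ i - e) := by
    rw [hΓe.2]
    simp only
    rw [hsψ, prod_sub_mul_sign, slopeFactor, div_mul_cancel₀ _ (by linarith)]
    ring
  obtain ⟨hL5, hL6⟩ := hL4 _ hD
  simp only at hL5 hL6
  rw [hDval] at hL5 hL6
  have hpos : 0 < slopeFactor (f .upper) (φ .upper) σ (m .upper) (σ * e, y e) *
        (σ * f .upper (σ * e, y e)) := mul_pos (by linarith) (by linarith)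
  have hCL := hC _ S Lp hhit
    (fun hp hn => hL5 (mul_neg_of_neg_of_pos (neg_neg_of_pos hpos) hp) hn)
    (fun hp => hL6 (by rw [hp, mul_zero]))
  refine ⟨bySide (fun i => σ * μ i) 0, bySide 
      (β := fun s => Fin (3 * (bySide d 1 : Side → ℕ) s + 1) → ℝ) k (stepParam κ),
    S, ?_, ⟨.upper, fun h => hμ0 ?_⟩, fun s => ?_, fun s => ?_, hS, by linarith, Lp, hCL.1, ?_, ?_,
    hCL.2, ?_⟩
  · rw [hSdef]
    congr 1
    funext s
    cases s
    · rfl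
    · exact (psi_stepParam κ r₁ r₂ _).symm
  · funext i
    have h1 : σ * μ i = 0 := congrFun h i
    rcases mul_eq_zero.1 h1 with h2 | h2
    · rw [h2, zero_mul] at hσσ; exact absurd hσσ (by norm_num)
    · exact h2
  · cases s
    · exact hlamδ.trans_lt (by linarith)
    · exact (norm_zero (E := Fin (m .lower) → ℝ)).trans_lt hε
  · cases s
    · exact hk.trans_lt (by linarith)
    · exact (norm_stepParam_le κ).trans_lt (by linarith)
  · exact hL1.trans (Metric.thickening_mono hmin _)
  · exact hL2.trans (Metric.thickening_mono hmin _)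
  · exact hL3.trans (Metric.ball_subset_ball hmin)

/-! ### Contacts at several knots -/

set_option maxHeartbeats 1000000 in
/-- Bifurcation with `n + 1` contacts, all of them under bumps of the switching line. With
`r = 2 n + 1` zeros at the knots the last contact is tangential, with `r = 2 n` it is transverse. -/
theorem Arcs.bifurcatesFrom_of_levelBound {f φ : Side → ℝ × ℝ → ℝ} {m : Side → ℕ}
    {U : Set (ℝ × ℝ)} {a : ℝ}
    (A : Arcs (baseSystem f φ m) U a) (hUo : IsOpen U) (hUb : Bornology.IsBounded U)
    (hU0 : ((0 : ℝ), (0 : ℝ)) ∈ U) (hf : ∀ s, ContDiff ℝ ∞ (f s)) (hφ : ∀ s, ContDiff ℝ ∞ (φ s))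
    (hf0 : ∀ s, f s (0, 0) ≠ 0) (hφ0 : ∀ s, φ s (0, 0) ≠ 0)
    {σ : ℝ} (hσ : σ = 1 ∨ σ = -1) {C : (S : PWS) → Loop S U → Prop} {ℓ n r : ℕ} {hit : ℝ → Prop}
    {ρ : ℝ} (hρ : 0 < ρ) (hσf : 0 < σ * f .upper (0, 0))
    (hpos : ∀ z, dist z ((0 : ℝ), (0 : ℝ)) < ρ → 0 < slopeFactor (f .upper) (φ .upper) σ (m .upper) z)
    (hC : ∀ p S (L : Loop S U), hit p →
      (0 < p → 0 < n → L.IsCro ∧ L.tangentPoints.encard = n) →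
      (p = 0 → L.IsCri ∧ L.tangentPoints.encard = (n + 1 : ℕ)) →
      C S L ∧ L.tangentPoints.encard = ℓ)
    (hr : 2 * n ≤ r) (hr' : r ≤ 2 * n + 1) (hr0 : 0 < r) (hrm : r ≤ m .upper)
    (hhit : ∀ p, (r = 2 * n + 1 → p = 0) → (r = 2 * n → 0 < p) → hit p)
    (E : LevelBound (slopeFactor (f .upper) (φ .upper) σ (m .upper)) σ n r (m .upper)) :
    BifurcatesFrom U f φ m A.carrier C ℓ := by
  have hσσ := mul_self_of_sign hσ
  have hσabs : |σ| = 1 := by rcases hσ with rfl | rfl <;> norm_num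
  have hσv : ∀ v, σ * (σ * v) = v := fun v => by rw [← mul_assoc, hσσ, one_mul]
  obtain ⟨K, ρ', hK, hρ', HE⟩ := E
  obtain ⟨s, hs, hsf⟩ : ∃ s : ℝ, (s = 1 ∨ s = -1) ∧ 0 < f .lower (0, 0) * (σ * s) := by
    have hσ0 : σ ≠ 0 := fun h => by rw [h, zero_mul] at hσσ; exact absurd hσσ (by norm_num)
    rcases lt_or_gt_of_ne (mul_ne_zero (hf0 .lower) hσ0) with h | h
    · exact ⟨-1, Or.inr rfl, by linarith⟩
    · exact ⟨1, Or.inl rfl, by linarith⟩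
  refine A.bifurcatesFrom_of_touches hUo hUb hU0 hf hφ hf0 hφ0 hσ hσf (Nat.succ_pos n)
    (show 0 < min ρ ρ' by positivity) hC fun δ hδ hδ1 => ?_
  -- the width of the bumps is small enough for all estimates
  -- `14000000` is the constant in the bounds for the derivatives of a bump
  set B : ℝ := (n + 1) * (3 * K * 14000000) + 10 * (n + 1) + 3 * K + 1 with hB
  have hn0 : (0 : ℝ) ≤ n := Nat.cast_nonneg n
  have hB0 : 0 < B := by positivity
  set w := δ / B with hw
  have hw0 : 0 < w := by positivity
  have hBw : (n + 1) * (3 * K * 14000000) * w + 10 * ((n + 1) * w) + 3 * K * w + w = δ := by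
    have : B * w = δ := by rw [hw]; field_simp
    rw [← this, hB]; ring
  have q1 : 0 ≤ (n + 1) * (3 * K * 14000000) * w := by positivity
  have q2 : w ≤ (n + 1) * w := le_mul_of_one_le_left hw0.le (by linarith)
  have q3 : 0 ≤ K * w := by positivity
  have hw1 : w ≤ 1 := by linarith
  have hpw : ∀ j, 1 ≤ j → w ^ j ≤ w := fun j hj => by
    calc w ^ j ≤ w ^ 1 := pow_le_pow_of_le_one hw0.le hw1 hj
      _ = w := pow_one w
  -- the last contact is at `v = s w`: the lower arc departs from the origin in the direction `s`
  set c := s * w - w * (2 * n + 1) with hc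
  have hlast : c + w * (2 * n + 1) = s * w := by rw [hc]; ring
  have hsabs : |s * w| = w := by
    rw [abs_mul, abs_of_pos hw0]
    rcases hs with rfl | rfl <;> norm_num
  have hsw := abs_le.1 hsabs.le
  have hnw : 0 ≤ n * w := by positivity
  have hcl : -(w * (2 * n + 2)) ≤ c := by rw [hc]; linarith
  have hcr : c ≤ 0 := by rw [hc]; linarith
  have hcabs : |c| ≤ w * (2 * n + 2) := by rw [abs_le]; constructor <;> linarith
  set μ := knotZeros c w r (2 * n + 2) (m .upper) with hμ
  have hμm : ∀ i, |μ i| ≤ δ := fun i => by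
    have := knotZeros_mem (c := c) hw0 (show r ≤ 2 * n + 2 by omega) i
    push_cast at this
    rw [abs_le]
    constructor <;> linarith [this.1, this.2]
  -- the orbit passes the last knot at height `2 K w^5`, so that it passes the others at heights
  -- between `K w^5` and `3 K w^5`
  refine ⟨μ, s * w, 2 * K * w ^ 5, fun h => ?_, hμm, by rw [hsabs]; linarith, ?_,
    fun u₁ u₂ y hy hyv => ?_⟩
  · -- the first zero is an odd multiple of `w`
    have h1 : μ ⟨0, by omega⟩ = 0 := congrFun h _
    rw [hμ, knotZeros, if_pos hr0, hc] at h1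
    have h2 : w * (s - 2 * n) = 0 := by
      rw [← h1]; push_cast; ring
    have h3 : s = 2 * n := by
      rcases mul_eq_zero.1 h2 with h | h
      · exact absurd h hw0.ne'
      · linarith
    rcases hs with rfl | rfl
    · have : (1 : ℕ) = 2 * n := by exact_mod_cast h3
      omega
    · linarith
  · rw [abs_of_pos (by positivity)]
    have := mul_le_mul_of_nonneg_left (hpw 5 (by norm_num)) (show 0 ≤ 2 * K by positivity)
    linarith
  have hK5 : 0 < K * w ^ 5 := by positivity
  have hu₁ : u₁ < c := by linarith [hy.left]
  have hu₂ : c + w * (2 * n + 2) < u₂ := by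
    have : c + w * (2 * n + 2) ≤ δ := by linarith
    linarith [hy.right]
  have hlev := HE c w u₁ u₂ y hw0 hw1 hcabs hu₁ hu₂ hy.deriv
    (fun v hv => (hy.near v (Ioo_subset_Icc_self hv)).trans_le (min_le_right _ _))
    (by
      rw [hlast, hyv, abs_of_pos (by positivity)]
      have h1 : w ^ 5 ≤ w * w := by
        have := pow_le_pow_of_le_one hw0.le hw1 (show 2 ≤ 5 by norm_num)
        linarith [sq w]
      have h2 : 2 * K * w ^ 5 ≤ 2 * K * (w * w) := by gcongr
      have h3 : 2 * K * w ≤ 1 := by linarith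
      have h4 : 2 * K * (w * w) = (2 * K * w) * w := by ring
      have h5 := mul_le_mul_of_nonneg_right h3 hw0.le
      linarith)
  rw [hlast, hyv] at hlev
  have hg : ∀ v ∈ Ioo u₁ u₂, 0 < slopeFactor (f .upper) (φ .upper) σ (m .upper) (σ * v, y v) :=
    fun v hv => hpos _ ((hy.near v (Ioo_subset_Icc_self hv)).trans_le (min_le_left _ _))
  obtain ⟨hanti, hmin⟩ := knot_minima (g := fun v => slopeFactor (f .upper) (φ .upper) σ (m .upper)
    (σ * v, y v)) hw0 hu₁ hu₂ hr hrm hy.deriv hy.cont hg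
  have hH : ∀ i : Fin (n + 1), K * w ^ 5 ≤ y (c + w * (2 * i + 1)) ∧
      y (c + w * (2 * i + 1)) ≤ 3 * K * w ^ 5 := fun i => by
    have := abs_le.1 (hlev i)
    constructor <;> linarith [this.1, this.2]
  obtain ⟨k, hk, hψs, hψ0, hψ1, hψ2, htop, hle, hleft, hright⟩ := exists_bumps (Nat.succ_pos n) 0 1 hσ
    c hw0 hw1 (fun i : Fin (n + 1) => y (c + w * (2 * i + 1))) (M := 3 * K * w ^ 5)
    (fun i => hK5.le.trans (hH i).1) (fun i => (hH i).2)
  set ψ := psi (n + 1) (Nat.succ_pos n) 0 1 k with hψ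
  push_cast at hk hψ0 hψ1 hψ2 hright
  have hMw : 3 * K * w ^ 5 ≤ 3 * K * w :=
    mul_le_mul_of_nonneg_left (hpw 5 (by norm_num)) (by positivity)
  have hlastmem : c + w * (2 * n + 1) < u₂ := by linarith
  have htouch := touches_of_bumps hw0 hu₁ hlastmem htop hle hleft (fun u hu => ?_) hmin
  · refine ⟨k, ?_, hψs, fun x => (hψ0 x).trans ?_, fun x => (hψ1 x).trans ?_,
      fun x => (hψ2 x).trans ?_, fun x hx => ?_, _, htouch, ?_, ?_, ?_, hhit _ (fun h => ?_)
      (fun h => ?_)⟩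
    · linarith
    · calc ((n : ℝ) + 1) * (3 * K * w ^ 5) ≤ (n + 1) * (3 * K * w) := by gcongr
        _ ≤ (n + 1) * (3 * K * 14000000) * w := by
          have : 0 ≤ (n + 1) * (3 * K * w) := by positivity
          linarith
        _ ≤ δ := by linarith
    · have h1 : w ^ 5 * (14000000 / w ^ 2) = 14000000 * w ^ 3 := by field_simp
      calc ((n : ℝ) + 1) * (3 * K * w ^ 5 * (14000000 / w ^ 2))
          = (n + 1) * (3 * K * (w ^ 5 * (14000000 / w ^ 2))) := by ring
        _ = (n + 1) * (3 * K * 14000000) * w ^ 3 := by rw [h1]; ring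
        _ ≤ (n + 1) * (3 * K * 14000000) * w :=
          mul_le_mul_of_nonneg_left (hpw 3 (by norm_num)) (by positivity)
        _ ≤ δ := by linarith
    · have h1 : w ^ 5 * (14000000 / w ^ 4) = 14000000 * w := by field_simp
      calc ((n : ℝ) + 1) * (3 * K * w ^ 5 * (14000000 / w ^ 4))
          = (n + 1) * (3 * K * (w ^ 5 * (14000000 / w ^ 4))) := by ring
        _ = (n + 1) * (3 * K * 14000000) * w := by rw [h1]; ring
        _ ≤ δ := by linarith
    · have hxa : δ ≤ |σ * x| := by rw [abs_mul, hσabs, one_mul]; exact hx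
      rw [← hσv x]
      rcases le_total 0 (σ * x) with h | h
      · rw [abs_of_nonneg h] at hxa
        exact hright _ (by linarith)
      · rw [abs_of_nonpos h] at hxa
        exact hleft _ (by linarith)
    · simp only [Fin.val_last]
      rw [hlast, hsabs]; linarith
    · simp only [Fin.val_last]
      rw [hlast]
      have := mul_pos hsf hw0
      linarith
    · simp only [Fin.val_last]
      -- the last contact is at the top of the last bump
      refine IsLocalMax.deriv_eq_zero (f := ψ) ?_
      have h1 := htop (Fin.last n)
      simp only [Fin.val_last] at h1
      have h2 : σ * (σ * (c + w * (2 * n + 1))) ∈ Ioo (c + w * (2 * n)) (c + w * (2 * n + 2)) := by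
        rw [hσv]; constructor <;> linarith
      have h3 : Continuous fun x : ℝ => σ * x := by fun_prop
      filter_upwards [h3.continuousAt.preimage_mem_nhds (Ioo_mem_nhds h2.1 h2.2)] with x hx
      have h4 := hle (Fin.last n) (σ * x) (Ioo_subset_Icc_self (by simpa using hx))
      rw [hσv] at h4
      simp only [Fin.val_last] at h4
      rw [h1]; exact h4
    · refine Finset.prod_eq_zero (i := (⟨2 * n, by omega⟩ : Fin (m .upper))) (Finset.mem_univ _) ?_
      rw [hμ, knotZeros, if_pos (show 2 * n < r by omega)]
      simp only [Fin.val_last]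
      push_cast; ring
    · have := prod_sub_sign (m := m .upper) (j := 2 * n) (by omega) (μ := μ)
        (v := c + w * (2 * n + 1)) (fun i hi => ?_) (fun i hi => ?_)
      · rw [Even.neg_one_pow ⟨n, by ring⟩, one_mul] at this
        simpa only [Fin.val_last] using this
      · rw [hμ, knotZeros, if_pos (by omega)]
        have h1 : ((i : ℕ) : ℝ) + 1 ≤ 2 * n := by exact_mod_cast hi
        linarith [mul_le_mul_of_nonneg_left h1 hw0.le]
      · rw [hμ, knotZeros, if_neg (by omega)]
        push_cast; linarith
  · have h1 : (0 : ℝ) < y (c + w) := by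
      have := (hH 0).1
      simp only [Fin.val_zero, Nat.cast_zero, mul_zero, zero_add, mul_one] at this
      linarith
    have h2 := hanti ⟨hu.1, by linarith [hu.2]⟩ ⟨by linarith, le_rfl⟩ (by linarith [hu.2] : u < c + w)
    linarith

/-! ### A crossing loop with a single tangent point -/

/-- The zeros for a single return to the switching line: two of them at distance `w` and the
others at `R`, far away. -/
def pairZeros (b w R : ℝ) (m : ℕ) (i : Fin m) : ℝ :=
  if (i : ℕ) = 0 then b else if (i : ℕ) = 1 then b + w else R

theorem prod_pairZeros (b w R v : ℝ) {m k : ℕ} (hm : m = k + 2) :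
    ∏ i, (pairZeros b w R m i - v) = (v - b) * (v - (b + w)) * (R - v) ^ k := by
  subst hm
  rw [Fin.prod_univ_succ, Fin.prod_univ_succ]
  have : ∀ i : Fin k, pairZeros b w R (k + 2) i.succ.succ = R := fun i => by simp [pairZeros]
  simp only [this, Finset.prod_const, Finset.card_univ, Fintype.card_fin]
  simp [pairZeros]
  ring

/-- A curve that starts on the axis at the first of two close zeros rises by `O(w^3)` up to the
second one and returns to the axis, transversely, within a distance `O(w)`. -/
theorem exists_first_return {g y : ℝ → ℝ} {b w R u₁ u₂ g₀ g₁ D : ℝ} {m k : ℕ}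
    (hm : m = k + 2) (hw : 0 < w) (hg₀ : 0 < g₀) (hg₁ : 0 < g₁) (hR : 0 < R) (hbR : |b| + D * w ≤ R / 2)
    (hD : g₁ * (2 * R) ^ k < g₀ * (R / 2) ^ k * (D - 2)) (hD2 : 2 < D)
    (hu₁ : u₁ < b) (hu₂ : b + D * w < u₂)
    (hyd : ∀ v ∈ Ioo u₁ u₂, HasDerivAt y (-(g v * ∏ i, (pairZeros b w R m i - v))) v)
    (hyc : ContinuousOn y (Icc u₁ u₂)) (hg : ∀ v ∈ Ioo u₁ u₂, g₀ ≤ g v ∧ g v ≤ g₁) (hyb : y b = 0) :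
    ∃ q, b + w < q ∧ q < b + D * w ∧ y q = 0 ∧ (∀ v ∈ Icc u₁ q, 0 ≤ y v) ∧
      (∀ v ∈ Icc u₁ q, y v = 0 ↔ v = b ∨ v = q) := by
  have hDw : 2 * w < D * w := mul_lt_mul_of_pos_right hD2 hw
  have hbl := neg_abs_le b
  have hbr := le_abs_self b
  have hder : ∀ v ∈ Ioo u₁ u₂, deriv y v = -(g v * ((v - b) * (v - (b + w)) * (R - v) ^ k)) :=
    fun v hv => by rw [(hyd v hv).deriv, prod_pairZeros _ _ _ _ hm]
  have hRv : ∀ v, v ≤ b + D * w → 0 < R - v := fun v hv => by linarith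
  have hc : ∀ p q, u₁ ≤ p → q ≤ u₂ → ContinuousOn y (Icc p q) := fun p q h1 h2 =>
    hyc.mono (Icc_subset_Icc h1 h2)
  -- decreasing before `b`, increasing between the two zeros, then decreasing again
  have h1 : StrictAntiOn y (Icc u₁ b) := by
    refine strictAntiOn_of_deriv_neg (convex_Icc _ _) (hc _ _ le_rfl (by linarith)) fun v hv => ?_
    rw [interior_Icc] at hv
    have hv' : v ∈ Ioo u₁ u₂ := ⟨hv.1, by linarith [hv.2]⟩
    rw [hder v hv']
    have h3 := pow_pos (hRv v (by linarith [hv.2])) k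
    have h4 : 0 < (v - b) * (v - (b + w)) :=
      mul_pos_of_neg_of_neg (by linarith [hv.2]) (by linarith [hv.2])
    have := mul_pos (hg₀.trans_le (hg v hv').1) (mul_pos h4 h3)
    linarith
  have h2 : StrictMonoOn y (Icc b (b + w)) := by
    refine strictMonoOn_of_deriv_pos (convex_Icc _ _) (hc _ _ hu₁.le (by linarith)) fun v hv => ?_
    rw [interior_Icc] at hv
    have hv' : v ∈ Ioo u₁ u₂ := ⟨by linarith [hv.1], by linarith [hv.2]⟩
    rw [hder v hv']
    have h3 := pow_pos (hRv v (by linarith [hv.2])) k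
    have h4 : (v - b) * (v - (b + w)) < 0 :=
      mul_neg_of_pos_of_neg (by linarith [hv.1]) (by linarith [hv.2])
    have := mul_neg_of_pos_of_neg (hg₀.trans_le (hg v hv').1) (mul_neg_of_neg_of_pos h4 h3)
    linarith
  have h3 : StrictAntiOn y (Icc (b + w) (b + D * w)) := by
    refine strictAntiOn_of_deriv_neg (convex_Icc _ _) (hc _ _ (by linarith) hu₂.le) fun v hv => ?_
    rw [interior_Icc] at hv
    have hv' : v ∈ Ioo u₁ u₂ := ⟨by linarith [hv.1], by linarith [hv.2]⟩
    rw [hder v hv']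
    have h3 := pow_pos (hRv v hv.2.le) k
    have h4 : 0 < (v - b) * (v - (b + w)) :=
      mul_pos (by linarith [hv.1]) (by linarith [hv.1])
    have := mul_pos (hg₀.trans_le (hg v hv').1) (mul_pos h4 h3)
    linarith
  have hpk : ∀ v, b ≤ v → v ≤ b + D * w → (R / 2) ^ k ≤ (R - v) ^ k ∧ (R - v) ^ k ≤ (2 * R) ^ k :=
    fun v h h' => ⟨pow_le_pow_left₀ (by linarith) (by linarith) k,
      pow_le_pow_left₀ (by linarith) (by linarith) k⟩
  have hRk : 0 < (R / 2) ^ k := by positivity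
  -- the rise
  have hrise : y (b + w) ≤ g₁ * (2 * R) ^ k * w ^ 3 := by
    have := (convex_Icc b (b + w)).image_sub_le_mul_sub_of_deriv_le (f := y)
      (C := g₁ * (2 * R) ^ k * w ^ 2) (hc _ _ hu₁.le (by linarith))
      (fun v hv => by
        rw [interior_Icc] at hv
        exact (hyd v ⟨by linarith [hv.1], by linarith [hv.2]⟩).differentiableAt.differentiableWithinAt)
      (fun v hv => by
        rw [interior_Icc] at hv
        have hv' : v ∈ Ioo u₁ u₂ := ⟨by linarith [hv.1], by linarith [hv.2]⟩
        rw [hder v hv']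
        have e1 := (hpk v hv.1.le (by linarith [hv.2])).2
        have e2 : 0 ≤ (R - v) ^ k := (hRk.le).trans (hpk v hv.1.le (by linarith [hv.2])).1
        have e3 : (v - b) * (b + w - v) ≤ w * w :=
          mul_le_mul (by linarith [hv.2]) (by linarith [hv.1]) (by linarith [hv.2]) hw.le
        have e4 : 0 ≤ (v - b) * (b + w - v) :=
          mul_nonneg (by linarith [hv.1]) (by linarith [hv.2])
        calc -(g v * ((v - b) * (v - (b + w)) * (R - v) ^ k))
            = g v * (R - v) ^ k * ((v - b) * (b + w - v)) := by ring
          _ ≤ g₁ * (2 * R) ^ k * (w * w) := by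
            refine mul_le_mul (mul_le_mul (hg v hv').2 e1 e2 hg₁.le) e3 e4 (by positivity)
          _ = _ := by ring)
      b ⟨le_rfl, by linarith⟩ (b + w) ⟨by linarith, le_rfl⟩ (by linarith)
    rw [hyb] at this
    calc y (b + w) = y (b + w) - 0 := by ring
      _ ≤ _ := this
      _ = _ := by ring
  -- the fall
  have hfall : y (b + D * w) < 0 := by
    have := (convex_Icc (b + 2 * w) (b + D * w)).image_sub_le_mul_sub_of_deriv_le (f := y)
      (C := -(g₀ * (R / 2) ^ k * w ^ 2)) (hc _ _ (by linarith) hu₂.le)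
      (fun v hv => by
        rw [interior_Icc] at hv
        exact (hyd v ⟨by linarith [hv.1], by linarith [hv.2]⟩).differentiableAt.differentiableWithinAt)
      (fun v hv => by
        rw [interior_Icc] at hv
        have hv' : v ∈ Ioo u₁ u₂ := ⟨by linarith [hv.1], by linarith [hv.2]⟩
        rw [hder v hv']
        have e1 := (hpk v (by linarith [hv.1]) hv.2.le).1
        have e3 : w * w ≤ (v - b) * (v - (b + w)) :=
          mul_le_mul (by linarith [hv.1]) (by linarith [hv.1]) hw.le (by linarith [hv.1])
        have : g₀ * (R / 2) ^ k * (w * w) ≤ g v * (R - v) ^ k * ((v - b) * (v - (b + w))) :=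
          mul_le_mul (mul_le_mul (hg v hv').1 e1 hRk.le (hg₀.le.trans (hg v hv').1)) e3
            (by positivity) (mul_nonneg (hg₀.le.trans (hg v hv').1) (hRk.le.trans e1))
        linarith)
      (b + 2 * w) ⟨le_rfl, by linarith⟩ (b + D * w) ⟨by linarith, le_rfl⟩ (by linarith)
    have h4 : y (b + 2 * w) < y (b + w) :=
      h3 ⟨le_rfl, by linarith⟩ ⟨by linarith, by linarith⟩ (by linarith)
    have h5 := mul_lt_mul_of_pos_right hD (pow_pos hw 3)
    have h6 : -(g₀ * (R / 2) ^ k * w ^ 2) * (b + D * w - (b + 2 * w)) =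
      -(g₀ * (R / 2) ^ k * (D - 2) * w ^ 3) := by ring
    linarith
  have hpos : 0 < y (b + w) := by
    rw [← hyb]; exact h2 ⟨le_rfl, by linarith⟩ ⟨by linarith, le_rfl⟩ (by linarith)
  obtain ⟨q, hq, hyq⟩ := intermediate_value_Ioo' (by linarith : b + w ≤ b + D * w)
    (hc _ _ (by linarith) hu₂.le) (show (0 : ℝ) ∈ Ioo _ _ from ⟨hfall, hpos⟩)
  have hsign : ∀ v ∈ Icc u₁ q, v ≠ b → v ≠ q → 0 < y v := fun v hv hvb hvq => by
    rcases lt_or_gt_of_ne hvb with h | h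
    · rw [← hyb]; exact h1 ⟨hv.1, h.le⟩ ⟨hu₁.le, le_rfl⟩ h
    rcases le_total v (b + w) with h' | h'
    · rw [← hyb]; exact h2 ⟨le_rfl, by linarith⟩ ⟨h.le, h'⟩ h
    · rw [← hyq]
      exact h3 ⟨h', by linarith [hv.2, hq.2]⟩ ⟨hq.1.le, hq.2.le⟩ (lt_of_le_of_ne hv.2 hvq)
  refine ⟨q, hq.1, hq.2, hyq, fun v hv => ?_, fun v hv => ⟨fun h => ?_, ?_⟩⟩
  · by_cases hb : v = b
    · rw [hb, hyb]
    by_cases hq' : v = q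
    · rw [hq', hyq]
    exact (hsign v hv hb hq').le
  · by_contra hn
    rw [not_or] at hn
    exact (hsign v hv hn.1 hn.2).ne' h
  · rintro (rfl | rfl)
    · exact hyb
    · exact hyq

theorem psi_zero {d : ℕ} (hd : 0 < d) (r₁ r₂ : ℝ) :
    psi d hd r₁ r₂ (0 : Fin (3 * d + 1) → ℝ) = fun _ => 0 := by
  funext x
  have hk : (0 : Fin (3 * d + 1) → ℝ) ∉ paramK d := fun hk => by
    have := hk ⟨0, by omega⟩
    simp at this
  rw [psi, if_neg hk]
  simp

set_option maxHeartbeats 1000000 in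
/-- One tangency followed by a crossing, with the switching line unchanged near the origin. -/
theorem Arcs.bifurcatesFrom_isCro_one {f φ : Side → ℝ × ℝ → ℝ} {m : Side → ℕ}
    {U : Set (ℝ × ℝ)} {a : ℝ}
    (A : Arcs (baseSystem f φ m) U a) (hUo : IsOpen U) (hUb : Bornology.IsBounded U)
    (hU0 : ((0 : ℝ), (0 : ℝ)) ∈ U) (hf : ∀ s, ContDiff ℝ ∞ (f s)) (hφ : ∀ s, ContDiff ℝ ∞ (φ s))
    (hf0 : ∀ s, f s (0, 0) ≠ 0) (hφ0 : ∀ s, φ s (0, 0) ≠ 0)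
    {σ : ℝ} (hσ : σ = 1 ∨ σ = -1) {ρ g₀ g₁ : ℝ} (hρ : 0 < ρ) (hσf : 0 < σ * f .upper (0, 0))
    (hg₀ : 0 < g₀) (hg₀₁ : g₀ ≤ g₁)
    (hg : ∀ z, dist z ((0 : ℝ), (0 : ℝ)) < ρ → g₀ ≤ slopeFactor (f .upper) (φ .upper) σ (m .upper) z ∧
      slopeFactor (f .upper) (φ .upper) σ (m .upper) z ≤ g₁)
    (hm : 2 ≤ m .upper) :
    BifurcatesFrom U f φ m A.carrier (fun _ L => L.IsCro) 1 := by
  have hσσ := mul_self_of_sign hσ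
  obtain ⟨k, hk⟩ : ∃ k, m .upper = k + 2 := ⟨m .upper - 2, by omega⟩
  obtain ⟨s, hs, hsf⟩ : ∃ s : ℝ, (s = 1 ∨ s = -1) ∧ 0 < f .lower (0, 0) * (σ * s) := by
    have hσ0 : σ ≠ 0 := fun h => by rw [h, zero_mul] at hσσ; exact absurd hσσ (by norm_num)
    rcases lt_or_gt_of_ne (mul_ne_zero (hf0 .lower) hσ0) with h | h
    · exact ⟨-1, Or.inr rfl, by linarith⟩
    · exact ⟨1, Or.inl rfl, by linarith⟩
  refine A.bifurcatesFrom_of_touches (n := 1) (d := 1) (hit := fun p => 0 < p) hUo hUb hU0 hf hφ hf0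
    hφ0 hσ hσf one_pos hρ (fun p S L hp h1 _ => by simpa using h1 hp one_pos) fun δ hδ hδ1 => ?_
  have hg₁ : 0 < g₁ := hg₀.trans_le hg₀₁
  -- within `D w` the fall beyond the second zero outweighs the rise between the zeros
  set D := 3 + g₁ * (2 * δ) ^ k / (g₀ * (δ / 2) ^ k) with hD
  have hq0 : 0 < g₁ * (2 * δ) ^ k / (g₀ * (δ / 2) ^ k) := by positivity
  have hD3 : 3 < D := by linarith
  have hDD : g₁ * (2 * δ) ^ k < g₀ * (δ / 2) ^ k * (D - 2) := by
    have h1 : g₀ * (δ / 2) ^ k * (D - 2) = g₀ * (δ / 2) ^ k + g₁ * (2 * δ) ^ k := by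
      rw [hD]; field_simp; ring
    have h2 : 0 < g₀ * (δ / 2) ^ k := by positivity
    linarith
  -- the pair of zeros lies entirely on the side from which the lower orbit departs
  set w := δ / (8 * D) with hw
  have hw0 : 0 < w := by positivity
  have hDw : D * w = δ / 8 := by rw [hw]; field_simp
  have hw3 : 3 * w < D * w := mul_lt_mul_of_pos_right hD3 hw0
  set b := if s = 1 then w else -(D * w) with hb
  have hb0 : b ≠ 0 := by
    rw [hb]; split_ifs
    · exact hw0.ne'
    · linarith
  have hbabs : |b| ≤ D * w := by
    rw [hb]; split_ifs
    · rw [abs_of_pos hw0]; linarith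
    · rw [abs_neg, abs_of_pos (by linarith)]
  have hb' := abs_le.1 hbabs
  refine ⟨pairZeros b w δ (m .upper), b, 0, fun h => ?_, fun i => ?_, by linarith, by simpa using hδ.le,
    fun u₁ u₂ y hy hyb => ?_⟩
  · have h1 : pairZeros b w δ (m .upper) ⟨0, by omega⟩ = 0 := congrFun h _
    exact hb0 (by simpa [pairZeros] using h1)
  · rw [pairZeros]
    split_ifs
    · linarith
    · rw [abs_le]; constructor <;> linarith
    · rw [abs_of_pos hδ]
  obtain ⟨q, hq1, hq2, hyq, hnonneg, hzero⟩ := exists_first_return (D := D) hk hw0 hg₀ hg₁ hδ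
    (by linarith) hDD (by linarith) (by linarith [hy.left]) (by linarith [hy.right]) hy.deriv hy.cont
    (fun v hv => hg _ (hy.near v (Ioo_subset_Icc_self hv))) hyb
  refine ⟨0, by simpa using hδ.le, ?_⟩
  rw [psi_zero]
  have hsq : 0 < s * q := by
    rcases hs with rfl | rfl
    · have : b = w := if_pos rfl
      linarith
    · have : b = -(D * w) := if_neg (by norm_num)
      linarith
  refine ⟨contDiff_const, fun x => by simpa using hδ.le, fun x => by simpa using hδ.le,
    fun x => by simpa using hδ.le, fun x _ => rfl, ![b, q], ⟨?_, ?_, ?_, ?_⟩, ?_, ?_, by simp, ?_⟩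
  · intro i j hij
    fin_cases i <;> fin_cases j <;> simp at hij ⊢
    linarith
  · intro i
    fin_cases i
    · constructor <;> simp <;> linarith [hy.left, hy.right]
    · constructor <;> simp <;> linarith [hy.left, hy.right]
  · exact fun v hv => hnonneg v hv
  · intro v hv
    have := hzero v hv
    simp only [this, mem_range]
    simp [eq_comm]
  · change |q| < δ
    rw [abs_lt]; constructor <;> linarith
  · change 0 < f .lower (0, 0) * (σ * q)
    have h1 := mul_pos hsf hsq
    have h2 : s * s = 1 := mul_self_of_sign hs
    calc (0 : ℝ) < f .lower (0, 0) * (σ * s) * (s * q) := h1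
      _ = f .lower (0, 0) * (σ * q) * (s * s) := by ring
      _ = _ := by rw [h2, mul_one]
  · change 0 < ∏ i, (pairZeros b w δ (m .upper) i - q)
    rw [prod_pairZeros _ _ _ _ hk]
    exact mul_pos (mul_pos (by linarith) (by linarith)) (pow_pos (by linarith) k)

/-! ### All numbers of tangent points on both sides -/

theorem exists_direction {F : ℝ} (hF : F ≠ 0) : ∃ σ : ℝ, (σ = 1 ∨ σ = -1) ∧ 0 < σ * F := by
  rcases lt_or_gt_of_ne hF with h | h
  · exact ⟨-1, Or.inr rfl, by linarith⟩
  · exact ⟨1, Or.inl rfl, by linarith⟩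

section upper

variable {f φ : Side → ℝ × ℝ → ℝ} {m : Side → ℕ} {U : Set (ℝ × ℝ)} {a : ℝ}

/-- Crossing loops: for `ℓ ≥ 2` there are at least four zeros, and `ℓ + 1` bumps touch the orbit, the
last one transversely; for `ℓ = 1` no bump is needed. -/
theorem Arcs.bifurcatesFrom_isCro (A : Arcs (baseSystem f φ m) U a) (hUo : IsOpen U)
    (hUb : Bornology.IsBounded U) (hU0 : ((0 : ℝ), (0 : ℝ)) ∈ U) (hf : ∀ s, ContDiff ℝ ∞ (f s))
    (hφ : ∀ s, ContDiff ℝ ∞ (φ s)) (hf0 : ∀ s, f s (0, 0) ≠ 0) (hφ0 : ∀ s, φ s (0, 0) ≠ 0)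
    {ℓ : ℕ} (hℓ : 1 ≤ ℓ) (hm : 2 * ℓ ≤ m .upper) :
    BifurcatesFrom U f φ m A.carrier (fun _ L => L.IsCro) ℓ := by
  obtain ⟨σ, hσ, hσf⟩ := exists_direction (hf0 .upper)
  obtain ⟨ρ, f₀, g₀, g₁, L, hρ, -, hg₀, hg₀₁, -, hb⟩ := exists_slopeFactor_bounds (hf .upper)
    (hφ .upper) hσf (A.upper_sign_of_direction (hφ .upper).continuous (hφ0 .upper) hσ hσf)
  have hpos : ∀ z, dist z ((0 : ℝ), (0 : ℝ)) < ρ →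
      0 < slopeFactor (f .upper) (φ .upper) σ (m .upper) z := fun z hz =>
    hg₀.trans_le (hb z hz).2.1
  rcases hℓ.eq_or_lt with rfl | h2
  · exact A.bifurcatesFrom_isCro_one hUo hUb hU0 hf hφ hf0 hφ0 hσ hρ hσf hg₀ hg₀₁
      (fun z hz => ⟨(hb z hz).2.1, (hb z hz).2.2.1⟩) hm
  · refine A.bifurcatesFrom_of_levelBound (n := ℓ) (r := 2 * ℓ) (hit := fun p => 0 < p) hUo hUb hU0
      hf hφ hf0 hφ0 hσ hρ hσf hpos (fun p S L hp h1 _ => h1 hp (by omega)) le_rfl (by omega)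
      (by omega) hm (fun p _ h => h rfl) ?_
    exact levelBound_of_four_le hρ (hg₀.trans_le hg₀₁)
      (fun z hz => by rw [abs_of_pos (hpos z hz)]; exact (hb z hz).2.2.1) σ (by omega) (by omega)

/-- Critical loops: `ℓ` bumps touch the orbit. Unless `ℓ = 1`, there are at least four zeros, or three
equidistant ones. -/
theorem Arcs.bifurcatesFrom_isCri (A : Arcs (baseSystem f φ m) U a) (hUo : IsOpen U)
    (hUb : Bornology.IsBounded U) (hU0 : ((0 : ℝ), (0 : ℝ)) ∈ U) (hf : ∀ s, ContDiff ℝ ∞ (f s))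
    (hφ : ∀ s, ContDiff ℝ ∞ (φ s)) (hf0 : ∀ s, f s (0, 0) ≠ 0) (hφ0 : ∀ s, φ s (0, 0) ≠ 0)
    {ℓ : ℕ} (hℓ : 1 ≤ ℓ) (hm : 2 * ℓ ≤ m .upper + 1) :
    BifurcatesFrom U f φ m A.carrier (fun _ L => L.IsCri) ℓ := by
  obtain ⟨σ, hσ, hσf⟩ := exists_direction (hf0 .upper)
  obtain ⟨ρ, f₀, g₀, g₁, L, hρ, -, hg₀, hg₀₁, hL, hb⟩ := exists_slopeFactor_bounds (hf .upper)
    (hφ .upper) hσf (A.upper_sign_of_direction (hφ .upper).continuous (hφ0 .upper) hσ hσf)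
  have hpos : ∀ z, dist z ((0 : ℝ), (0 : ℝ)) < ρ →
      0 < slopeFactor (f .upper) (φ .upper) σ (m .upper) z := fun z hz =>
    hg₀.trans_le (hb z hz).2.1
  have habs : ∀ z, dist z ((0 : ℝ), (0 : ℝ)) < ρ →
      |slopeFactor (f .upper) (φ .upper) σ (m .upper) z| ≤ g₁ := fun z hz => by
    rw [abs_of_pos (hpos z hz)]; exact (hb z hz).2.2.1
  obtain ⟨n, rfl⟩ : ∃ n, ℓ = n + 1 := ⟨ℓ - 1, by omega⟩
  refine A.bifurcatesFrom_of_levelBound (n := n) (r := 2 * n + 1) (hit := fun p => p = 0) hUo hUb hU0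
    hf hφ hf0 hφ0 hσ hρ hσf hpos (fun p S L hp _ h2 => h2 hp) (by omega) le_rfl
    (by omega) (by omega) (fun p h _ => h rfl) ?_
  rcases n.eq_zero_or_pos with rfl | hn
  · exact levelBound_zero _ _ _ _
  rcases (show 3 ≤ m .upper by omega).eq_or_lt with h3 | h4
  · obtain rfl : n = 1 := by omega
    have hthree := levelBound_three hρ (hg₀.trans_le hg₀₁) hL
      (fun z hz => ⟨habs z hz, (hb z hz).2.2.2⟩) hσ
    rw [← h3] at hthree ⊢
    exact hthree
  · exact levelBound_of_four_le hρ (hg₀.trans_le hg₀₁) habs σ (by omega) h4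

end upper

theorem mirror_preimage_preimage (K : Set (ℝ × ℝ)) : mirror ⁻¹' (mirror ⁻¹' K) = K := by
  ext p; simp only [mem_preimage, mirror_mirror]

theorem isBounded_mirror {U : Set (ℝ × ℝ)} (hU : Bornology.IsBounded U) :
    Bornology.IsBounded (mirror ⁻¹' U) := by
  have : mirror ⁻¹' U = mirror '' U := by
    ext p
    exact ⟨fun hp => ⟨mirror p, hp, mirror_mirror p⟩, by
      rintro ⟨q, hq, rfl⟩; rw [mem_preimage, mirror_mirror]; exact hq⟩
  rw [this]
  exact mirror.lipschitz.isBounded_image hU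

/-- A property of loops that is stable under reflection bifurcates from the loop if it bifurcates
from its reflection. -/
theorem BifurcatesFrom.of_reflect {f φ : Side → ℝ × ℝ → ℝ} {m : Side → ℕ} {U K : Set (ℝ × ℝ)}
    {C : (S : PWS) → (U : Set (ℝ × ℝ)) → Loop S U → Prop}
    (hC : ∀ S U (L : Loop S U), C S U L → C S.reflect (mirror ⁻¹' U) L.reflect) {ℓ : ℕ}
    (h : BifurcatesFrom (mirror ⁻¹' U) (-flipComp f) (flipComp φ) (m ∘ Side.flip) (mirror ⁻¹' K)
      (fun S L => C S _ L) ℓ) :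
    BifurcatesFrom U f φ m K (fun S L => C S _ L) ℓ := by
  have h1 := h.reflect (C' := fun S L => C S _ L) (fun S L => hC S _ L)
  have e1 : -flipComp (-flipComp f) = f := by funext s p; simp [flipComp]
  have e2 : (m ∘ Side.flip) ∘ Side.flip = m := by funext s; simp
  rw [e1, e2, flipComp_flipComp] at h1
  have e3 := mirror_preimage_preimage U
  rw [mirror_preimage_preimage K] at h1
  rwa [e3] at h1

section both

variable {f φ : Side → ℝ × ℝ → ℝ} {m : Side → ℕ} {U : Set (ℝ × ℝ)} {a : ℝ}

/-- By reflection, one side can be exchanged for the other. -/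
theorem Arcs.bifurcatesFrom_of_upper {C : (S : PWS) → (U : Set (ℝ × ℝ)) → Loop S U → Prop}
    (hC : ∀ S U (L : Loop S U), C S U L → C S.reflect (mirror ⁻¹' U) L.reflect) {ℓ b c : ℕ}
    (hupper : ∀ (f φ : Side → ℝ × ℝ → ℝ) (m : Side → ℕ) (U : Set (ℝ × ℝ))
      (A : Arcs (baseSystem f φ m) U a), IsOpen U → Bornology.IsBounded U →
      ((0 : ℝ), (0 : ℝ)) ∈ U → (∀ s, ContDiff ℝ ∞ (f s)) → (∀ s, ContDiff ℝ ∞ (φ s)) →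
      (∀ s, f s (0, 0) ≠ 0) → (∀ s, φ s (0, 0) ≠ 0) → b ≤ m .upper + c →
      BifurcatesFrom U f φ m A.carrier (fun S L => C S _ L) ℓ)
    (A : Arcs (baseSystem f φ m) U a) (hUo : IsOpen U)
    (hUb : Bornology.IsBounded U) (hU0 : ((0 : ℝ), (0 : ℝ)) ∈ U) (hf : ∀ s, ContDiff ℝ ∞ (f s))
    (hφ : ∀ s, ContDiff ℝ ∞ (φ s)) (hf0 : ∀ s, f s (0, 0) ≠ 0) (hφ0 : ∀ s, φ s (0, 0) ≠ 0)
    (hm : b ≤ max (m .upper) (m .lower) + c) :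
    BifurcatesFrom U f φ m A.carrier (fun S L => C S _ L) ℓ := by
  rcases le_total (m .lower) (m .upper) with h | h
  · exact hupper f φ m U A hUo hUb hU0 hf hφ hf0 hφ0 (by rwa [max_eq_left h] at hm)
  · refine BifurcatesFrom.of_reflect hC ?_
    rw [← A.carrier_reflect]
    refine hupper (-flipComp f) (flipComp φ) (m ∘ Side.flip) (mirror ⁻¹' U) A.reflect
      (hUo.preimage mirror.continuous) (isBounded_mirror hUb) (by simpa using hU0)
      (fun s => ((hf s.flip).comp (contDiff_fst.prodMk contDiff_snd.neg)).neg)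
      (fun s => (hφ s.flip).comp (contDiff_fst.prodMk contDiff_snd.neg))
      (fun s => by simpa [flipComp] using hf0 s.flip) (fun s => by simpa [flipComp] using hφ0 s.flip) ?_
    rw [max_eq_right h] at hm
    exact hm

end both

end Filippov

theorem theorem3 (U : Set (ℝ × ℝ)) (hUo : IsOpen U) (hUb : Bornology.IsBounded U)
    (hU0 : ((0 : ℝ), (0 : ℝ)) ∈ U)
    (f φ : Filippov.Side → ℝ × ℝ → ℝ) (m : Filippov.Side → ℕ)
    (hf : ∀ s, ContDiff ℝ ∞ (f s)) (hφ : ∀ s, ContDiff ℝ ∞ (φ s))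
    (hf0 : ∀ s, f s (0, 0) ≠ 0) (hφ0 : ∀ s, φ s (0, 0) ≠ 0)
    (hm : 1 ≤ m .upper + m .lower)
    (L₀ : Filippov.Loop (Filippov.baseSystem f φ m) U) (Px : ℝ) (hL₀ : L₀.HypH Px) :
    ((max (m .upper) (m .lower) = 1 →
        ∃ ε : ℝ, 0 < ε ∧ ∀ S : Filippov.PWS, S.Smooth →
          Filippov.rho U (Filippov.baseSystem f φ m) S < ε →
          ∀ L : Filippov.Loop S U, L.carrier ⊆ Metric.thickening ε L₀.carrier → ¬ L.IsCro) ∧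
      (max (m .upper) (m .lower) ≠ 1 →
        ∀ ℓ : ℕ, 1 ≤ ℓ → ℓ ≤ max (m .upper) (m .lower) / 2 →
          Filippov.Bifurcates U f φ m L₀ (fun _ L => L.IsCro) ℓ)) ∧
    (∀ ℓ : ℕ, 1 ≤ ℓ → ℓ ≤ (max (m .upper) (m .lower) + 1) / 2 →
      Filippov.Bifurcates U f φ m L₀ (fun _ L => L.IsCri) ℓ) := by
  obtain ⟨A, hA⟩ := hL₀.exists_arcs
  refine ⟨⟨fun h1 => ?_, fun h1 ℓ hℓ hℓm => ?_⟩, fun ℓ hℓ hℓm => ?_⟩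
  · rw [← hA]
    refine A.no_cro hUo hUb hU0 hf hφ hf0 hφ0 fun s => ?_
    cases s
    · exact (le_max_left _ _).trans h1.le
    · exact (le_max_right _ _).trans h1.le
  · change Filippov.BifurcatesFrom U f φ m L₀.carrier _ ℓ
    rw [← hA]
    exact A.bifurcatesFrom_of_upper (C := fun _ _ L => L.IsCro) (b := 2 * ℓ) (c := 0)
      (fun _ _ _ h => h.reflect)
      (fun f φ m U A h1 h2 h3 h4 h5 h6 h7 h8 => A.bifurcatesFrom_isCro h1 h2 h3 h4 h5 h6 h7 hℓ h8)
      hUo hUb hU0 hf hφ hf0 hφ0 (by omega)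
  · change Filippov.BifurcatesFrom U f φ m L₀.carrier _ ℓ
    rw [← hA]
    exact A.bifurcatesFrom_of_upper (C := fun _ _ L => L.IsCri) (b := 2 * ℓ) (c := 1)
      (fun _ _ _ h => h.reflect)
      (fun f φ m U A h1 h2 h3 h4 h5 h6 h7 h8 => A.bifurcatesFrom_isCri h1 h2 h3 h4 h5 h6 h7 hℓ h8)
      hUo hUb hU0 hf hφ hf0 hφ0 (by omega)
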